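/- Let $N\ge 4$ and let $\Sigma$ be a smooth manifold of dimension $N-1$ (Hausdorff, $\sigma$-compact, without boundary). Let $\mathcal V\to\Sigma$ be a smooth vector bundle of rank $N$ with a smooth fibrewise Lorentzian inner product $\eta$ of signature $(N-1,1)$, and let $e\colon T\Sigma\to\mathcal V$ be a smooth injective bundle map (coframe) whose induced metric $g=\eta(e,e)$ is light-like: there is a nowhere vanishing smooth vector field $X$ with $\iota_Xg=0$. Write $\Omega^{i,j}_\partial=\Omega^i(\Sigma,\bigwedge^j\mathcal V)$ (smooth forms), products being wedge products in both the form part and the internal part; $W_k^{(i,j)}\colon\Omega_\partial^{i,j}\to\Omega_\partial^{i+k,j+k}$, $A\mapsto A\wedge e^{k}$; and, for a bundle map $\phi\colon T\Sigma\to\mathcal V$, let $[A,\phi]\in\Omega_\partial^{i+1,j-1}$ be the contraction of the last internal index of $A\in\Omega_\partial^{i,j}$ with $\phi$ by means of $\eta$, antisymmetrized in the form indices. Let $H\subset T\Sigma$ be a smooth subbundle complementary to $\langle X\rangle$, with local frames $Y^1,\dots,Y^{N-2}$. Let $\beta$ be the one-form with $\iota_X\beta=1$ such that $\widetilde e:=e-\beta\,\iota_Xe$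 satisfies $\iota_{Y^1}\cdots\iota_{Y^{N-2}}(\widetilde e\wedge e^{N-4}\wedge v)=0$ for all $v\in\Omega_\partial^{1,2}$ with $e^{N-3}\wedge v=0$. Put $$\mathcal S=\{\tau\in\Omega_\partial^{N-3,N-1}:\ \tau\wedge e=0,\ [\tau,\widetilde e]=0\}.$$ Let $e_n$ be a smooth section of $\mathcal V$, transversal to $e(T\Sigma)$ at every point and $\eta$-orthogonal to $e(H)$. Choose an arbitrary Riemannian metric on $\Sigma$ and extend it to $\mathcal V$ by a smooth positive definite fibre metric for which $e$ is isometric and $e_n$ is orthogonal to $e(T\Sigma)$; this gives a fibre metric on $\bigwedge^2T^*\Sigma\otimes\mathcal V$. Let $J\subset\Omega_\partial^{2,1}$ be the pointwise orthogonal complement of $\{[v,e]: v\in\operatorname{Ker}W_{N-3}^{(1,2)}\}$, let $\mathcal T=\operatorname{Ker}W_{N-3}^{(2,1)}\cap J$, and for $\alpha\in\Omega^{2,1}_\partial$ let $p_{\mathcal T}(\alpha)$ be the pointwise orthogonal projection of $\alpha$ to $\mathcal T$, i.e. the $\theta\in\mathcal T$ such that $\alpha-\theta$ is orthogonal to every element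 of $\mathcal T$ at every point. Elements of $\Omega_\partial^{N-1,N}$ are identified with densities on $\Sigma$ by means of the volume of $\eta$, with $(e(\partial_1),\dots,e(\partial_{N-1}),e_n)$ counted as a positive frame of $\mathcal V$ when $(\partial_1,\dots,\partial_{N-1})$ is a positive frame of $T\Sigma$, and integrated over $\Sigma$. **Claim.** If $\alpha\in\Omega_\partial^{2,1}$ and $\int_\Sigma\tau\wedge\alpha=0$ for all compactly supported $\tau\in\mathcal S$ (for compact $\Sigma$: for all $\tau\in\mathcal S$), then the projection $p_{\mathcal T}(\alpha)$ exists and $p_{\mathcal T}(\alpha)=0$. In particular $\mathcal S$ acts as a dual of $\mathcal T$: an element $\theta\in\mathcal T$ with $\int_\Sigma\tau\wedge\theta=0$ for all compactly supported $\tau\in\mathcal S$ is zero. -/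

import Mathlib

open Bundle Set MeasureTheory
open scoped Manifold ContDiff Topology

noncomputable section

/-! ### Products of alternating maps -/

namespace PalatiniCartan

section Algebra

variable {T : Type*} [AddCommGroup T] [Module ℝ T]
variable {A B C : Type*} [AddCommGroup A] [Module ℝ A] [AddCommGroup B] [Module ℝ B]
  [AddCommGroup C] [Module ℝ C]

/-- The exterior product of an `A`-valued `i`-form and a `B`-valued `k`-form on `T`, the values being
multiplied through the bilinear map `f` (a signed sum over shuffles). -/
def altProd (i k : ℕ) (f : A →ₗ[ℝ] B →ₗ[ℝ] C) :
    (T [⋀^Fin i]→ₗ[ℝ] A) →ₗ[ℝ] (T [⋀^Fin k]→ₗ[ℝ] B) →ₗ[ℝ] (T [⋀^Fin (i + k)]→ₗ[ℝ] C) :=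
  (TensorProduct.mk ℝ (T [⋀^Fin i]→ₗ[ℝ] A) (T [⋀^Fin k]→ₗ[ℝ] B)).compr₂
    ((AlternatingMap.domDomCongrₗ ℝ finSumFinEquiv).toLinearMap ∘ₗ
      LinearMap.compAlternatingMapₗ ℝ (TensorProduct.lift f) ∘ₗ AlternatingMap.domCoprod')

/-- A linear map on `T`, regarded as an alternating map of one argument. -/
def oneForm (φ : T →ₗ[ℝ] A) : T [⋀^Fin 1]→ₗ[ℝ] A :=
  AlternatingMap.ofSubsingleton ℝ T A (0 : Fin 1) φ

variable {U : Type*} [AddCommGroup U] [Module ℝ U]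

/-- The coefficient `c` in `w = c • b₀ ∧ ⋯ ∧ bₙ₋₁`; it is unique if `b` is linearly independent,
and exists for every `w` of degree `n` if `b` is a basis. -/
def topCoeff {n : ℕ} (b : Fin n → U) (w : ExteriorAlgebra ℝ U) : ℝ :=
  open Classical in
  if h : ∃ c : ℝ, w = c • ExteriorAlgebra.ιMulti ℝ n b then h.choose else 0

/-- The inner product on `⋀² T* ⊗ U` that inner products `p` on `T` and `q` on `U` induce:
`½ ∑ p^{ac} p^{bd} q(α_{ab}, α'_{cd})`, where `(p^{ac})` is the inverse of the Gram matrix of `p`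
in the basis `u` of `T` (the choice of the basis is immaterial). The elements of `⋀² T* ⊗ U` are the
alternating maps with values in the degree one part of the exterior algebra of `U`. -/
def twoFormInner {n : ℕ} (u : Module.Basis (Fin n) ℝ T) (p : T → T → ℝ) (q : U →ₗ[ℝ] U →ₗ[ℝ] ℝ)
    (α α' : T [⋀^Fin 2]→ₗ[ℝ] ExteriorAlgebra ℝ U) : ℝ :=
  let G : Matrix (Fin n) (Fin n) ℝ := (Matrix.of fun a c => p (u a) (u c))⁻¹
  (1 / 2 : ℝ) * ∑ a, ∑ b, ∑ c, ∑ d, G a c * G b d *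
    q (ExteriorAlgebra.ιInv (α ![u a, u b])) (ExteriorAlgebra.ιInv (α' ![u c, u d]))

theorem twoFormInner_add {n : ℕ} (u : Module.Basis (Fin n) ℝ T) (p : T → T → ℝ)
    (q : U →ₗ[ℝ] U →ₗ[ℝ] ℝ) (a b r : T [⋀^Fin 2]→ₗ[ℝ] ExteriorAlgebra ℝ U) :
    twoFormInner u p q (a + b) r = twoFormInner u p q a r + twoFormInner u p q b r := by
  simp only [twoFormInner, AlternatingMap.add_apply, map_add, LinearMap.add_apply, mul_add,
    Finset.sum_add_distrib]

theorem twoFormInner_smul {n : ℕ} (u : Module.Basis (Fin n) ℝ T) (p : T → T → ℝ)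
    (q : U →ₗ[ℝ] U →ₗ[ℝ] ℝ) (c : ℝ) (a r : T [⋀^Fin 2]→ₗ[ℝ] ExteriorAlgebra ℝ U) :
    twoFormInner u p q (c • a) r = c * twoFormInner u p q a r := by
  simp only [twoFormInner, AlternatingMap.smul_apply, map_smul, LinearMap.smul_apply, smul_eq_mul,
    Finset.mul_sum]
  refine Finset.sum_congr rfl fun _ _ => Finset.sum_congr rfl fun _ _ =>
    Finset.sum_congr rfl fun _ _ => Finset.sum_congr rfl fun _ _ => by ring

end Algebra

/-! ### Differential forms on `M` with values in the exterior powers of a vector bundle -/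

/-- The model space of an `(N - 1)`-dimensional manifold, `N = m + 4`. -/
abbrev BaseModel (m : ℕ) : Type := EuclideanSpace ℝ (Fin (m + 3))

/-- The model fibre of a bundle of rank `N = m + 4`. -/
abbrev FibreModel (m : ℕ) : Type := EuclideanSpace ℝ (Fin (m + 4))

variable (m : ℕ) {M : Type*} [TopologicalSpace M] [ChartedSpace (BaseModel m) M]
  [IsManifold (𝓡 (m + 3)) ∞ M]
  (V : M → Type*) [∀ x, AddCommGroup (V x)] [∀ x, Module ℝ (V x)] [∀ x, TopologicalSpace (V x)]
  [TopologicalSpace (TotalSpace (FibreModel m) V)] [FiberBundle (FibreModel m) V]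
  [VectorBundle ℝ (FibreModel m) V]

/-- Fields of alternating `i`-forms on `M` with values in the exterior algebra of `V`, with no
condition on regularity or on the degree of the values. -/
abbrev FormField (i : ℕ) :=
  ∀ x : M, TangentSpace (𝓡 (m + 3)) x [⋀^Fin i]→ₗ[ℝ] ExteriorAlgebra ℝ (V x)

variable {m V}

/-- Smoothness: in the local trivializations of `TM` and of `V` all components are smooth
functions. -/
def IsSmoothField {i : ℕ} (φ : FormField m V i) : Prop :=
  ∀ (x₀ : M) (v : Fin i → BaseModel m)
    (l : ExteriorAlgebra ℝ (FibreModel m) →ₗ[ℝ] ℝ),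
    ContMDiffOn (𝓡 (m + 3)) 𝓘(ℝ, ℝ) ∞
      (fun x => l (ExteriorAlgebra.map
        ((trivializationAt (FibreModel m) V x₀).linearMapAt ℝ x)
        (φ x fun k => (trivializationAt (BaseModel m)
          (TangentSpace (𝓡 (m + 3)) : M → Type _) x₀).symmL ℝ x (v k))))
      ((trivializationAt (BaseModel m) (TangentSpace (𝓡 (m + 3)) : M → Type _) x₀).baseSet ∩
        (trivializationAt (FibreModel m) V x₀).baseSet)

variable (m V) in
/-- `Ω^{i,j}`: the smooth `i`-forms on `M` with values in `⋀^j V`. -/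
def Omega (i j : ℕ) : Submodule ℝ (FormField m V i) where
  carrier := {φ | (∀ x v, φ x v ∈ ⋀[ℝ]^j (V x)) ∧ IsSmoothField φ}
  zero_mem' := by
    refine ⟨fun x v => by simp, fun x₀ v l => ?_⟩
    simpa using contMDiffOn_const
  add_mem' := by
    rintro a b ⟨ha, ha'⟩ ⟨hb, hb'⟩
    refine ⟨fun x v => by simpa using add_mem (ha x v) (hb x v), fun x₀ v l => ?_⟩
    refine ((ha' x₀ v l).add (hb' x₀ v l)).congr fun x _ => ?_
    simp
  smul_mem' := by
    rintro c a ⟨ha, ha'⟩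
    refine ⟨fun x v => by simpa using Submodule.smul_mem _ c (ha x v), fun x₀ v l => ?_⟩
    have h := contMDiffOn_const (I := 𝓡 (m + 3)) (I' := 𝓘(ℝ, ℝ)) (n := ∞) (c := c)
      (s := (trivializationAt (BaseModel m) (TangentSpace (𝓡 (m + 3)) : M → Type _) x₀).baseSet ∩
        (trivializationAt (FibreModel m) V x₀).baseSet)
    refine (h.mul (ha' x₀ v l)).congr fun x _ => ?_
    simp

/-- The wedge product of an element of `Ω^{i,j}` with an element of `Ω^{k,l}`, taken on the form
part and on the internal part. The sign makes it graded commutative for the total degree: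
`α β = (-1)^{(i+j)(k+l)} β α`. -/
def wedge (i j k : ℕ) : FormField m V i →ₗ[ℝ] FormField m V k →ₗ[ℝ] FormField m V (i + k) :=
  LinearMap.mk₂ ℝ (fun α β x => (-1 : ℝ) ^ (j * k) •
      altProd i k (LinearMap.mul ℝ (ExteriorAlgebra ℝ (V x))) (α x) (β x))
    (fun _ _ _ => by
      ext1 x; simp only [Pi.add_apply, map_add, LinearMap.add_apply, smul_add])
    (fun _ _ _ => by
      ext1 x; simp only [Pi.smul_apply, map_smul, LinearMap.smul_apply]; rw [smul_comm])
    (fun _ _ _ => by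
      ext1 x; simp only [Pi.add_apply, map_add, smul_add])
    (fun _ _ _ => by
      ext1 x; simp only [Pi.smul_apply, map_smul]; rw [smul_comm])

/-- A field of linear maps `T_xM → V_x`, as a field of forms (a candidate element of
`Ω^{1,1}`). -/
def vecForm (φ : ∀ x : M, TangentSpace (𝓡 (m + 3)) x →ₗ[ℝ] V x) : FormField m V 1 :=
  fun x => oneForm (ExteriorAlgebra.ι ℝ ∘ₗ φ x)

/-- A field of linear forms on `TM`, as a field of forms (a candidate element of `Ω^{1,0}`). -/
def scalarForm (β : ∀ x : M, TangentSpace (𝓡 (m + 3)) x →ₗ[ℝ] ℝ) : FormField m V 1 :=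
  fun x => oneForm (Algebra.linearMap ℝ (ExteriorAlgebra ℝ (V x)) ∘ₗ β x)

/-- `X ↦ X ∧ e ∧ ⋯ ∧ e` (`k` factors) on forms of bidegree `(i, j)`. -/
def wedgePow (e : ∀ x : M, TangentSpace (𝓡 (m + 3)) x →ₗ[ℝ] V x) (i j : ℕ) :
    (k : ℕ) → FormField m V i →ₗ[ℝ] FormField m V (i + k)
  | 0 => LinearMap.id
  | k + 1 => (wedge (i + k) (j + k) 1).flip (vecForm e) ∘ₗ wedgePow e i j k

/-- The bracket `X ↦ [X, φ]` of `i`-forms with values in the exterior algebra of `V` with a field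
of linear maps `φ : TM → V`: an internal index of `X` (the last one) is contracted with `φ` by means
of the inner product `η`, and the form indices are antisymmetrized. -/
def bracket (η : ∀ x : M, V x →ₗ[ℝ] V x →ₗ[ℝ] ℝ)
    (φ : ∀ x : M, TangentSpace (𝓡 (m + 3)) x →ₗ[ℝ] V x) (i : ℕ) :
    FormField m V i →ₗ[ℝ] FormField m V (i + 1) :=
  LinearMap.pi fun x =>
    ((altProd i 1 (CliffordAlgebra.contractRight :
        ExteriorAlgebra ℝ (V x) →ₗ[ℝ] Module.Dual ℝ (V x) →ₗ[ℝ] ExteriorAlgebra ℝ (V x))).flip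
      (oneForm (η x ∘ₗ φ x))) ∘ₗ LinearMap.proj x

/-! ### Boundary fields -/

section Boundary

variable [∀ x, IsTopologicalAddGroup (V x)] [∀ x, ContinuousSMul ℝ (V x)]

variable (m V) in
/-- A smooth Lorentzian inner product `η` on the fibres of `V` (signature `(N - 1, 1)`), and a
boundary coframe `e`: a smooth injective bundle map `TM → V`. -/
structure BoundaryCoframe where
  /-- the Lorentzian inner product on the fibres -/
  η : ∀ x : M, V x →L[ℝ] V x →L[ℝ] ℝ
  η_symm : ∀ x u w, η x u w = η x w u
  η_lorentz : ∀ x, ∃ b : Module.Basis (Fin (m + 4)) ℝ (V x), ∀ i j,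
    η x (b i) (b j) = if i = j then (if i = 0 then -1 else 1) else 0
  η_smooth : ContMDiff (𝓡 (m + 3))
    ((𝓡 (m + 3)).prod 𝓘(ℝ, FibreModel m →L[ℝ] FibreModel m →L[ℝ] ℝ)) ∞
    (fun x => TotalSpace.mk' (FibreModel m →L[ℝ] FibreModel m →L[ℝ] ℝ) x (η x))
  /-- the coframe -/
  e : ∀ x : M, TangentSpace (𝓡 (m + 3)) x →ₗ[ℝ] V x
  e_smooth : vecForm e ∈ Omega m V 1 1
  e_injective : ∀ x, Function.Injective (e x)

namespace BoundaryCoframe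

variable (C : BoundaryCoframe m V)

/-- `η` as a field of bilinear forms. -/
def ηlin (x : M) : V x →ₗ[ℝ] V x →ₗ[ℝ] ℝ :=
  ContinuousLinearMap.coeLM ℝ ∘ₗ (C.η x).toLinearMap

/-- The induced (possibly degenerate) boundary metric `g = η(e, e)`. -/
def g (x : M) (u w : TangentSpace (𝓡 (m + 3)) x) : ℝ := C.η x (C.e x u) (C.e x w)

/-- The kernel of `W_k : Ω^{i,j} → Ω^{i+k,j+k}`, `X ↦ X ∧ e^k`. -/
def kerW (i j k : ℕ) : Submodule ℝ (FormField m V i) :=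
  Omega m V i j ⊓ LinearMap.ker (wedgePow C.e i j k)

/-- The image of `Ker (W_{N-3} : Ω^{1,2} → Ω^{N-2,N-1})` under `v ↦ [v, e]`. -/
def imRho : Submodule ℝ (FormField m V 2) :=
  (C.kerW 1 2 (m + 1)).map (bracket C.ηlin C.e 1)

end BoundaryCoframe

/-- The data from which `ẽ` is built, for a light-like boundary metric: a nowhere vanishing null
vector field `X` with `ι_X g = 0`, smooth local frames `Y¹, …, Y^{N-2}` that complete `X` to a frame
of `TM` (only the subbundle `H` which they span matters), and the one-form `β` that is normalized by
`ι_X β = 1` and by the vanishing of `ι_{Y¹} ⋯ ι_{Y^{N-2}} (ẽ ∧ e^{N-4} ∧ v)` for all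
`v ∈ Ω^{1,2}` with `e^{N-3} ∧ v = 0`, where `ẽ = e - β ι_X e`. -/
structure NullSplitting (C : BoundaryCoframe m V) where
  /-- the null vector field -/
  X : ∀ x : M, TangentSpace (𝓡 (m + 3)) x
  X_smooth : ContMDiff (𝓡 (m + 3)) (𝓡 (m + 3)).tangent ∞
    (fun x => (⟨x, X x⟩ : TangentBundle (𝓡 (m + 3)) M))
  X_ne_zero : ∀ x, X x ≠ 0
  X_null : ∀ x u, C.g x (X x) u = 0
  /-- the span of the vector fields `Yⁱ` -/
  H : ∀ x : M, Submodule ℝ (TangentSpace (𝓡 (m + 3)) x)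
  H_isCompl : ∀ x, IsCompl (Submodule.span ℝ {X x}) (H x)
  H_smooth : ∀ x₀ : M, ∃ U ∈ 𝓝 x₀, ∃ Y : Fin (m + 2) → ∀ x : M, TangentSpace (𝓡 (m + 3)) x,
    (∀ i, ContMDiffOn (𝓡 (m + 3)) (𝓡 (m + 3)).tangent ∞
      (fun x => (⟨x, Y i x⟩ : TangentBundle (𝓡 (m + 3)) M)) U) ∧
    ∀ x ∈ U, Submodule.span ℝ (range fun i => Y i x) = H x
  /-- the one-form dual to `X` -/
  β : ∀ x : M, TangentSpace (𝓡 (m + 3)) x →ₗ[ℝ] ℝ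
  β_smooth : scalarForm β ∈ Omega m V 1 0
  β_X : ∀ x, β x (X x) = 1
  β_normalized : ∀ v ∈ C.kerW 1 2 (m + 1), ∀ (x : M)
    (u : Fin (1 + m + 1) → TangentSpace (𝓡 (m + 3)) x), (∀ k, u k ∈ H x) →
    wedge (1 + m) (1 + m) 1
      (wedgePow C.e 1 1 m (vecForm fun y => C.e y - (β y).smulRight (C.e y (X y)))) v x u = 0

namespace NullSplitting

variable {C : BoundaryCoframe m V} (P : NullSplitting C)

/-- `ẽ = e - β ι_X e`. -/
def eTilde (x : M) : TangentSpace (𝓡 (m + 3)) x →ₗ[ℝ] V x :=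
  C.e x - (P.β x).smulRight (C.e x (P.X x))

/-- `𝒮 = Ker (W_1 : Ω^{N-3,N-1} → Ω^{N-2,N}) ∩ Ker (τ ↦ [τ, ẽ])`. -/
def S : Submodule ℝ (FormField m V (m + 1)) :=
  C.kerW (m + 1) (m + 3) 1 ⊓ LinearMap.ker (bracket C.ηlin P.eTilde (m + 1))

end NullSplitting

/-- A section `e_n` of `V` that completes `e(TM)` to `V` and is `η`-orthogonal to `e(H)`, and
a Riemannian metric on `M` (arbitrary) together with its extension to the fibres of `V`,
for which `e` is isometric and `e_n` is orthogonal to `e(TM)`. -/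
structure AdaptedMetric {C : BoundaryCoframe m V} (P : NullSplitting C) where
  /-- the transversal section -/
  en : ∀ x : M, V x
  en_smooth : ContMDiff (𝓡 (m + 3)) ((𝓡 (m + 3)).prod 𝓘(ℝ, FibreModel m)) ∞
    (fun x => TotalSpace.mk' (FibreModel m) x (en x))
  en_transversal : ∀ x, en x ∉ LinearMap.range (C.e x)
  en_orthogonal : ∀ x, ∀ u ∈ P.H x, C.η x (en x) (C.e x u) = 0
  /-- the Riemannian metric on `M` -/
  base : ContMDiffRiemannianMetric (𝓡 (m + 3)) ∞ (BaseModel m)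
    (TangentSpace (𝓡 (m + 3)) : M → Type _)
  /-- its extension to the fibres of `V` -/
  fibre : ContMDiffRiemannianMetric (𝓡 (m + 3)) ∞ (FibreModel m) V
  fibre_e : ∀ x u w, fibre.inner x (C.e x u) (C.e x w) = base.inner x u w
  fibre_en : ∀ x u, fibre.inner x (C.e x u) (en x) = 0

namespace AdaptedMetric

variable {C : BoundaryCoframe m V} {P : NullSplitting C} (Q : AdaptedMetric P)

/-- The pointwise inner product of elements of `Ω^{2,1}`. -/
def inner (α α' : FormField m V 2) (x : M) : ℝ :=
  twoFormInner (T := TangentSpace (𝓡 (m + 3)) x)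
    (EuclideanSpace.basisFun (Fin (m + 3)) ℝ).toBasis (fun u w => Q.base.inner x u w) 
    (ContinuousLinearMap.coeLM ℝ ∘ₗ (Q.fibre.inner x).toLinearMap) (α x) (α' x)

/-- `J`: the orthogonal complement in `Ω^{2,1}` of the image of
`Ker (W_{N-3} : Ω^{1,2} → Ω^{N-2,N-1})` under `v ↦ [v, e]`. -/
def J : Submodule ℝ (FormField m V 2) where
  carrier := {α | α ∈ Omega m V 2 1 ∧ ∀ ρ ∈ C.imRho, ∀ x, Q.inner α ρ x = 0}
  zero_mem' := ⟨zero_mem _, fun ρ _ x => by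
    have h : Q.inner ((0 : ℝ) • 0) ρ x = 0 * Q.inner 0 ρ x := twoFormInner_smul _ _ _ _ _ _
    simpa using h⟩
  add_mem' := by
    rintro a b ⟨ha, ha'⟩ ⟨hb, hb'⟩
    refine ⟨add_mem ha hb, fun ρ hρ x => ?_⟩
    have h : Q.inner (a + b) ρ x = Q.inner a ρ x + Q.inner b ρ x := twoFormInner_add _ _ _ _ _ _
    rw [h, ha' ρ hρ x, hb' ρ hρ x, add_zero]
  smul_mem' := by
    rintro c a ⟨ha, ha'⟩
    refine ⟨Submodule.smul_mem _ c ha, fun ρ hρ x => ?_⟩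
    have h : Q.inner (c • a) ρ x = c * Q.inner a ρ x := twoFormInner_smul _ _ _ _ _ _
    rw [h, ha' ρ hρ x, mul_zero]

/-- `𝒯 = Ker (W_{N-3} : Ω^{2,1} → Ω^{N-1,N-2}) ∩ J`. -/
def T : Submodule ℝ (FormField m V 2) := C.kerW 2 1 (m + 1) ⊓ Q.J

/-- `θ = p_𝒯(α)`: `θ` is the orthogonal projection of `α ∈ Ω^{2,1}` to `𝒯`. -/
def IsProjT (α θ : FormField m V 2) : Prop :=
  θ ∈ Q.T ∧ ∀ θ' ∈ Q.T, ∀ x, Q.inner (α - θ) θ' x = 0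

/-! The integral over `M` of elements of `Ω^{N-1,N}`. -/

/-- Let `c : ℝ` be such that `φ(∂₁, …, ∂_{N-1}) = c • e(∂₁) ∧ ⋯ ∧ e(∂_{N-1}) ∧ e_n`, where `∂` is the
coordinate frame of the chart at `i`. The density of `φ ∈ Ω^{N-1,N}` in this chart is `c` times the
`η`-volume of `(e(∂₁), …, e(∂_{N-1}), e_n)`. This is the identification of `Ω^{N-1,N}` with the
densities on `M` for which `(e(∂₁), …, e(∂_{N-1}), e_n)` is a positive frame of `V` whenever `∂` is
a positive frame of `TM`; a change of the orientation of the chart changes neither the density nor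
the sign of its integral. -/
def density (φ : FormField m V (m + 3)) (i x : M) : ℝ :=
  let d : Fin (m + 3) → TangentSpace (𝓡 (m + 3)) x := fun k =>
    (trivializationAt (BaseModel m) (TangentSpace (𝓡 (m + 3)) : M → Type _) i).symmL ℝ x
      (EuclideanSpace.single k (1 : ℝ))
  let f : Fin (m + 4) → V x := Fin.snoc (fun k => C.e x (d k)) (Q.en x)
  topCoeff f (φ x d) * √|(Matrix.of fun a b => C.η x (f a) (f b)).det|

variable [T2Space M] [SigmaCompactSpace M]

/-- The integral over `M` of a compactly supported element of `Ω^{N-1,N}`: its density is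
integrated in charts, by means of a smooth partition of unity subordinate to the atlas. -/
def integral (φ : FormField m V (m + 3)) : ℝ :=
  let ρ := (SmoothPartitionOfUnity.exists_isSubordinate_chartAt_source (𝓡 (m + 3)) M).choose
  ∑ᶠ i : M, ∫ y in (chartAt (BaseModel m) i).target,
    ρ i ((chartAt (BaseModel m) i).symm y) * Q.density φ i ((chartAt (BaseModel m) i).symm y)

end AdaptedMetric

/-- The support of a field of forms is relatively compact. -/
def CompactlySupported {i : ℕ} (φ : FormField m V i) : Prop := IsCompact (closure {x | φ x ≠ 0})

end Boundary

end PalatiniCartan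

end

/-!
The pairing `∫ τ ∧ α` is inverted explicitly. Raise all indices of `θ ∈ 𝒯` with the auxiliary
metrics to obtain a tensor `K^{cd}` with values in `V*`; the form
`τ_θ = ∑ (ι_d ι_c vol_T) ⊗ (vol_V ⌊ K^{cd})` of bidegree `(N - 3, N - 1)` then satisfies
`τ_θ ∧ α = 2 ⟨α, θ⟩ vol_T ⊗ vol_V`. The two defining conditions of `𝒮` are linear conditions on `K`:

* `τ_θ ∧ e = 0` says that `K` is trace-free against `e`, which holds because `θ ∧ e^{N-3} = 0`
  forces `θ` to be trace-free;
* `[τ_θ, ẽ] = 0` says that a contraction of `K` with `η(ẽ, ·)` is symmetric. This is orthogonality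
  of `θ` to the forms `[v, e]`, where `v` runs through the trace-free parts of `φ ⊗ e(s) ∧ e(t)`,
  which lie in `Ker W_{N-3}`; here `β` vanishes on `H` by its normalization and `e_n` is orthogonal
  to `ẽ(TM)`.

So `χ ⟨α, θ⟩ τ_θ ∈ 𝒮` for every bump function `χ ≥ 0`, and the vanishing of `∫ χ ⟨α, θ⟩²` gives
`⟨α, θ⟩ = 0` at every point.

The algebra takes place in `⋀ (T* ⊕ V)`, where wedge products become products and the coframe is a
central element.
-/

noncomputable section

namespace PalatiniCartan

open ExteriorAlgebra (ι ιMulti)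
open CliffordAlgebra (contractLeft contractRight)

section ExteriorAlgebra

variable {R U U' : Type*} [CommRing R] [AddCommGroup U] [Module R U] [AddCommGroup U'] [Module R U']

theorem mem_exteriorPower_zero {x : ExteriorAlgebra R U} :
    x ∈ ⋀[R]^0 U ↔ ∃ r : R, algebraMap R _ r = x :=
  Submodule.mem_one

theorem ι_mem_exteriorPower_one (u : U) : ι R u ∈ ⋀[R]^1 U :=
  (Submodule.pow_one (ι R : U →ₗ[R] ExteriorAlgebra R U).range).symm.le
    (LinearMap.mem_range_self (ι R) u)

@[elab_as_elim]
theorem exteriorPower_succ_induction {j : ℕ} {motive : ExteriorAlgebra R U → Prop}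
    (mul_ι : ∀ x ∈ ⋀[R]^j U, ∀ u, motive (x * ι R u))
    (add : ∀ x y, motive x → motive y → motive (x + y))
    {x : ExteriorAlgebra R U} (hx : x ∈ ⋀[R]^(j + 1) U) : motive x := by
  change x ∈ LinearMap.range (ι R : U →ₗ[R] _) ^ (j + 1) at hx
  rw [pow_succ] at hx
  refine Submodule.mul_induction_on hx (fun y hy w hw => ?_) add
  obtain ⟨u, rfl⟩ := hw
  exact mul_ι y hy u

theorem map_mem_exteriorPower (f : U →ₗ[R] U') {j : ℕ} {x : ExteriorAlgebra R U}
    (hx : x ∈ ⋀[R]^j U) : ExteriorAlgebra.map f x ∈ ⋀[R]^j U' := by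
  have h : ExteriorAlgebra.map f x ∈ (⋀[R]^j U).map (ExteriorAlgebra.map f).toLinearMap :=
    Submodule.mem_map_of_mem hx
  rw [Submodule.map_pow, ExteriorAlgebra.ι_range_map_map] at h
  exact pow_le_pow_left' LinearMap.map_le_range j h

theorem ι_mul_ι_comm (u w : U) : ι R u * ι R w = -(ι R w * ι R u) :=
  eq_neg_of_add_eq_zero_left (ExteriorAlgebra.ι_add_mul_swap u w)

theorem mul_ι_of_mem_exteriorPower {j : ℕ} {x : ExteriorAlgebra R U} (hx : x ∈ ⋀[R]^j U) (u : U) :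
    x * ι R u = (-1 : R) ^ j • (ι R u * x) := by
  induction j generalizing x with
  | zero =>
    obtain ⟨r, rfl⟩ := mem_exteriorPower_zero.1 hx
    rw [pow_zero, one_smul, Algebra.commutes]
  | succ j ih =>
    refine exteriorPower_succ_induction (fun y hy w => ?_) (fun y z hy hz => ?_) hx
    · rw [mul_assoc, ι_mul_ι_comm, mul_neg, ← mul_assoc, ih hy, smul_mul_assoc, mul_assoc,
        pow_succ, mul_neg_one, neg_smul]
    · rw [add_mul, hy, hz, mul_add, smul_add]

theorem mul_comm_of_mem_exteriorPower {j k : ℕ} {x y : ExteriorAlgebra R U}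
    (hx : x ∈ ⋀[R]^j U) (hy : y ∈ ⋀[R]^k U) : x * y = (-1 : R) ^ (j * k) • (y * x) := by
  induction k generalizing y with
  | zero =>
    obtain ⟨r, rfl⟩ := mem_exteriorPower_zero.1 hy
    rw [mul_zero, pow_zero, one_smul, Algebra.commutes]
  | succ k ih =>
    refine exteriorPower_succ_induction (fun z hz u => ?_) (fun z w hz hw => ?_) hy
    · rw [← mul_assoc, ih hz, smul_mul_assoc, mul_assoc, mul_ι_of_mem_exteriorPower hx,
        mul_smul_comm, smul_smul, ← mul_assoc, ← pow_add, ← Nat.mul_succ]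
    · rw [mul_add, hz, hw, add_mul, smul_add]

theorem contractRight_mem_exteriorPower {j : ℕ} {x : ExteriorAlgebra R U}
    (hx : x ∈ ⋀[R]^(j + 1) U) (d : Module.Dual R U) : contractRight x d ∈ ⋀[R]^j U := by
  induction j generalizing x with
  | zero =>
    refine exteriorPower_succ_induction (fun y hy u => ?_) (fun y z hy hz => ?_) hx
    · obtain ⟨r, rfl⟩ := mem_exteriorPower_zero.1 hy
      rw [← Algebra.smul_def, map_smul, LinearMap.smul_apply]
      exact Submodule.smul_mem _ _ (mem_exteriorPower_zero.2
        ⟨d u, (CliffordAlgebra.contractRight_ι _ _ _).symm⟩)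
    · rw [map_add, LinearMap.add_apply]
      exact add_mem hy hz
  | succ j ih =>
    refine exteriorPower_succ_induction (fun y hy u => ?_) (fun y z hy hz => ?_) hx
    · have h : contractRight (y * ι R u) d = d u • y - contractRight y d * ι R u :=
        CliffordAlgebra.contractRight_mul_ι _ _ _
      rw [h]
      exact sub_mem (Submodule.smul_mem _ _ hy)
        (SetLike.mul_mem_graded (A := fun i : ℕ => ⋀[R]^i U) (ih hy)
          (ι_mem_exteriorPower_one u))
    · rw [map_add, LinearMap.add_apply]
      exact add_mem hy hz

theorem ιMulti_succ_last {k : ℕ} (u : Fin (k + 1) → U) :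
    ιMulti R (k + 1) u = ιMulti R k (Fin.init u) * ι R (u (Fin.last k)) := by
  rw [ExteriorAlgebra.ιMulti_apply, ExteriorAlgebra.ιMulti_apply, List.ofFn_succ',
    List.concat_eq_append, List.prod_append, List.prod_singleton]
  rfl

theorem ιMulti_basis_ne_zero [Nontrivial R] {k : ℕ} (f : Module.Basis (Fin k) R U) :
    ιMulti R k f ≠ 0 := by
  intro h
  have h_power : exteriorPower.ιMulti R k f = 0 := Subtype.ext h
  have det_self := exteriorPower.alternatingMapLinearEquiv_apply_ιMulti f.det f
  rw [h_power, map_zero, f.det_self] at det_self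
  exact zero_ne_one det_self

end ExteriorAlgebra

section CliffordAlgebra

variable {R U U' : Type*} [CommRing R] [AddCommGroup U] [Module R U] [AddCommGroup U'] [Module R U']
  {q : QuadraticForm R U} {q' : QuadraticForm R U'}

theorem contractLeft_map (f : q →qᵢ q') (d : Module.Dual R U') (x : CliffordAlgebra q) :
    contractLeft d (CliffordAlgebra.map f x) =
      CliffordAlgebra.map f (contractLeft (d ∘ₗ f.toLinearMap) x) := by
  induction x using CliffordAlgebra.left_induction with
  | algebraMap r => simp
  | add x y hx hy => simp only [map_add, hx, hy]
  | ι_mul x u hx =>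
    simp only [map_mul, CliffordAlgebra.map_apply_ι, CliffordAlgebra.contractLeft_ι_mul, hx,
      map_sub, map_smul]
    rfl

end CliffordAlgebra

section AltProd

variable {T : Type*} [AddCommGroup T] [Module ℝ T]
variable {A B C : Type*} [AddCommGroup A] [Module ℝ A] [AddCommGroup B] [Module ℝ B]
  [AddCommGroup C] [Module ℝ C]

theorem factorial_smul_altProd_apply (i k : ℕ) (f : A →ₗ[ℝ] B →ₗ[ℝ] C)
    (α : T [⋀^Fin i]→ₗ[ℝ] A) (β : T [⋀^Fin k]→ₗ[ℝ] B) (t : Fin (i + k) → T) :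
    ((i.factorial * k.factorial : ℕ) : ℝ) • altProd i k f α β t =
      ∑ σ : Equiv.Perm (Fin i ⊕ Fin k), (Equiv.Perm.sign σ : ℤ) •
        f (α fun a => t (finSumFinEquiv (σ (Sum.inl a))))
          (β fun a => t (finSumFinEquiv (σ (Sum.inr a)))) := by
  have h := congrArg (fun ψ => TensorProduct.lift f (ψ fun a => t (finSumFinEquiv a)))
    (MultilinearMap.domCoprod_alternization_eq α β)
  simp only [Fintype.card_fin, AlternatingMap.smul_apply, map_nsmul] at h
  rw [Nat.cast_smul_eq_nsmul]
  refine Eq.trans rfl (h.symm.trans ?_)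
  rw [MultilinearMap.alternatization_apply, map_sum]
  refine Finset.sum_congr rfl fun σ _ => ?_
  rw [Units.smul_def, map_zsmul]
  rfl

theorem altProd_apply_mem (i k : ℕ) (f : A →ₗ[ℝ] B →ₗ[ℝ] C) (S : Submodule ℝ C)
    {α : T [⋀^Fin i]→ₗ[ℝ] A} {β : T [⋀^Fin k]→ₗ[ℝ] B}
    (h : ∀ s t, f (α s) (β t) ∈ S) (t : Fin (i + k) → T) : altProd i k f α β t ∈ S := by
  have hne : ((i.factorial * k.factorial : ℕ) : ℝ) ≠ 0 := by positivity
  rw [← Submodule.smul_mem_iff S hne, factorial_smul_altProd_apply]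
  exact sum_mem fun σ _ => S.smul_of_tower_mem _ (h _ _)

theorem altProd_one_one_apply (f : A →ₗ[ℝ] B →ₗ[ℝ] C) (α : T [⋀^Fin 1]→ₗ[ℝ] A)
    (φ : T →ₗ[ℝ] B) (t : Fin 2 → T) :
    altProd 1 1 f α (oneForm φ) t =
      f (α fun _ => t 0) (φ (t 1)) - f (α fun _ => t 1) (φ (t 0)) := by
  have h := factorial_smul_altProd_apply 1 1 f α (oneForm φ) t
  simp only [Nat.factorial_one, mul_one, Nat.cast_one, one_smul] at h
  rw [h, ← (Equiv.permCongr finSumFinEquiv.symm).sum_comp]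
  have univ_eq : (Finset.univ : Finset (Equiv.Perm (Fin (1 + 1)))) = {1, Equiv.swap 0 1} := by
    decide
  have sign_swap : Equiv.Perm.sign (Equiv.swap (0 : Fin (1 + 1)) 1) = -1 := by decide
  have inl_eq : ∀ a : Fin 1, finSumFinEquiv (Sum.inl a : Fin 1 ⊕ Fin 1) = 0 := by decide
  have inr_eq : ∀ a : Fin 1, finSumFinEquiv (Sum.inr a : Fin 1 ⊕ Fin 1) = 1 := by decide
  rw [univ_eq, Finset.sum_pair (by decide)]
  simp only [Equiv.Perm.sign_permCongr, sign_swap, Equiv.permCongr_apply, Equiv.symm_symm, map_one,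
    oneForm, Units.val_one, one_smul, Units.val_neg, neg_smul, ← sub_eq_add_neg,
    Equiv.Perm.one_apply, Equiv.apply_symm_apply, inl_eq, inr_eq, Equiv.swap_apply_left,
    Equiv.swap_apply_right]
  rfl

end AltProd

section TwoForm

variable {T V : Type*} [AddCommGroup T] [Module ℝ T] [AddCommGroup V] [Module ℝ V]

/-- The bilinear map with values in `V` that corresponds to a two-form with values in the degree
one part of `⋀ V`. -/
def twoFormBilin (α : T [⋀^Fin 2]→ₗ[ℝ] ExteriorAlgebra ℝ V) : T →ₗ[ℝ] T →ₗ[ℝ] V :=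
  LinearMap.mk₂ ℝ (fun s t => ExteriorAlgebra.ιInv (α ![s, t]))
    (fun s s' t => by
      rw [← map_add]
      exact congrArg _ (α.toMultilinearMap.cons_add ![t] s s'))
    (fun r s t => by
      rw [← map_smul]
      exact congrArg _ (α.toMultilinearMap.cons_smul ![t] r s))
    (fun s t t' => by
      rw [← map_add]
      exact congrArg _ ((α.curryLeft s).toMultilinearMap.cons_add ![] t t'))
    (fun r s t => by
      rw [← map_smul]
      exact congrArg _ ((α.curryLeft s).toMultilinearMap.cons_smul ![] r t))

theorem twoFormBilin_apply (α : T [⋀^Fin 2]→ₗ[ℝ] ExteriorAlgebra ℝ V) (s t : T) :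
    twoFormBilin α s t = ExteriorAlgebra.ιInv (α ![s, t]) := rfl

theorem twoFormBilin_swap (α : T [⋀^Fin 2]→ₗ[ℝ] ExteriorAlgebra ℝ V) (s t : T) :
    twoFormBilin α t s = -twoFormBilin α s t := by
  rw [twoFormBilin_apply, twoFormBilin_apply, ← map_neg,
    ← α.map_swap ![s, t] (i := 0) (j := 1) (by simp)]
  congr 2
  ext1 k
  fin_cases k <;> rfl

theorem ι_twoFormBilin {α : T [⋀^Fin 2]→ₗ[ℝ] ExteriorAlgebra ℝ V} (hα : ∀ t, α t ∈ ⋀[ℝ]^1 V)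
    (s t : T) : ι ℝ (twoFormBilin α s t) = α ![s, t] := by
  obtain ⟨v, hv⟩ := (Submodule.pow_one (ι ℝ : V →ₗ[ℝ] _).range).le (hα ![s, t])
  rw [twoFormBilin_apply, ← hv, ExteriorAlgebra.ι_leftInverse]

end TwoForm

section SymbolAlgebra

variable {T V : Type*} [AddCommGroup T] [Module ℝ T] [AddCommGroup V] [Module ℝ V]

/-- The exterior algebra of `T* ⊕ V`, in which forms on `T` with values in `⋀ V` are multiplied
with the signs of the total degree. -/
abbrev SymbolAlgebra (T V : Type*) [AddCommGroup T] [Module ℝ T] [AddCommGroup V] [Module ℝ V] :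
    Type _ := ExteriorAlgebra ℝ (Module.Dual ℝ T × V)

/-- The inclusion of `T*` in the symbol algebra. -/
def covec : Module.Dual ℝ T →ₗ[ℝ] SymbolAlgebra T V := ι ℝ ∘ₗ LinearMap.inl ℝ _ _

/-- The inclusion of `V` in the symbol algebra. -/
def vec : V →ₗ[ℝ] SymbolAlgebra T V := ι ℝ ∘ₗ LinearMap.inr ℝ _ _

variable (T V) in
/-- The inclusion of `⋀ V` in the symbol algebra. -/
def internal : ExteriorAlgebra ℝ V →ₐ[ℝ] SymbolAlgebra T V :=
  ExteriorAlgebra.map (LinearMap.inr ℝ (Module.Dual ℝ T) V)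

/-- The contraction of the form part with a vector of `T`. -/
def contr (t : T) : SymbolAlgebra T V →ₗ[ℝ] SymbolAlgebra T V :=
  contractLeft (Module.Dual.eval ℝ T t ∘ₗ LinearMap.fst ℝ (Module.Dual ℝ T) V)

@[simp] theorem internal_ι (v : V) : internal T V (ι ℝ v) = vec v :=
  ExteriorAlgebra.map_apply_ι _ _

theorem internal_injective : Function.Injective (internal T V) :=
  ExteriorAlgebra.map_injective ⟨LinearMap.snd ℝ _ _, by ext; simp⟩

theorem internal_mem {j : ℕ} {a : ExteriorAlgebra ℝ V} (ha : a ∈ ⋀[ℝ]^j V) :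
    internal T V a ∈ ⋀[ℝ]^j (Module.Dual ℝ T × V) := map_mem_exteriorPower _ ha

@[simp] theorem contr_covec_mul (t : T) (φ : Module.Dual ℝ T) (x : SymbolAlgebra T V) :
    contr t (covec φ * x) = φ t • x - covec φ * contr t x :=
  CliffordAlgebra.contractLeft_ι_mul _ _ _

@[simp] theorem contr_vec_mul (t : T) (v : V) (x : SymbolAlgebra T V) :
    contr t (vec v * x) = -(vec v * contr t x) := by
  refine (CliffordAlgebra.contractLeft_ι_mul _ _ _).trans ?_
  simp [contr, vec]

@[simp] theorem contr_internal (t : T) (a : ExteriorAlgebra ℝ V) :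
    contr t (internal T V a) = 0 := by
  have h : (Module.Dual.eval ℝ T t ∘ₗ LinearMap.fst ℝ (Module.Dual ℝ T) V) ∘ₗ
    LinearMap.inr ℝ (Module.Dual ℝ T) V = 0 := by ext; simp
  refine (contractLeft_map _ _ _).trans ((congrArg _ ?_).trans (map_zero _))
  exact (congrArg (contractLeft · a) h).trans (by simp)

@[simp] theorem contr_one (t : T) : contr t (1 : SymbolAlgebra T V) = 0 :=
  CliffordAlgebra.contractLeft_one (Q := (0 : QuadraticForm ℝ (Module.Dual ℝ T × V))) _

theorem vec_mul_vec (v w : V) : (vec v * vec w : SymbolAlgebra T V) = -(vec w * vec v) :=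
  ι_mul_ι_comm _ _

theorem vec_mul_covec (v : V) (φ : Module.Dual ℝ T) :
    (vec v * covec φ : SymbolAlgebra T V) = -(covec φ * vec v) := ι_mul_ι_comm _ _

end SymbolAlgebra

section CovecProd

variable {κ : Type*} {T V : Type*} [AddCommGroup T] [Module ℝ T] [AddCommGroup V] [Module ℝ V]

/-- The product of the one-forms dual to the basis vectors `b (c 0), b (c 1), …`. -/
def covecProd (b : Module.Basis κ ℝ T) {i : ℕ} (c : Fin i → κ) : SymbolAlgebra T V :=
  ιMulti ℝ i fun k => (b.coord (c k), (0 : V))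

variable (b : Module.Basis κ ℝ T)

theorem covecProd_cons {i : ℕ} (a : κ) (c : Fin i → κ) :
    (covecProd b (Fin.cons a c : Fin (i + 1) → κ) : SymbolAlgebra T V) =
      covec (b.coord a) * covecProd b c := by
  rw [covecProd, ExteriorAlgebra.ιMulti_succ_apply]
  rfl

theorem covecProd_one (d : Fin 1 → κ) :
    (covecProd b d : SymbolAlgebra T V) = covec (b.coord (d 0)) := by
  simp [covecProd, ExteriorAlgebra.ιMulti_apply, covec]

theorem covecProd_two (d : Fin 2 → κ) : (covecProd b d : SymbolAlgebra T V) =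
    covec (b.coord (d 0)) * covec (b.coord (d 1)) := by
  simp [covecProd, ExteriorAlgebra.ιMulti_apply, covec, Matrix.vecTail]

theorem covecProd_append {i k : ℕ} (c : Fin i → κ) (d : Fin k → κ) :
    (covecProd b (Fin.append c d) : SymbolAlgebra T V) = covecProd b c * covecProd b d := by
  rw [covecProd, covecProd, covecProd, ExteriorAlgebra.ιMulti_mul_ιMulti]
  congr 1
  funext s
  refine Fin.addCases (fun s => ?_) (fun s => ?_) s <;> simp

theorem covecProd_comp_perm {i : ℕ} (c : Fin i → κ) (σ : Equiv.Perm (Fin i)) :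
    (covecProd b (c ∘ σ) : SymbolAlgebra T V) = (Equiv.Perm.sign σ : ℤ) • covecProd b c := by
  rw [← Units.smul_def]
  exact AlternatingMap.map_perm _ (fun k => (b.coord (c k), (0 : V))) σ

theorem covecProd_mem {i : ℕ} (c : Fin i → κ) :
    (covecProd b c : SymbolAlgebra T V) ∈ ⋀[ℝ]^i (Module.Dual ℝ T × V) :=
  ExteriorAlgebra.ιMulti_range ℝ i (mem_range_self _)

theorem covecProd_eq_zero {i : ℕ} {c : Fin i → κ} (h : ¬Function.Injective c) :
    (covecProd b c : SymbolAlgebra T V) = 0 := by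
  refine ExteriorAlgebra.ιMulti_eq_zero_of_not_inj fun h' => h fun x y hxy => h' ?_
  simp only [hxy]

theorem internal_mul_covecProd {j k : ℕ} {a : ExteriorAlgebra ℝ V} (ha : a ∈ ⋀[ℝ]^j V)
    (c : Fin k → κ) : internal T V a * covecProd b c =
      (-1 : ℝ) ^ (j * k) • (covecProd b c * internal T V a) :=
  mul_comm_of_mem_exteriorPower (internal_mem ha) (covecProd_mem b c)

theorem sum_smul_covec [Fintype κ] (φ : Module.Dual ℝ T) :
    ∑ c, φ (b c) • covec (b.coord c) = (covec φ : SymbolAlgebra T V) := by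
  simp only [← map_smul, ← map_sum]
  congr 1
  exact b.ext fun k => by simp

theorem sum_covecProd_mul_perm [Fintype κ] {i k : ℕ} (σ : Equiv.Perm (Fin i ⊕ Fin k))
    (F : (Fin i → κ) → (Fin k → κ) → ExteriorAlgebra ℝ V) :
    ∑ c : Fin (i + k) → κ, covecProd b c * internal T V ((Equiv.Perm.sign σ : ℤ) •
        F (fun a => c (finSumFinEquiv (σ (Sum.inl a))))
          (fun a => c (finSumFinEquiv (σ (Sum.inr a))))) =
      ∑ c, ∑ d, covecProd b c * covecProd b d * internal T V (F c d) := by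
  let τ : Equiv.Perm (Fin (i + k)) := finSumFinEquiv.permCongr σ
  rw [← (τ.arrowCongr (Equiv.refl κ)).sum_comp, ← (Fin.appendEquiv i k).sum_comp,
    Fintype.sum_prod_type]
  refine Finset.sum_congr rfl fun c _ => Finset.sum_congr rfl fun d _ => ?_
  have sign_symm : Equiv.Perm.sign τ.symm = Equiv.Perm.sign σ := by
    rw [Equiv.Perm.sign_symm, Equiv.Perm.sign_permCongr]
  have prod_eq : (covecProd b (τ.arrowCongr (Equiv.refl κ) (Fin.appendEquiv i k (c, d))) :
      SymbolAlgebra T V) = (Equiv.Perm.sign σ : ℤ) • (covecProd b c * covecProd b d) := by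
    rw [← covecProd_append, ← sign_symm, ← covecProd_comp_perm]
    rfl
  have arg_eq : ∀ s, (τ.arrowCongr (Equiv.refl κ) (Fin.appendEquiv i k (c, d)))
      (finSumFinEquiv (σ s)) = Sum.elim c d s := fun s => by
    have symm_apply : τ.symm (finSumFinEquiv (σ s)) = finSumFinEquiv s := by
      rw [Equiv.symm_apply_eq]
      simp [τ]
    rw [Equiv.arrowCongr_apply, Function.comp_apply, Function.comp_apply, symm_apply]
    rcases s with s | s <;> simp [Fin.appendEquiv]
  have sign_mul_self : (Equiv.Perm.sign σ : ℤ) * (Equiv.Perm.sign σ : ℤ) = 1 := by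
    rw [← Units.val_mul, Int.units_mul_self, Units.val_one]
  simp only [prod_eq, arg_eq, Sum.elim_inl, Sum.elim_inr, map_zsmul,
    mul_smul_comm, smul_mul_assoc, smul_smul, sign_mul_self, one_smul]

end CovecProd

theorem curryLeft_curryLeft_comm {R M M' : Type*} [CommRing R] [AddCommGroup M] [Module R M]
    [AddCommGroup M'] [Module R M'] {i : ℕ} (A : M [⋀^Fin (i + 2)]→ₗ[R] M') (u w : M) :
    (A.curryLeft u).curryLeft w = -(A.curryLeft w).curryLeft u := by
  have h := A.curryLeft_same (u + w)
  simp only [map_add, AlternatingMap.curryLeft_add, LinearMap.add_apply,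
    AlternatingMap.curryLeft_same, zero_add, add_zero] at h
  exact eq_neg_of_add_eq_zero_right h

section Symbol

variable {κ : Type*} [Fintype κ] {T V : Type*} [AddCommGroup T] [Module ℝ T] [AddCommGroup V]
  [Module ℝ V]

/-- The element of the symbol algebra that corresponds to a form on `T` with values in `⋀ V`. The
basis `b` only serves to write it down. -/
def symb (b : Module.Basis κ ℝ T) {i : ℕ} :
    (T [⋀^Fin i]→ₗ[ℝ] ExteriorAlgebra ℝ V) →ₗ[ℝ] SymbolAlgebra T V where
  toFun A := (i.factorial : ℝ)⁻¹ • ∑ c : Fin i → κ, covecProd b c * internal T V (A (b ∘ c))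
  map_add' A B := by
    simp only [AlternatingMap.add_apply, map_add, mul_add, Finset.sum_add_distrib, smul_add]
  map_smul' r A := by
    simp only [AlternatingMap.smul_apply, map_smul, mul_smul_comm, ← Finset.smul_sum]
    rw [smul_comm, RingHom.id_apply]

variable (b : Module.Basis κ ℝ T)

theorem symb_apply {i : ℕ} (A : T [⋀^Fin i]→ₗ[ℝ] ExteriorAlgebra ℝ V) : symb b A =
    (i.factorial : ℝ)⁻¹ • ∑ c : Fin i → κ, covecProd b c * internal T V (A (b ∘ c)) := rfl

theorem symb_zero (A : T [⋀^Fin 0]→ₗ[ℝ] ExteriorAlgebra ℝ V) (t : Fin 0 → T) :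
    symb b A = internal T V (A t) := by
  rw [symb_apply]
  simp [covecProd, ExteriorAlgebra.ιMulti_zero_apply, Subsingleton.elim _ t]

theorem symb_oneForm (φ : T →ₗ[ℝ] ExteriorAlgebra ℝ V) :
    symb b (oneForm φ) = ∑ c, covec (b.coord c) * internal T V (φ (b c)) := by
  rw [symb_apply, ← (Equiv.funUnique (Fin 1) κ).symm.sum_comp]
  simp only [Nat.factorial_one, Nat.cast_one, inv_one, one_smul]
  refine Finset.sum_congr rfl fun c _ => ?_
  rw [covecProd_one]
  rfl

theorem symb_two (α : T [⋀^Fin 2]→ₗ[ℝ] ExteriorAlgebra ℝ V) : symb b α =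
    (2 : ℝ)⁻¹ • ∑ c, ∑ d, covec (b.coord c) * covec (b.coord d) *
      internal T V (α ![b c, b d]) := by
  rw [symb_apply, ← (finTwoArrowEquiv κ).symm.sum_comp, Fintype.sum_prod_type]
  simp only [Nat.factorial_two, Nat.cast_ofNat]
  congr 1
  refine Finset.sum_congr rfl fun c _ => Finset.sum_congr rfl fun d _ => ?_
  rw [covecProd_two]
  congr 3
  funext k
  fin_cases k <;> rfl

theorem sum_covec_mul_symb_curryLeft {i : ℕ} (A : T [⋀^Fin (i + 1)]→ₗ[ℝ] ExteriorAlgebra ℝ V) :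
    ∑ a, covec (b.coord a) * symb b (A.curryLeft (b a)) = (i + 1 : ℝ) • symb b A := by
  have hi : (i + 1 : ℝ) ≠ 0 := by positivity
  simp only [symb_apply]
  rw [Nat.factorial_succ, Nat.cast_mul, Nat.cast_succ, mul_inv, ← smul_smul, smul_inv_smul₀ hi,
    ← (Fin.consEquiv fun _ => κ).sum_comp, Fintype.sum_prod_type, Finset.smul_sum]
  refine Finset.sum_congr rfl fun a _ => ?_
  rw [mul_smul_comm, Finset.mul_sum]
  congr 1
  refine Finset.sum_congr rfl fun c _ => ?_
  rw [← mul_assoc, ← covecProd_cons]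
  simp only [Fin.consEquiv, AlternatingMap.curryLeft_apply_apply]
  congr 3
  funext k
  refine Fin.cases ?_ (fun _ => ?_) k <;> simp [Matrix.vecCons]

theorem sum_coord_smul_symb_curryLeft {i : ℕ} (t : T)
    (A : T [⋀^Fin (i + 1)]→ₗ[ℝ] ExteriorAlgebra ℝ V) :
    ∑ a, b.coord a t • symb b (A.curryLeft (b a)) = symb b (A.curryLeft t) := by
  conv_rhs => rw [← b.sum_repr t]
  simp only [map_sum, map_smul, Module.Basis.coord_apply]

theorem contr_symb {i : ℕ} (t : T) (A : T [⋀^Fin (i + 1)]→ₗ[ℝ] ExteriorAlgebra ℝ V) :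
    contr t (symb b A) = symb b (A.curryLeft t) := by
  induction i with
  | zero =>
    have contr_symb_zero (B : T [⋀^Fin 0]→ₗ[ℝ] ExteriorAlgebra ℝ V) :
        contr t (symb b B) = 0 := by rw [symb_zero b B 0, contr_internal]
    have h := sum_covec_mul_symb_curryLeft b A
    rw [Nat.cast_zero, zero_add, one_smul] at h
    rw [← h, map_sum]
    simp only [contr_covec_mul, contr_symb_zero, mul_zero, sub_zero,
      sum_coord_smul_symb_curryLeft]
  | succ i ih =>
    have hi : ((i + 1 : ℕ) + 1 : ℝ) ≠ 0 := by positivity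
    refine smul_right_injective _ hi ?_
    simp only
    rw [← map_smul, ← sum_covec_mul_symb_curryLeft, map_sum]
    simp only [contr_covec_mul, ih, curryLeft_curryLeft_comm A _ t, map_neg, mul_neg,
      sub_neg_eq_add, Finset.sum_add_distrib, sum_coord_smul_symb_curryLeft,
      sum_covec_mul_symb_curryLeft]
    push_cast
    module

theorem symb_injective {i : ℕ} : Function.Injective
    (symb b : (T [⋀^Fin i]→ₗ[ℝ] ExteriorAlgebra ℝ V) →ₗ[ℝ] SymbolAlgebra T V) := by
  rw [injective_iff_map_eq_zero]
  intro A h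
  induction i with
  | zero =>
    ext t
    rw [symb_zero b A t] at h
    simpa using internal_injective (h.trans (map_zero _).symm)
  | succ i ih =>
    ext t
    have curry_eq_zero : A.curryLeft (t 0) = 0 := ih _ (by rw [← contr_symb, h, map_zero])
    have := congrArg (fun B => B (Matrix.vecTail t)) curry_eq_zero
    rw [AlternatingMap.curryLeft_apply_apply] at this
    rwa [show t = Matrix.vecCons (t 0) (Matrix.vecTail t) from (Matrix.cons_head_tail t).symm]

theorem symb_altProd {A B : Type*} [AddCommGroup A] [Module ℝ A] [AddCommGroup B] [Module ℝ B]
    {i k : ℕ} (f : A →ₗ[ℝ] B →ₗ[ℝ] ExteriorAlgebra ℝ V) (α : T [⋀^Fin i]→ₗ[ℝ] A)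
    (β : T [⋀^Fin k]→ₗ[ℝ] B) : symb b (altProd i k f α β) =
      ((i.factorial : ℝ)⁻¹ * (k.factorial : ℝ)⁻¹) • ∑ c : Fin i → κ, ∑ d : Fin k → κ,
        covecProd b c * covecProd b d * internal T V (f (α (b ∘ c)) (β (b ∘ d))) := by
  have hne : ((i.factorial * k.factorial : ℕ) : ℝ) ≠ 0 := by positivity
  rw [← mul_inv, ← Nat.cast_mul, eq_inv_smul_iff₀ hne, symb_apply, smul_comm, Finset.smul_sum]
  simp only [← mul_smul_comm, ← map_smul, factorial_smul_altProd_apply]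
  simp only [map_sum, Finset.mul_sum]
  rw [Finset.sum_comm]
  have shuffle_sum (σ : Equiv.Perm (Fin i ⊕ Fin k)) :
      ∑ c : Fin (i + k) → κ, covecProd b c * internal T V ((Equiv.Perm.sign σ : ℤ) •
        f (α fun a => (b ∘ c) (finSumFinEquiv (σ (Sum.inl a))))
          (β fun a => (b ∘ c) (finSumFinEquiv (σ (Sum.inr a))))) =
      ∑ c, ∑ d, covecProd b c * covecProd b d * internal T V (f (α (b ∘ c)) (β (b ∘ d))) :=
    sum_covecProd_mul_perm b σ fun c d => f (α (b ∘ c)) (β (b ∘ d))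
  rw [Finset.sum_congr rfl fun σ _ => shuffle_sum σ, Finset.sum_const, Finset.card_univ,
    Fintype.card_perm, Fintype.card_sum, Fintype.card_fin, Fintype.card_fin,
    ← Nat.cast_smul_eq_nsmul ℝ, inv_smul_smul₀ (by positivity)]

theorem symb_altProd_mul {i j k : ℕ} {α : T [⋀^Fin i]→ₗ[ℝ] ExteriorAlgebra ℝ V}
    (hα : ∀ t, α t ∈ ⋀[ℝ]^j V) (β : T [⋀^Fin k]→ₗ[ℝ] ExteriorAlgebra ℝ V) :
    symb b ((-1 : ℝ) ^ (j * k) • altProd i k (LinearMap.mul ℝ (ExteriorAlgebra ℝ V)) α β) =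
      symb b α * symb b β := by
  rw [map_smul, symb_altProd, symb_apply, symb_apply, smul_mul_smul_comm, smul_comm,
    Finset.sum_mul_sum, Finset.smul_sum]
  congr 1
  refine Finset.sum_congr rfl fun c _ => ?_
  rw [Finset.smul_sum]
  refine Finset.sum_congr rfl fun d _ => ?_
  have h := internal_mul_covecProd b (hα (b ∘ c)) d
  calc _ = covecProd b c * ((-1 : ℝ) ^ (j * k) • (covecProd b d * internal T V (α (b ∘ c)))) *
        internal T V (β (b ∘ d)) := by
        rw [LinearMap.mul_apply', map_mul]
        simp only [smul_mul_assoc, mul_smul_comm, mul_assoc]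
    _ = _ := by rw [← h]; simp only [mul_assoc]

theorem covec_mul_symb_eq_zero {i : ℕ} (hi : Fintype.card κ ≤ i) (φ : Module.Dual ℝ T)
    (A : T [⋀^Fin i]→ₗ[ℝ] ExteriorAlgebra ℝ V) : covec φ * symb b A = 0 := by
  have not_injective (c : Fin (i + 1) → κ) : ¬Function.Injective c := fun h => by
    have := Fintype.card_le_of_injective _ h
    rw [Fintype.card_fin] at this
    omega
  rw [← sum_smul_covec b φ, Finset.sum_mul]
  refine Finset.sum_eq_zero fun a _ => ?_
  rw [symb_apply, mul_smul_comm, Finset.mul_sum, Finset.sum_eq_zero fun c _ => ?_, smul_zero]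
  rw [← mul_assoc, smul_mul_assoc, ← covecProd_cons, covecProd_eq_zero b (not_injective _),
    smul_zero, zero_mul]

end Symbol

section CoframeSymb

variable {κ : Type*} [Fintype κ] {T V : Type*} [AddCommGroup T] [Module ℝ T] [AddCommGroup V]
  [Module ℝ V] (b : Module.Basis κ ℝ T) (e : T →ₗ[ℝ] V)

/-- The element of the symbol algebra that corresponds to a linear map `T → V`. -/
def coframeSymb : SymbolAlgebra T V := ∑ c, covec (b.coord c) * vec (e (b c))

theorem symb_oneForm_ι : symb b (oneForm (ι ℝ ∘ₗ e)) = coframeSymb b e := by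
  simp [symb_oneForm, coframeSymb]

theorem coframeSymb_sub_smulRight (β : Module.Dual ℝ T) (v : V) :
    coframeSymb b (e - β.smulRight v) = coframeSymb b e - covec β * vec v := by
  simp only [coframeSymb, LinearMap.sub_apply, LinearMap.smulRight_apply, map_sub, map_smul,
    mul_sub, mul_smul_comm, Finset.sum_sub_distrib, ← smul_mul_assoc, ← Finset.sum_mul,
    sum_smul_covec]

theorem coframeSymb_commute (x : SymbolAlgebra T V) : Commute (coframeSymb b e) x := by
  induction x using ExteriorAlgebra.induction with
  | algebraMap r => exact (Algebra.commutes r _).symm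
  | ι u =>
    refine Commute.sum_left _ _ _ fun c _ => ?_
    change _ * ι ℝ u = ι ℝ u * _
    rw [mul_assoc, vec, LinearMap.comp_apply, ι_mul_ι_comm _ u, mul_neg, ← mul_assoc, covec,
      LinearMap.comp_apply, ι_mul_ι_comm _ u, neg_mul, neg_neg, mul_assoc]
  | mul x y hx hy => exact hx.mul_right hy
  | add x y hx hy => exact hx.add_right hy

theorem mul_coframeSymb_pow_mul (k : ℕ) (x y : SymbolAlgebra T V) :
    x * (coframeSymb b e ^ k * y) = coframeSymb b e ^ k * (x * y) := by
  rw [← mul_assoc, ← ((coframeSymb_commute b e x).pow_left k).eq, mul_assoc]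

theorem contr_coframeSymb_mul (t : T) (x : SymbolAlgebra T V) :
    contr t (coframeSymb b e * x) = vec (e t) * x + coframeSymb b e * contr t x := by
  have h : vec (e t) = ∑ c, b.coord c t • (vec (e (b c)) : SymbolAlgebra T V) := by
    conv_lhs => rw [← b.sum_repr t]
    simp only [map_sum, map_smul, Module.Basis.coord_apply]
  rw [h, coframeSymb, Finset.sum_mul, Finset.sum_mul, Finset.sum_mul, map_sum,
    ← Finset.sum_add_distrib]
  refine Finset.sum_congr rfl fun c _ => ?_
  simp only [mul_assoc, contr_covec_mul, contr_vec_mul, mul_neg, sub_neg_eq_add, smul_mul_assoc]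

theorem contr_coframeSymb_pow_mul (k : ℕ) (t : T) (x : SymbolAlgebra T V) :
    contr t (coframeSymb b e ^ (k + 1) * x) =
      (k + 1 : ℝ) • (coframeSymb b e ^ k * (vec (e t) * x)) +
        coframeSymb b e ^ (k + 1) * contr t x := by
  induction k generalizing x with
  | zero => simp [contr_coframeSymb_mul]
  | succ k ih =>
    rw [pow_succ', mul_assoc, contr_coframeSymb_mul, ih, mul_add, mul_smul_comm,
      mul_coframeSymb_pow_mul]
    simp only [← mul_assoc, ← pow_succ']
    push_cast
    module

omit [Fintype κ] in
theorem ιMulti_inl_succ {q : ℕ} (φ : Fin (q + 1) → Module.Dual ℝ T) :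
    ιMulti ℝ (q + 1) (LinearMap.inl ℝ _ V ∘ φ) =
      covec (φ 0) * ιMulti ℝ q (LinearMap.inl ℝ _ V ∘ φ ∘ Fin.succ) :=
  ExteriorAlgebra.ιMulti_succ_apply _

theorem contr_ιMulti_inl_mul_internal {q : ℕ} (t : T) (φ : Fin (q + 1) → Module.Dual ℝ T)
    (a : ExteriorAlgebra ℝ V) :
    contr t (ιMulti ℝ (q + 1) (LinearMap.inl ℝ _ V ∘ φ) * internal T V a) =
      ∑ i : Fin (q + 1), ((-1) ^ (i : ℕ) * φ i t) •
        (ιMulti ℝ q (LinearMap.inl ℝ _ V ∘ φ ∘ i.succAbove) * internal T V a) := by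
  induction q with
  | zero =>
    rw [ιMulti_inl_succ, mul_assoc, contr_covec_mul]
    simp [ExteriorAlgebra.ιMulti_zero_apply]
  | succ q ih =>
    have hφ (i : Fin (q + 1)) : (φ ∘ i.succ.succAbove) ∘ Fin.succ =
        (φ ∘ Fin.succ) ∘ i.succAbove := by
      ext1 j
      simp
    rw [ιMulti_inl_succ, mul_assoc, contr_covec_mul, ih, sub_eq_add_neg, Finset.mul_sum,
      ← Finset.sum_neg_distrib, Fin.sum_univ_succ (n := q + 1)]
    congr 1
    · simp [Function.comp_def]
    · refine Finset.sum_congr rfl fun i _ => ?_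
      rw [ιMulti_inl_succ (φ ∘ i.succ.succAbove), hφ, mul_assoc, mul_smul_comm, Function.comp_apply,
        Function.comp_apply, Fin.succ_succAbove_zero, Fin.val_succ, pow_succ]
      module

theorem exists_symb_eq_coframeSymb_pow (k : ℕ) :
    ∃ A : T [⋀^Fin k]→ₗ[ℝ] ExteriorAlgebra ℝ V,
      (∀ t, A t ∈ ⋀[ℝ]^k V) ∧ symb b A = coframeSymb b e ^ k := by
  induction k with
  | zero =>
    refine ⟨AlternatingMap.constOfIsEmpty ℝ T (Fin 0) 1, fun _ => SetLike.one_mem_graded _, ?_⟩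
    rw [symb_zero b _ 0]
    simp
  | succ k ih =>
    obtain ⟨A, A_mem, symb_A⟩ := ih
    refine ⟨_, fun t => ?_, (symb_altProd_mul b A_mem (oneForm (ι ℝ ∘ₗ e))).trans ?_⟩
    · exact Submodule.smul_mem _ _ (altProd_apply_mem _ _ _ _ (fun s t =>
        SetLike.mul_mem_graded (A := fun i : ℕ => ⋀[ℝ]^i V) (A_mem _)
          (ι_mem_exteriorPower_one _)) _)
    · rw [symb_A, symb_oneForm_ι, pow_succ]

theorem covec_mul_coframeSymb_pow_eq_zero {k : ℕ} (hk : Fintype.card κ ≤ k)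
    (φ : Module.Dual ℝ T) : covec φ * coframeSymb b e ^ k = 0 := by
  obtain ⟨A, -, hA⟩ := exists_symb_eq_coframeSymb_pow b e k
  rw [← hA, covec_mul_symb_eq_zero b hk]

theorem coframeSymb_pow_mul_vec_eq_zero {k : ℕ} (hk : Fintype.card κ ≤ k) (t : T) :
    coframeSymb b e ^ k * vec (e t) = 0 := by
  have pow_succ_eq_zero : coframeSymb b e ^ (k + 1) * 1 = 0 := by
    rw [mul_one, pow_succ]
    conv_lhs => rw [coframeSymb, Finset.mul_sum, ← coframeSymb]
    refine Finset.sum_eq_zero fun c _ => ?_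
    rw [← mul_assoc, ((coframeSymb_commute b e _).pow_left k).eq,
      covec_mul_coframeSymb_pow_eq_zero b e hk, zero_mul]
  have h := congrArg (contr t) pow_succ_eq_zero
  rw [contr_coframeSymb_pow_mul, map_zero, contr_one, mul_zero, add_zero, mul_one] at h
  exact (smul_eq_zero.mp h).resolve_left (by positivity)

omit [Fintype κ] in
theorem vec_mul_ιMulti_inl_mul_internal {q : ℕ} (φ : Fin (q + 1) → Module.Dual ℝ T)
    (t : Fin (q + 1) → T) :
    vec (e (t 0)) * (ιMulti ℝ (q + 1) (LinearMap.inl ℝ _ V ∘ φ) *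
        internal T V (ιMulti ℝ q (e ∘ t ∘ Fin.succ))) =
      (-1 : ℝ) ^ (q + 1) • (ιMulti ℝ (q + 1) (LinearMap.inl ℝ _ V ∘ φ) *
        internal T V (ιMulti ℝ (q + 1) (e ∘ t))) := by
  rw [← mul_assoc, vec, LinearMap.comp_apply, mul_comm_of_mem_exteriorPower
    (ι_mem_exteriorPower_one _) (ExteriorAlgebra.ιMulti_range ℝ _ (mem_range_self _)), one_mul,
    smul_mul_assoc, mul_assoc, ExteriorAlgebra.ιMulti_succ_apply (e ∘ t), map_mul, internal_ι]
  rfl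

theorem coframeSymb_pow_mul_contr_ιMulti_inl_mul_internal {p q : ℕ} {r s : ℝ}
    {x : SymbolAlgebra T V} (a : ExteriorAlgebra ℝ V) (t : Fin (q + 1) → T)
    (h : ∀ ψ : Fin q → Module.Dual ℝ T, r • (coframeSymb b e ^ p *
        (ιMulti ℝ q (LinearMap.inl ℝ _ V ∘ ψ) * internal T V a)) =
      (s * (Matrix.of fun i j => ψ i (t (Fin.succ j))).det) • x)
    (φ : Fin (q + 1) → Module.Dual ℝ T) :
    r • (coframeSymb b e ^ p * contr (t 0)
        (ιMulti ℝ (q + 1) (LinearMap.inl ℝ _ V ∘ φ) * internal T V a)) =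
      (s * (Matrix.of fun i j => φ i (t j)).det) • x := by
  have summand (i : Fin (q + 1)) : r • (coframeSymb b e ^ p * (((-1) ^ (i : ℕ) * φ i (t 0)) •
        (ιMulti ℝ q (LinearMap.inl ℝ _ V ∘ φ ∘ i.succAbove) * internal T V a))) =
      (s * ((-1) ^ (i : ℕ) * φ i (t 0) *
        (Matrix.of fun k j => φ (i.succAbove k) (t (Fin.succ j))).det)) • x := by
    rw [mul_smul_comm, smul_comm]
    refine (congrArg _ (h (φ ∘ i.succAbove))).trans ?_
    rw [smul_smul, mul_left_comm]
    rfl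
  rw [contr_ιMulti_inl_mul_internal, Finset.mul_sum, Finset.smul_sum,
    Finset.sum_congr rfl fun i _ => summand i, ← Finset.sum_smul, ← Finset.mul_sum,
    Matrix.det_succ_column_zero]
  rfl

theorem factorial_smul_coframeSymb_pow_mul_ιMulti {p q : ℕ} (hpq : Fintype.card κ ≤ p + q)
    (φ : Fin q → Module.Dual ℝ T) (t : Fin q → T) :
    ((p + q).factorial : ℝ) • (coframeSymb b e ^ p *
      (ιMulti ℝ q (LinearMap.inl ℝ _ V ∘ φ) * internal T V (ιMulti ℝ q (e ∘ t)))) =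
      ((-1) ^ q.choose 2 * p.factorial * (Matrix.of fun i j => φ i (t j)).det) •
        coframeSymb b e ^ (p + q) := by
  induction q generalizing p with
  | zero => simp [ExteriorAlgebra.ιMulti_zero_apply]
  | succ q ih =>
    rw [show p + (q + 1) = p + 1 + q by omega] at hpq ⊢
    set a := ιMulti ℝ q (e ∘ t ∘ Fin.succ) with ha
    have expand (ψ : Fin q → Module.Dual ℝ T) := ih hpq ψ (t ∘ Fin.succ)
    -- The form degree exceeds `dim T`; contraction with `t 0` turns this into the recursion.
    have pow_mul_eq_zero : ((p + 1 + q).factorial : ℝ) • (coframeSymb b e ^ (p + 1) *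
        (ιMulti ℝ (q + 1) (LinearMap.inl ℝ _ V ∘ φ) * internal T V a)) = 0 := by
      rw [ιMulti_inl_succ, mul_assoc, ← mul_coframeSymb_pow_mul, ← mul_smul_comm, expand,
        mul_smul_comm, covec_mul_coframeSymb_pow_eq_zero b e hpq, smul_zero]
    have contracted := congrArg (contr (t 0)) pow_mul_eq_zero
    rw [map_smul, contr_coframeSymb_pow_mul, map_zero, ha,
      vec_mul_ιMulti_inl_mul_internal e φ t, smul_add,
      coframeSymb_pow_mul_contr_ιMulti_inl_mul_internal b e _ t expand φ, mul_smul_comm,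
      Nat.factorial_succ p] at contracted
    rw [Nat.choose_succ_succ' q 1, Nat.choose_one_right, pow_add]
    refine smul_right_injective _ (Nat.cast_add_one_ne_zero p : (p + 1 : ℝ) ≠ 0) ?_
    push_cast at contracted
    beta_reduce
    rw [pow_succ (-1 : ℝ)] at contracted
    obtain sign | sign := neg_one_pow_eq_or ℝ q
    · rw [sign] at contracted ⊢
      linear_combination (norm := module) -contracted
    · rw [sign] at contracted ⊢
      linear_combination (norm := module) contracted

theorem factorial_smul_coframeSymb_pow_mul_one {p : ℕ} (hp : Fintype.card κ ≤ p + 1)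
    (φ : Module.Dual ℝ T) (s : T) :
    ((p + 1).factorial : ℝ) • (coframeSymb b e ^ p * (covec φ * vec (e s))) =
      (p.factorial * φ s) • coframeSymb b e ^ (p + 1) := by
  have h := factorial_smul_coframeSymb_pow_mul_ιMulti b e hp ![φ] ![s]
  simpa [ExteriorAlgebra.ιMulti_succ_apply, ExteriorAlgebra.ιMulti_zero_apply, covec] using h

theorem factorial_smul_coframeSymb_pow_mul_two {p : ℕ} (hp : Fintype.card κ ≤ p + 2)
    (φ ψ : Module.Dual ℝ T) (s t : T) : ((p + 2).factorial : ℝ) •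
      (coframeSymb b e ^ p * (covec φ * (covec ψ * (vec (e s) * vec (e t))))) =
      (-p.factorial * (φ s * ψ t - φ t * ψ s)) • coframeSymb b e ^ (p + 2) := by
  have h := factorial_smul_coframeSymb_pow_mul_ιMulti b e hp ![φ, ψ] ![s, t]
  simpa [ExteriorAlgebra.ιMulti_succ_apply, ExteriorAlgebra.ιMulti_zero_apply, covec, mul_assoc,
    Matrix.vecTail, Matrix.det_fin_two] using h

theorem factorial_smul_coframeSymb_pow_mul_three {p : ℕ} (hp : Fintype.card κ ≤ p + 3)
    (φ ψ χ : Module.Dual ℝ T) (s t u : T) : ((p + 3).factorial : ℝ) • (coframeSymb b e ^ p *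
      (covec φ * (covec ψ * (covec χ * (vec (e s) * (vec (e t) * vec (e u))))))) =
      (-p.factorial * !![φ s, φ t, φ u; ψ s, ψ t, ψ u; χ s, χ t, χ u].det) •
        coframeSymb b e ^ (p + 3) := by
  have h := factorial_smul_coframeSymb_pow_mul_ιMulti b e hp ![φ, ψ, χ] ![s, t, u]
  simpa [ExteriorAlgebra.ιMulti_succ_apply, ExteriorAlgebra.ιMulti_zero_apply, covec, mul_assoc,
    Matrix.vecTail, Matrix.det_fin_three, Odd.neg_one_pow (n := 3) (by decide)] using h

theorem smul_coframeSymb_pow_mul_covec_mul_vec_mul_vec {p : ℕ} (hp : Fintype.card κ ≤ p + 2)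
    (φ : Module.Dual ℝ T) (s t : T) :
    (p + 1 : ℝ) • (coframeSymb b e ^ p * (covec φ * (vec (e s) * vec (e t)))) =
      coframeSymb b e ^ (p + 1) * (φ s • vec (e t) - φ t • vec (e s)) := by
  set E := coframeSymb b e
  have vec_mul : vec (e t) * (covec φ * vec (e s)) =
      (covec φ * (vec (e s) * vec (e t)) : SymbolAlgebra T V) := by
    rw [← mul_assoc, vec_mul_covec, neg_mul, mul_assoc, vec_mul_vec (e t), mul_neg, neg_neg]
  have contr_pow : contr t (E ^ (p + 2)) = (p + 2 : ℝ) • (E ^ (p + 1) * vec (e t)) := by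
    have h := contr_coframeSymb_pow_mul b e (p + 1) t 1
    rw [contr_one, mul_zero, add_zero, mul_one, mul_one] at h
    push_cast at h
    rw [h]
    module
  have contr_vec : contr t (vec (e s) : SymbolAlgebra T V) = 0 := by
    rw [← internal_ι, contr_internal]
  have h := congrArg (contr t) (factorial_smul_coframeSymb_pow_mul_one b e (p := p + 1) hp φ s)
  rw [map_smul, map_smul, contr_coframeSymb_pow_mul, vec_mul, contr_covec_mul, contr_vec, mul_zero,
    sub_zero, contr_pow, Nat.factorial_succ (p + 1), Nat.cast_mul, mul_comm _
      ((p + 1).factorial : ℝ), mul_smul, mul_smul] at h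
  replace h := smul_right_injective _ (Nat.cast_ne_zero.mpr (p + 1).factorial_ne_zero) h
  refine smul_right_injective _ (Nat.cast_add_one_ne_zero (p + 1) : ((p + 1 : ℕ) + 1 : ℝ) ≠ 0) ?_
  beta_reduce
  push_cast at h ⊢
  rw [mul_smul_comm] at h
  rw [mul_sub, mul_smul_comm, mul_smul_comm]
  linear_combination (norm := module) h

theorem ιMulti_mul_eq_zero_of_coframeSymb_pow_mul {k : ℕ} (a : ExteriorAlgebra ℝ V)
    (h : coframeSymb b e ^ k * internal T V a = 0) (u : Fin k → T) :
    ιMulti ℝ k (e ∘ u) * a = 0 := by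
  induction k generalizing a with
  | zero =>
    rw [pow_zero, one_mul] at h
    rw [internal_injective (h.trans (map_zero _).symm), mul_zero]
  | succ k ih =>
    have contracted := congrArg (contr (u (Fin.last k))) h
    rw [contr_coframeSymb_pow_mul, contr_internal, mul_zero, add_zero, map_zero, ← internal_ι,
      ← map_mul] at contracted
    rw [ιMulti_succ_last, mul_assoc]
    exact ih _ ((smul_eq_zero.mp contracted).resolve_left (by positivity)) (Fin.init u)

theorem coframeSymb_pow_mul_vec_ne_zero {n : ℕ} (b : Module.Basis (Fin n) ℝ T)
    (f : Module.Basis (Fin (n + 1)) ℝ V)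
    (hf : ∀ c, f (Fin.castSucc c) = e (b c)) :
    coframeSymb b e ^ n * vec (f (Fin.last n)) ≠ 0 := by
  rw [← internal_ι]
  intro h
  have multi_eq_zero := ιMulti_mul_eq_zero_of_coframeSymb_pow_mul b e _ h b
  refine ιMulti_basis_ne_zero f ?_
  rw [ιMulti_succ_last, ← multi_eq_zero]
  congr 2
  funext c
  exact hf c

end CoframeSymb

section AdaptedBasis

variable {n : ℕ} {T V : Type*} [AddCommGroup T] [Module ℝ T] [AddCommGroup V] [Module ℝ V]
  {b : Module.Basis (Fin n) ℝ T} {e : T →ₗ[ℝ] V} {f : Module.Basis (Fin (n + 1)) ℝ V}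

theorem exists_eq_add_smul_last (hf : ∀ c, f (Fin.castSucc c) = e (b c)) (v : V) :
    ∃ t : T, v = e t + f.coord (Fin.last n) v • f (Fin.last n) := by
  refine ⟨∑ c, f.coord (Fin.castSucc c) v • b c, ?_⟩
  conv_lhs => rw [← f.sum_repr v, Fin.sum_univ_castSucc]
  simp [hf]

theorem coframeSymb_pow_mul_vec (hf : ∀ c, f (Fin.castSucc c) = e (b c)) (v : V) :
    coframeSymb b e ^ n * vec v =
      f.coord (Fin.last n) v • (coframeSymb b e ^ n * vec (f (Fin.last n))) := by
  obtain ⟨t, hv⟩ := exists_eq_add_smul_last hf v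
  conv_lhs => rw [hv, map_add, map_smul, mul_add, mul_smul_comm,
    coframeSymb_pow_mul_vec_eq_zero b e (Fintype.card_fin n).le, zero_add]

end AdaptedBasis

section KerW

variable {p : ℕ} {T V : Type*} [AddCommGroup T] [Module ℝ T] [AddCommGroup V] [Module ℝ V]
  {b : Module.Basis (Fin (p + 2)) ℝ T} {e : T →ₗ[ℝ] V} {f : Module.Basis (Fin (p + 3)) ℝ V}

theorem coord_last_eq_zero_of_sum_eq_zero
    (hf : ∀ c, f (Fin.castSucc c) = e (b c)) {v : Fin (p + 2) → Fin (p + 2) → V}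
    (v_antisymm : ∀ c d, v d c = -v c d)
    (h : ∑ c, ∑ d, coframeSymb b e ^ p *
      (covec (b.coord c) * (covec (b.coord d) * vec (v c d))) = 0) (s t : Fin (p + 2)) :
    f.coord (Fin.last _) (v s t) = 0 := by
  have vec_comm (w : V) : (vec w * (vec (e (b s)) * vec (e (b t))) : SymbolAlgebra T V) =
      vec (e (b s)) * vec (e (b t)) * vec w := by
    rw [← mul_assoc, vec_mul_vec w, neg_mul, mul_assoc, vec_mul_vec w, mul_neg, neg_neg, mul_assoc]
  have summand (c d : Fin (p + 2)) : ((p + 2).factorial : ℝ) • (coframeSymb b e ^ p *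
      (covec (b.coord c) * (covec (b.coord d) * vec (v c d))) * (vec (e (b s)) * vec (e (b t)))) =
      (-p.factorial * (b.coord c (b s) * b.coord d (b t) - b.coord c (b t) * b.coord d (b s))) •
        (f.coord (Fin.last _) (v c d) • (coframeSymb b e ^ (p + 2) * vec (f (Fin.last _)))) := by
    have h_two := factorial_smul_coframeSymb_pow_mul_two b e (p := p)
      (Fintype.card_fin _).le (b.coord c) (b.coord d) (b s) (b t)
    rw [← coframeSymb_pow_mul_vec hf, ← smul_mul_assoc _ (coframeSymb b e ^ (p + 2)), ← h_two,
      smul_mul_assoc]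
    simp only [mul_assoc, vec_comm]
  have h_mul := congrArg
    (fun x => ((p + 2).factorial : ℝ) • (x * (vec (e (b s)) * vec (e (b t))))) h
  simp only [Finset.sum_mul, Finset.smul_sum, summand, zero_mul, smul_zero,
    smul_smul, ← Finset.sum_smul] at h_mul
  have coeff_eq_zero := (smul_eq_zero.mp h_mul).resolve_right
    (coframeSymb_pow_mul_vec_ne_zero e b f hf)
  have sum_eq : ∑ c, ∑ d, (-p.factorial * (b.coord c (b s) * b.coord d (b t) -
      b.coord c (b t) * b.coord d (b s))) * f.coord (Fin.last _) (v c d) =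
      -(2 * p.factorial) * f.coord (Fin.last _) (v s t) := by
    have swap : f.coord (Fin.last _) (v t s) = -f.coord (Fin.last _) (v s t) := by
      rw [v_antisymm s t, map_neg]
    simp only [mul_sub, sub_mul, Finset.sum_sub_distrib, Module.Basis.coord_apply,
      Module.Basis.repr_self, Finsupp.single_apply, mul_ite, ite_mul, mul_one, mul_zero, zero_mul,
      Finset.sum_ite_eq, Finset.mem_univ, if_true] at swap ⊢
    rw [swap]
    ring
  rw [sum_eq] at coeff_eq_zero
  exact (mul_eq_zero.mp coeff_eq_zero).resolve_left (by simp [Nat.factorial_ne_zero])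

theorem sum_coord_eq_zero_of_sum_eq_zero
    (hf : ∀ c, f (Fin.castSucc c) = e (b c)) {τ : Fin (p + 2) → Fin (p + 2) → T}
    (τ_antisymm : ∀ c d, τ d c = -τ c d)
    (h : ∑ c, ∑ d, coframeSymb b e ^ p *
      (covec (b.coord c) * (covec (b.coord d) * vec (e (τ c d)))) = 0) (s : Fin (p + 2)) :
    ∑ c, b.coord c (τ c s) = 0 := by
  set w := f (Fin.last _)
  have summand (c d : Fin (p + 2)) : ((p + 2).factorial : ℝ) • (coframeSymb b e ^ p *
      (covec (b.coord c) * (covec (b.coord d) * vec (e (τ c d)))) * (vec (e (b s)) * vec w)) =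
      (-p.factorial * (b.coord c (τ c d) * b.coord d (b s) -
        b.coord c (b s) * b.coord d (τ c d))) • (coframeSymb b e ^ (p + 2) * vec w) := by
    have h_two := factorial_smul_coframeSymb_pow_mul_two b e (p := p)
      (Fintype.card_fin _).le (b.coord c) (b.coord d) (τ c d) (b s)
    rw [← smul_mul_assoc _ (coframeSymb b e ^ (p + 2)), ← h_two, smul_mul_assoc]
    simp only [mul_assoc]
  have h_mul := congrArg (fun x => ((p + 2).factorial : ℝ) • (x * (vec (e (b s)) * vec w))) h
  simp only [Finset.sum_mul, Finset.smul_sum, summand, zero_mul, smul_zero, ← Finset.sum_smul]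
    at h_mul
  have coeff_eq_zero := (smul_eq_zero.mp h_mul).resolve_right
    (coframeSymb_pow_mul_vec_ne_zero e b f hf)
  have sum_eq : ∑ c, ∑ d, -p.factorial * (b.coord c (τ c d) * b.coord d (b s) -
      b.coord c (b s) * b.coord d (τ c d)) = -(2 * p.factorial) * ∑ c, b.coord c (τ c s) := by
    have swap : ∑ d, b.coord d (τ s d) = -∑ c, b.coord c (τ c s) := by
      simp only [τ_antisymm _ s, map_neg, Finset.sum_neg_distrib]
    simp only [← Finset.mul_sum, Finset.sum_sub_distrib, Module.Basis.coord_apply,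
      Module.Basis.repr_self, Finsupp.single_apply, mul_ite, ite_mul, mul_one, mul_zero, zero_mul,
      one_mul, Finset.sum_ite_eq, Finset.sum_ite_irrel, Finset.mem_univ, if_true,
      Finset.sum_const_zero] at swap ⊢
    rw [swap]
    ring
  rw [sum_eq] at coeff_eq_zero
  exact (mul_eq_zero.mp coeff_eq_zero).resolve_left (by simp [Nat.factorial_ne_zero])

theorem exists_bilin_of_symb_mul_coframeSymb_pow_eq_zero (he : Function.Injective e)
    (hf : ∀ c, f (Fin.castSucc c) = e (b c))
    {θ : T [⋀^Fin 2]→ₗ[ℝ] ExteriorAlgebra ℝ V} (hθ : ∀ t, θ t ∈ ⋀[ℝ]^1 V)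
    (h : symb b θ * coframeSymb b e ^ p = 0) :
    ∃ τ : T →ₗ[ℝ] T →ₗ[ℝ] T, (∀ s t, twoFormBilin θ s t = e (τ s t)) ∧
      ∀ t, ∑ c, b.coord c (τ (b c) t) = 0 := by
  have sum_eq_zero : ∑ c, ∑ d, coframeSymb b e ^ p *
      (covec (b.coord c) * (covec (b.coord d) * vec (twoFormBilin θ (b c) (b d)))) = 0 := by
    rw [← ((coframeSymb_commute b e _).pow_left p).eq, symb_two, mul_smul_comm, smul_eq_zero] at h
    simpa only [Finset.mul_sum, ← ι_twoFormBilin hθ, internal_ι, mul_assoc] using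
      h.resolve_left (by norm_num)
  obtain ⟨r, hr⟩ := e.exists_leftInverse_of_injective (LinearMap.ker_eq_bot.mpr he)
  have e_r_basis (c d : Fin (p + 2)) :
      e (r (twoFormBilin θ (b c) (b d))) = twoFormBilin θ (b c) (b d) := by
    obtain ⟨u, hu⟩ := exists_eq_add_smul_last hf (twoFormBilin θ (b c) (b d))
    rw [coord_last_eq_zero_of_sum_eq_zero hf (fun c d => twoFormBilin_swap θ (b c) (b d))
      sum_eq_zero, zero_smul, add_zero] at hu
    rw [hu, ← LinearMap.comp_apply r e, hr, LinearMap.id_apply]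
  let τ := (twoFormBilin θ).compr₂ r
  have e_τ : τ.compr₂ e = twoFormBilin θ := b.ext fun c => b.ext fun d => e_r_basis c d
  have e_τ_apply (s t : T) : twoFormBilin θ s t = e (τ s t) := by
    rw [← LinearMap.compr₂_apply, e_τ]
  have trace_basis (d : Fin (p + 2)) : ∑ c, b.coord c (τ (b c) (b d)) = 0 :=
    sum_coord_eq_zero_of_sum_eq_zero hf (τ := fun c d => τ (b c) (b d))
      (fun c d => he (by rw [map_neg, ← e_τ_apply, ← e_τ_apply, twoFormBilin_swap]))
      (by simpa only [e_τ_apply] using sum_eq_zero) d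
  have trace_eq_zero : ∑ c, b.coord c ∘ₗ τ (b c) = 0 := b.ext fun d => by
    simpa only [LinearMap.sum_apply, LinearMap.comp_apply, LinearMap.zero_apply] using trace_basis d
  exact ⟨τ, e_τ_apply, fun t => by simpa using LinearMap.congr_fun trace_eq_zero t⟩

end KerW

section TraceFree

variable {κ : Type*} [Fintype κ] {T V : Type*} [AddCommGroup T] [Module ℝ T] [AddCommGroup V]
  [Module ℝ V] (b : Module.Basis κ ℝ T) (e : T →ₗ[ℝ] V)

/-- The trace-free part of `φ ⊗ e(s) ∧ e(t)`, as a linear map `T → ⋀² V`, for `T` of dimension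
`n`. -/
def traceFree (n : ℕ) (e : T →ₗ[ℝ] V) (φ : Module.Dual ℝ T) (s t : T) :
    T →ₗ[ℝ] ExteriorAlgebra ℝ V :=
  φ.smulRight (ι ℝ (e s) * ι ℝ (e t)) - ((n : ℝ) - 1)⁻¹ •
    (φ s • (LinearMap.mulRight ℝ (ι ℝ (e t)) ∘ₗ ι ℝ ∘ₗ e) -
      φ t • (LinearMap.mulRight ℝ (ι ℝ (e s)) ∘ₗ ι ℝ ∘ₗ e))

theorem traceFree_apply (n : ℕ) (φ : Module.Dual ℝ T) (s t y : T) :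
    traceFree n e φ s t y = φ y • (ι ℝ (e s) * ι ℝ (e t)) -
      ((n : ℝ) - 1)⁻¹ • (φ s • (ι ℝ (e y) * ι ℝ (e t)) - φ t • (ι ℝ (e y) * ι ℝ (e s))) := rfl

theorem traceFree_mem (n : ℕ) (φ : Module.Dual ℝ T) (s t y : T) :
    traceFree n e φ s t y ∈ ⋀[ℝ]^2 V := by
  have h (u w : V) : ι ℝ u * ι ℝ w ∈ ⋀[ℝ]^2 V :=
    SetLike.mul_mem_graded (A := fun i : ℕ => ⋀[ℝ]^i V) (ι_mem_exteriorPower_one u)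
      (ι_mem_exteriorPower_one w)
  exact sub_mem (Submodule.smul_mem _ _ (h _ _)) (Submodule.smul_mem _ _ (sub_mem
    (Submodule.smul_mem _ _ (h _ _)) (Submodule.smul_mem _ _ (h _ _))))

theorem symb_traceFree (n : ℕ) (φ : Module.Dual ℝ T) (s t : T) :
    symb b (oneForm (traceFree n e φ s t)) = covec φ * (vec (e s) * vec (e t)) -
      ((n : ℝ) - 1)⁻¹ • (coframeSymb b e * (φ s • vec (e t) - φ t • vec (e s))) := by
  simp only [symb_oneForm, traceFree_apply, map_sub, map_smul, map_mul, internal_ι, mul_sub,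
    mul_smul_comm, Finset.sum_sub_distrib, ← Finset.smul_sum]
  congr 1
  · simp only [← smul_mul_assoc, ← Finset.sum_mul, sum_smul_covec]
  · simp only [coframeSymb, Finset.sum_mul, mul_assoc]

theorem symb_traceFree_mul {p : ℕ} (hp : Fintype.card κ ≤ p + 2) (φ : Module.Dual ℝ T) (s t : T) :
    symb b (oneForm (traceFree (p + 2) e φ s t)) * coframeSymb b e ^ p = 0 := by
  have h := smul_coframeSymb_pow_mul_covec_mul_vec_mul_vec b e hp φ s t
  have hp_ne : (p + 1 : ℝ) ≠ 0 := by positivity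
  rw [← ((coframeSymb_commute b e _).pow_left p).eq, symb_traceFree, mul_sub, mul_smul_comm,
    ← mul_assoc _ (coframeSymb b e), ← pow_succ, ← h, smul_smul]
  push_cast
  rw [show (p : ℝ) + 2 - 1 = p + 1 by ring, inv_mul_cancel₀ hp_ne, one_smul, sub_self]

theorem covec_mul_symb_eq_zero_of_vanish {i : ℕ} (A : T [⋀^Fin i]→ₗ[ℝ] ExteriorAlgebra ℝ V)
    {c₀ : κ} (h : ∀ c : Fin i → κ, (∀ k, c k ≠ c₀) → A (b ∘ c) = 0) :
    covec (b.coord c₀) * symb b A = 0 := by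
  rw [symb_apply, mul_smul_comm, Finset.mul_sum, Finset.sum_eq_zero, smul_zero]
  intro c _
  by_cases hc : ∀ k, c k ≠ c₀
  · rw [h c hc, map_zero, mul_zero, mul_zero]
  · push Not at hc
    obtain ⟨k, hk⟩ := hc
    rw [← mul_assoc, ← covecProd_cons, covecProd_eq_zero, zero_mul]
    intro h_inj
    have zero_eq_succ : (0 : Fin (i + 1)) = k.succ := h_inj (by simp [hk])
    exact absurd zero_eq_succ (Fin.succ_ne_zero _).symm

end TraceFree

section Normalization

variable {p : ℕ} {T V : Type*} [AddCommGroup T] [Module ℝ T] [AddCommGroup V] [Module ℝ V]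
  {b : Module.Basis (Fin (p + 3)) ℝ T} {e : T →ₗ[ℝ] V}

theorem coframeSymb_pow_mul_eq_zero_of_normalized {c₀ : Fin (p + 3)} {β : Module.Dual ℝ T}
    {φ : Module.Dual ℝ T} {s t : T} (hs : φ s = 0) (ht : φ t = 0)
    (h : covec (b.coord c₀) * (coframeSymb b (e - β.smulRight (e (b c₀))) *
      coframeSymb b e ^ p * symb b (oneForm (traceFree (p + 3) e φ s t))) = 0) :
    coframeSymb b e ^ p * (covec (b.coord c₀) * (covec β * (covec φ *
      (vec (e (b c₀)) * (vec (e s) * vec (e t)))))) = 0 := by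
  have pow_mul_eq_zero := symb_traceFree_mul b e (p := p + 1) (Fintype.card_fin _).le φ s t
  have symb_eq : symb b (oneForm (traceFree (p + 3) e φ s t)) =
      covec φ * (vec (e s) * vec (e t)) := by
    rw [symb_traceFree, hs, ht]
    simp
  rw [← ((coframeSymb_commute b e _).pow_left _).eq, pow_succ', symb_eq] at pow_mul_eq_zero
  rw [coframeSymb_sub_smulRight, sub_mul, sub_mul, symb_eq, pow_mul_eq_zero, zero_sub, mul_neg,
    neg_eq_zero, mul_assoc, mul_coframeSymb_pow_mul, mul_coframeSymb_pow_mul] at h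
  rw [← neg_eq_zero, ← h, ← mul_neg, ← mul_neg, ← mul_neg, mul_assoc (covec β),
    ← mul_assoc (vec _) (covec φ), vec_mul_covec, neg_mul, mul_assoc, mul_neg (covec β)]

theorem eq_zero_of_normalized {f : Module.Basis (Fin (p + 4)) ℝ V}
    (hf : ∀ c, f (Fin.castSucc c) = e (b c)) {c₀ : Fin (p + 3)} {β : Module.Dual ℝ T}
    (h : ∀ φ s t, covec (b.coord c₀) * (coframeSymb b (e - β.smulRight (e (b c₀))) *
      coframeSymb b e ^ p * symb b (oneForm (traceFree (p + 3) e φ s t))) = 0)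
    {j : Fin (p + 3)} (hj : j ≠ c₀) : β (b j) = 0 := by
  obtain ⟨k, hk, hkj⟩ : ∃ k : Fin (p + 3), k ≠ c₀ ∧ k ≠ j := by
    obtain ⟨k, -, hk⟩ := Finset.exists_mem_notMem_of_card_lt_card (s := {c₀, j})
      (t := (Finset.univ : Finset (Fin (p + 3)))) (Finset.card_le_two.trans_lt (by simp))
    exact ⟨k, by simpa only [Finset.mem_insert, Finset.mem_singleton, not_or] using hk⟩
  set φ := b.coord k + b.coord c₀ with hφ
  have φ_s : φ (b k - b c₀) = 0 := by simp [hφ, hk, hk.symm]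
  have φ_t : φ (b j) = 0 := by simp [hφ, hkj, hj]
  have h_mul := coframeSymb_pow_mul_eq_zero_of_normalized φ_s φ_t (h φ (b k - b c₀) (b j))
  have h_three := factorial_smul_coframeSymb_pow_mul_three b e (p := p) (Fintype.card_fin _).le
    (b.coord c₀) β φ (b c₀) (b k - b c₀) (b j)
  rw [h_mul, smul_zero, eq_comm, smul_eq_zero] at h_three
  have pow_ne_zero : coframeSymb b e ^ (p + 3) ≠ 0 :=
    left_ne_zero_of_mul (coframeSymb_pow_mul_vec_ne_zero e b f hf)
  have det_eq_zero := h_three.resolve_right pow_ne_zero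
  rw [φ_s, φ_t, Matrix.det_fin_three] at det_eq_zero
  simpa [hφ, hk, hj, hj.symm, hk.symm, Nat.factorial_ne_zero] using det_eq_zero

end Normalization

section ScalarForms

variable {κ : Type*} {T V : Type*} [AddCommGroup T] [Module ℝ T] [AddCommGroup V] [Module ℝ V]

/-- The form `s ⊗ a` with values in `A`, for a scalar form `s` and `a : A`. -/
def tensorForm {A : Type*} [AddCommGroup A] [Module ℝ A] {i : ℕ} (s : T [⋀^Fin i]→ₗ[ℝ] ℝ) (a : A) :
    T [⋀^Fin i]→ₗ[ℝ] A := (LinearMap.toSpanSingleton ℝ A a).compAlternatingMap s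

@[simp] theorem tensorForm_apply {A : Type*} [AddCommGroup A] [Module ℝ A] {i : ℕ}
    (s : T [⋀^Fin i]→ₗ[ℝ] ℝ) (a : A) (t : Fin i → T) : tensorForm s a t = s t • a := rfl

theorem alternatingMap_sum_apply {A I : Type*} [AddCommGroup A] [Module ℝ A] {i : ℕ} (s : Finset I)
    (g : I → T [⋀^Fin i]→ₗ[ℝ] A) (t : Fin i → T) : (∑ k ∈ s, g k) t = ∑ k ∈ s, g k t :=
  map_sum (AddMonoidHom.mk' (fun a : T [⋀^Fin i]→ₗ[ℝ] A => a t) fun _ _ => rfl) g s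

variable [Fintype κ] (b : Module.Basis κ ℝ T)

variable (V) in
/-- The element of the symbol algebra that corresponds to a scalar form. -/
def scalarSymb {i : ℕ} (s : T [⋀^Fin i]→ₗ[ℝ] ℝ) : SymbolAlgebra T V :=
  symb b (tensorForm s (1 : ExteriorAlgebra ℝ V))

theorem scalarSymb_eq {i : ℕ} (s : T [⋀^Fin i]→ₗ[ℝ] ℝ) : scalarSymb V b s =
    (i.factorial : ℝ)⁻¹ • ∑ c : Fin i → κ, s (b ∘ c) • covecProd b c := by
  simp [scalarSymb, symb_apply]

theorem scalarSymb_mul_covec {i : ℕ} (s : T [⋀^Fin i]→ₗ[ℝ] ℝ) (φ : Module.Dual ℝ T) :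
    scalarSymb V b s * covec φ = (-1 : ℝ) ^ i • (covec φ * scalarSymb V b s) := by
  refine mul_ι_of_mem_exteriorPower ?_ _
  rw [scalarSymb_eq]
  exact Submodule.smul_mem _ _ (sum_mem fun c _ => Submodule.smul_mem _ _ (covecProd_mem b c))

theorem contr_scalarSymb {i : ℕ} (s : T [⋀^Fin (i + 1)]→ₗ[ℝ] ℝ) (t : T) :
    contr t (scalarSymb V b s) = scalarSymb V b (s.curryLeft t) := contr_symb b t _

theorem symb_tensorForm {i : ℕ} (s : T [⋀^Fin i]→ₗ[ℝ] ℝ) (a : ExteriorAlgebra ℝ V) :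
    symb b (tensorForm s a) = scalarSymb V b s * internal T V a := by
  rw [scalarSymb_eq, symb_apply, smul_mul_assoc, Finset.sum_mul]
  simp only [tensorForm_apply, map_smul, mul_smul_comm, smul_mul_assoc]

theorem symb_altProd_tensorForm {A B : Type*} [AddCommGroup A] [Module ℝ A] [AddCommGroup B]
    [Module ℝ B] (g : A →ₗ[ℝ] B →ₗ[ℝ] ExteriorAlgebra ℝ V) {i k : ℕ} (s : T [⋀^Fin i]→ₗ[ℝ] ℝ)
    (a : A) (β : T [⋀^Fin k]→ₗ[ℝ] B) : symb b (altProd i k g (tensorForm s a) β) =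
      scalarSymb V b s * symb b ((g a).compAlternatingMap β) := by
  rw [symb_altProd, scalarSymb_eq, symb_apply, smul_mul_smul_comm, Finset.sum_mul_sum]
  simp only [tensorForm_apply, map_smul, LinearMap.smul_apply, mul_smul_comm, smul_mul_assoc,
    mul_assoc, LinearMap.compAlternatingMap_apply]

end ScalarForms

section VolumeForm

variable {p q : ℕ} {T V : Type*} [AddCommGroup T] [Module ℝ T] [AddCommGroup V] [Module ℝ V]

theorem covec_mul_scalarSymb_det_curryLeft (b : Module.Basis (Fin (p + 1)) ℝ T)
    (φ : Module.Dual ℝ T) (t : T) :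
    covec φ * scalarSymb V b (b.det.curryLeft t) = φ t • scalarSymb V b b.det := by
  have covec_mul_det : covec φ * scalarSymb V b b.det = 0 :=
    covec_mul_symb_eq_zero b (Fintype.card_fin _).le _ _
  have h := contr_covec_mul t φ (scalarSymb V b b.det)
  rw [covec_mul_det, map_zero, contr_scalarSymb] at h
  exact (sub_eq_zero.mp h.symm).symm

variable (b : Module.Basis (Fin (p + 2)) ℝ T)

/-- The contraction of the volume form of a basis with two of its vectors. -/
def detContr (c d : Fin (p + 2)) : T [⋀^Fin p]→ₗ[ℝ] ℝ := (b.det.curryLeft (b c)).curryLeft (b d)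

theorem detContr_map {T' : Type*} [AddCommGroup T'] [Module ℝ T'] (L : T ≃ₗ[ℝ] T')
    (c d : Fin (p + 2)) (t : Fin p → T) : detContr (b.map L) c d (L ∘ t) = detContr b c d t := by
  simp only [detContr, AlternatingMap.curryLeft_apply_apply, Module.Basis.det_map,
    Module.Basis.map_apply, Matrix.vecCons, Fin.comp_cons, LinearEquiv.symm_apply_apply]
  congr 1
  funext k
  refine Fin.cases ?_ (fun k => Fin.cases ?_ (fun k => ?_) k) k <;> simp

theorem covec_mul_scalarSymb_detContr (c d : Fin (p + 2)) (φ : Module.Dual ℝ T) :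
    covec φ * scalarSymb V b (detContr b c d) =
      φ (b d) • scalarSymb V b (b.det.curryLeft (b c)) -
        φ (b c) • scalarSymb V b (b.det.curryLeft (b d)) := by
  have h := contr_covec_mul (b d) φ (scalarSymb V b (b.det.curryLeft (b c)))
  rw [covec_mul_scalarSymb_det_curryLeft, map_smul, contr_scalarSymb, contr_scalarSymb] at h
  exact (sub_eq_of_eq_add (eq_sub_iff_add_eq'.mp h).symm).symm

theorem scalarSymb_detContr_mul_covec_mul_covec (c d : Fin (p + 2)) (φ ψ : Module.Dual ℝ T) :
    scalarSymb V b (detContr b c d) * (covec φ * covec ψ) =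
      (φ (b c) * ψ (b d) - φ (b d) * ψ (b c)) • scalarSymb V b b.det := by
  have comm : scalarSymb V b (detContr b c d) * (covec φ * covec ψ) =
      covec φ * (covec ψ * scalarSymb V b (detContr b c d)) := by
    rw [← mul_assoc, scalarSymb_mul_covec, smul_mul_assoc, mul_assoc, scalarSymb_mul_covec,
      mul_smul_comm, smul_smul, ← mul_pow, neg_one_mul, neg_neg, one_pow, one_smul]
  rw [comm, covec_mul_scalarSymb_detContr, mul_sub, mul_smul_comm, mul_smul_comm,
    covec_mul_scalarSymb_det_curryLeft, covec_mul_scalarSymb_det_curryLeft]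
  module

variable (f : Module.Basis (Fin q) ℝ V)

theorem ιMulti_basis_mul_ι (v : V) : ιMulti ℝ q f * ι ℝ v = 0 := by
  have mul_eq : ιMulti ℝ q f * ι ℝ v = ιMulti ℝ (q + 1) (Fin.snoc f v : Fin (q + 1) → V) := by
    rw [ιMulti_succ_last, Fin.init_snoc, Fin.snoc_last]
  rw [mul_eq]
  refine AlternatingMap.map_linearDependent _ _ fun linearIndependent => ?_
  have := Module.Finite.of_basis f
  have card_le := linearIndependent.fintype_card_le_finrank (R := ℝ)
  simp [Module.finrank_eq_card_basis f] at card_le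

theorem contractRight_ιMulti_basis_mul_ι (κ : Module.Dual ℝ V) (v : V) :
    contractRight (ιMulti ℝ q f) κ * ι ℝ v = κ v • ιMulti ℝ q f := by
  have h := CliffordAlgebra.contractRight_mul_ι (Q := (0 : QuadraticForm ℝ V)) κ v (ιMulti ℝ q f)
  have mul_eq_zero : ιMulti ℝ q f * CliffordAlgebra.ι 0 v = 0 := ιMulti_basis_mul_ι f v
  rw [mul_eq_zero, map_zero, LinearMap.zero_apply] at h
  exact (sub_eq_zero.mp h.symm).symm

include f in
theorem sum_contractRight_contractRight_eq_zero {I : Type*} [Fintype I] {κ μ : I → Module.Dual ℝ V}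
    (h : ∀ v w, ∑ i, κ i v * μ i w = ∑ i, κ i w * μ i v) (x : ExteriorAlgebra ℝ V) :
    ∑ i, contractRight (contractRight x (κ i)) (μ i) = 0 := by
  set R := fun A B => contractRight (contractRight x (f.coord A)) (f.coord B) with hR
  have R_swap (A B) : R B A = -R A B :=
    CliffordAlgebra.contractRight_comm (Q := (0 : QuadraticForm ℝ V)) _ _ _
  have expand (ν : Module.Dual ℝ V) : ν = ∑ A, ν (f A) • f.coord A := f.ext fun B => by simp
  have sum_eq : ∑ i, contractRight (contractRight x (κ i)) (μ i) =
      ∑ A, ∑ B, (∑ i, κ i (f A) * μ i (f B)) • R A B := by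
    have summand (i : I) : contractRight (contractRight x (κ i)) (μ i) =
        ∑ A, ∑ B, (κ i (f A) * μ i (f B)) • R A B := by
      conv_lhs => rw [expand (κ i), expand (μ i)]
      simp only [map_sum, map_smul, LinearMap.sum_apply, LinearMap.smul_apply, Finset.smul_sum,
        smul_smul, hR]
      rw [Finset.sum_comm]
      simp only [mul_comm]
    simp only [summand, Finset.sum_smul]
    rw [Finset.sum_comm]
    exact Finset.sum_congr rfl fun _ _ => Finset.sum_comm
  have sum_eq_neg : ∑ A, ∑ B, (∑ i, κ i (f A) * μ i (f B)) • R A B =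
      -∑ A, ∑ B, (∑ i, κ i (f A) * μ i (f B)) • R A B := by
    conv_lhs => rw [Finset.sum_comm]
    simp only [← Finset.sum_neg_distrib, ← smul_neg, ← R_swap, h (f _) (f _)]
  rw [sum_eq]
  linear_combination (norm := module) (2⁻¹ : ℝ) • sum_eq_neg

end VolumeForm

section DualForm

variable {p q : ℕ} {T V : Type*} [AddCommGroup T] [Module ℝ T] [AddCommGroup V] [Module ℝ V]
  (b : Module.Basis (Fin (p + 2)) ℝ T) (f : Module.Basis (Fin q) ℝ V)

/-- The form `∑ (ι_d ι_c vol_T) ⊗ (vol_V ⌊ K^{cd})` that is dual to a tensor `K` with two indices in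
`T` and one in `V*`; here `vol_T` and `vol_V` are the volume elements of the bases. -/
def dualForm (K : Fin (p + 2) → Fin (p + 2) → Module.Dual ℝ V) :
    T [⋀^Fin p]→ₗ[ℝ] ExteriorAlgebra ℝ V :=
  ∑ c, ∑ d, tensorForm (detContr b c d) (contractRight (ιMulti ℝ q f) (K c d))

variable {K : Fin (p + 2) → Fin (p + 2) → Module.Dual ℝ V}

theorem dualForm_apply (t : Fin p → T) : dualForm b f K t =
    ∑ c, ∑ d, detContr b c d t • contractRight (ιMulti ℝ q f) (K c d) := by
  simp only [dualForm, alternatingMap_sum_apply, tensorForm_apply]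

theorem dualForm_mem (f : Module.Basis (Fin (q + 1)) ℝ V) (t : Fin p → T) :
    dualForm b f K t ∈ ⋀[ℝ]^q V := by
  rw [dualForm_apply]
  exact sum_mem fun c _ => sum_mem fun d _ => Submodule.smul_mem _ _
    (contractRight_mem_exteriorPower (ExteriorAlgebra.ιMulti_range ℝ _ (mem_range_self _)) _)

theorem symb_altProd_dualForm {B : Type*} [AddCommGroup B] [Module ℝ B] {k : ℕ}
    (g : ExteriorAlgebra ℝ V →ₗ[ℝ] B →ₗ[ℝ] ExteriorAlgebra ℝ V) (β : T [⋀^Fin k]→ₗ[ℝ] B) :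
    symb b (altProd p k g (dualForm b f K) β) = ∑ c, ∑ d, scalarSymb V b (detContr b c d) *
      symb b ((g (contractRight (ιMulti ℝ q f) (K c d))).compAlternatingMap β) := by
  simp only [dualForm, map_sum, LinearMap.sum_apply, symb_altProd_tensorForm]

theorem altProd_dualForm_eq_zero {B : Type*} [AddCommGroup B] [Module ℝ B]
    (g : ExteriorAlgebra ℝ V →ₗ[ℝ] B →ₗ[ℝ] ExteriorAlgebra ℝ V) (φ : T →ₗ[ℝ] B)
    (hK : ∀ c d, K d c = -K c d)
    (h : ∀ c, ∑ d, g (contractRight (ιMulti ℝ q f) (K c d)) (φ (b d)) = 0) :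
    altProd p 1 g (dualForm b f K) (oneForm φ) = 0 := by
  refine symb_injective b ?_
  set G := fun c d => internal T V (g (contractRight (ιMulti ℝ q f) (K c d)) (φ (b d))) with hG
  have summand (c d : Fin (p + 2)) : scalarSymb V b (detContr b c d) *
      symb b ((g (contractRight (ιMulti ℝ q f) (K c d))).compAlternatingMap (oneForm φ)) =
      (-1 : ℝ) ^ p • (scalarSymb V b (b.det.curryLeft (b c)) * G c d +
        scalarSymb V b (b.det.curryLeft (b d)) * G d c) := by
    change _ * symb b (oneForm (g _ ∘ₗ φ)) = _
    simp only [symb_oneForm, Finset.mul_sum, ← mul_assoc, scalarSymb_mul_covec,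
      covec_mul_scalarSymb_detContr, LinearMap.comp_apply, Module.Basis.coord_apply,
      Module.Basis.repr_self, Finsupp.single_apply, ite_smul, one_smul, zero_smul, smul_sub,
      smul_ite, smul_zero, sub_mul, ite_mul, zero_mul, Finset.sum_sub_distrib, Finset.sum_ite_eq,
      Finset.mem_univ, if_true, hG, hK c d, map_neg, LinearMap.neg_apply, mul_neg, smul_mul_assoc]
    module
  have sum_G (c : Fin (p + 2)) : ∑ d, G c d = 0 := by rw [← map_sum, h, map_zero]
  rw [symb_altProd_dualForm, map_zero]
  simp only [summand, ← Finset.smul_sum, Finset.sum_add_distrib, ← Finset.mul_sum, sum_G]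
  rw [Finset.sum_comm]
  simp only [← Finset.mul_sum, sum_G, mul_zero, Finset.sum_const_zero, add_zero, smul_zero]

theorem dualForm_wedge_eq_zero (e : T →ₗ[ℝ] V) (hK : ∀ c d, K d c = -K c d)
    (h : ∀ c, ∑ d, K c d (e (b d)) = 0) :
    altProd p 1 (LinearMap.mul ℝ (ExteriorAlgebra ℝ V)) (dualForm b f K)
      (oneForm (ι ℝ ∘ₗ e)) = 0 := by
  refine altProd_dualForm_eq_zero b f _ _ hK fun c => ?_
  simp only [LinearMap.mul_apply', LinearMap.comp_apply, contractRight_ιMulti_basis_mul_ι,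
    ← Finset.sum_smul, h, zero_smul]

theorem dualForm_bracket_eq_zero (μ : T →ₗ[ℝ] Module.Dual ℝ V) (hK : ∀ c d, K d c = -K c d)
    (h : ∀ c v w, ∑ d, K c d v * μ (b d) w = ∑ d, K c d w * μ (b d) v) :
    altProd p 1 (contractRight :
        ExteriorAlgebra ℝ V →ₗ[ℝ] Module.Dual ℝ V →ₗ[ℝ] ExteriorAlgebra ℝ V) (dualForm b f K)
      (oneForm μ) = 0 :=
  altProd_dualForm_eq_zero b f _ _ hK fun c => sum_contractRight_contractRight_eq_zero f (h c) _

theorem dualForm_wedge_two {α : T [⋀^Fin 2]→ₗ[ℝ] ExteriorAlgebra ℝ V}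
    (hα : ∀ t, α t ∈ ⋀[ℝ]^1 V) :
    altProd p 2 (LinearMap.mul ℝ (ExteriorAlgebra ℝ V)) (dualForm b f K) α =
      (∑ c, ∑ d, K c d (twoFormBilin α (b c) (b d))) • tensorForm b.det (ιMulti ℝ q f) := by
  refine symb_injective b ?_
  have term (c d k l : Fin (p + 2)) : scalarSymb V b (detContr b c d) *
      (covec (b.coord k) * covec (b.coord l) * internal T V
        (contractRight (ιMulti ℝ q f) (K c d) * α ![b k, b l])) =
      ((b.coord k (b c) * b.coord l (b d) - b.coord k (b d) * b.coord l (b c)) *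
        K c d (twoFormBilin α (b k) (b l))) • (scalarSymb V b b.det *
          internal T V (ιMulti ℝ q f)) := by
    rw [← ι_twoFormBilin hα, contractRight_ιMulti_basis_mul_ι, ← mul_assoc,
      scalarSymb_detContr_mul_covec_mul_covec, map_smul, smul_mul_smul_comm]
  have summand (c d : Fin (p + 2)) : scalarSymb V b (detContr b c d) * symb b
      ((LinearMap.mul ℝ (ExteriorAlgebra ℝ V)
        (contractRight (ιMulti ℝ q f) (K c d))).compAlternatingMap α) =
      K c d (twoFormBilin α (b c) (b d)) •
        (scalarSymb V b b.det * internal T V (ιMulti ℝ q f)) := by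
    simp only [symb_two, LinearMap.compAlternatingMap_apply, LinearMap.mul_apply', mul_smul_comm,
      Finset.mul_sum, term, ← Finset.sum_smul, smul_smul]
    congr 1
    simp only [Module.Basis.coord_apply, Module.Basis.repr_self, Finsupp.single_apply, sub_mul,
      mul_sub, mul_ite, mul_one, mul_zero, ite_mul, one_mul, zero_mul, Finset.sum_sub_distrib,
      Finset.sum_ite_eq, Finset.mem_univ, if_true, twoFormBilin_swap α (b c) (b d), map_neg]
    ring
  rw [symb_altProd_dualForm, map_smul, symb_tensorForm]
  simp only [summand, ← Finset.sum_smul]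

end DualForm

section DualBasis

variable {𝕜 κ T : Type*} [Field 𝕜] [DecidableEq κ] [AddCommGroup T] [Module 𝕜 T]
  {h : LinearMap.BilinForm 𝕜 T} (hh : h.Nondegenerate) (b b' : Module.Basis κ 𝕜 T)

theorem apply_dualBasis_eq_coord [Finite κ] (c : κ) : h (h.dualBasis hh b c) = b.coord c :=
  b.ext fun d => by
    rw [LinearMap.BilinForm.apply_dualBasis_left, Module.Basis.coord_apply,
      Module.Basis.repr_self, Finsupp.single_apply]

variable [Fintype κ]

theorem dualBasis_eq_sum_inv_toMatrix (c : κ) :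
    h.dualBasis hh b c = ∑ k, (LinearMap.BilinForm.toMatrix b h)⁻¹ c k • b k := by
  have hdet : IsUnit (LinearMap.BilinForm.toMatrix b h).det :=
    ((LinearMap.BilinForm.nondegenerate_iff_det_ne_zero b).1 hh).isUnit
  refine congrFun ((h.dualBasis_eq_iff hh b
    fun c => ∑ k, (LinearMap.BilinForm.toMatrix b h)⁻¹ c k • b k).2 fun c d => ?_) c
  have hinv := congrFun₂ (Matrix.nonsing_inv_mul _ hdet) c d
  rw [Matrix.mul_apply, Matrix.one_apply] at hinv
  simpa only [map_sum, map_smul, LinearMap.sum_apply, LinearMap.smul_apply, smul_eq_mul,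
    LinearMap.BilinForm.toMatrix_apply, eq_comm (a := c)] using hinv

theorem sum_apply_dualBasis_basis_change (B : LinearMap.BilinForm 𝕜 T) :
    ∑ a, B (b' a) (h.dualBasis hh b' a) = ∑ a, B (b a) (h.dualBasis hh b a) := by
  have hb' : ∀ a, b' a = ∑ c, h (h.dualBasis hh b c) (b' a) • b c := fun a => by
    simp only [apply_dualBasis_eq_coord, Module.Basis.coord_apply, b.sum_repr]
  have hb : ∀ c, ∑ a, h (h.dualBasis hh b c) (b' a) • h.dualBasis hh b' a =
      h.dualBasis hh b c := fun c => by
    simp only [← LinearMap.BilinForm.dualBasis_repr_apply hh b', Module.Basis.sum_repr]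
  calc ∑ a, B (b' a) (h.dualBasis hh b' a)
      = ∑ a, ∑ c, h (h.dualBasis hh b c) (b' a) * B (b c) (h.dualBasis hh b' a) :=
        Finset.sum_congr rfl fun a _ => by
          conv_lhs => rw [hb' a]
          simp only [map_sum, map_smul, LinearMap.sum_apply, LinearMap.smul_apply, smul_eq_mul]
    _ = ∑ c, B (b c) (h.dualBasis hh b c) := by
        rw [Finset.sum_comm]
        refine Finset.sum_congr rfl fun c _ => ?_
        conv_rhs => rw [← hb c]
        simp only [map_sum, map_smul, smul_eq_mul]

end DualBasis

section TwoFormInner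

variable {n : ℕ} {T V : Type*} [AddCommGroup T] [Module ℝ T] [AddCommGroup V] [Module ℝ V]
  {h : LinearMap.BilinForm ℝ T} (hh : h.Nondegenerate) (b b' : Module.Basis (Fin n) ℝ T)
  (q : LinearMap.BilinForm ℝ V) (α α' : T [⋀^Fin 2]→ₗ[ℝ] ExteriorAlgebra ℝ V)

theorem twoFormInner_eq_sum_dualBasis : twoFormInner b (fun u w => h u w) q α α' =
    1 / 2 * ∑ a, ∑ d, q (twoFormBilin α (b a) (b d))
      (twoFormBilin α' (h.dualBasis hh b a) (h.dualBasis hh b d)) := by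
  have hG : (Matrix.of fun a c => h (b a) (b c)) = LinearMap.BilinForm.toMatrix b h :=
    Matrix.ext fun _ _ => (LinearMap.BilinForm.toMatrix_apply ..).symm
  simp only [twoFormInner, hG, dualBasis_eq_sum_inv_toMatrix, map_sum, map_smul,
    LinearMap.sum_apply, LinearMap.smul_apply, smul_eq_mul]
  congr 1
  refine Finset.sum_congr rfl fun a _ => Finset.sum_congr rfl fun d _ => ?_
  rw [Finset.sum_comm]
  simp only [Finset.mul_sum]
  exact Finset.sum_congr rfl fun k _ => Finset.sum_congr rfl fun c _ => by
    rw [← mul_assoc, mul_comm ((LinearMap.BilinForm.toMatrix b h)⁻¹ d k)]; rfl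

include hh in
theorem twoFormInner_basis_change : twoFormInner b' (fun u w => h u w) q α α' =
    twoFormInner b (fun u w => h u w) q α α' := by
  rw [twoFormInner_eq_sum_dualBasis hh, twoFormInner_eq_sum_dualBasis hh]
  congr 1
  calc ∑ a, ∑ d, q (twoFormBilin α (b' a) (b' d))
        (twoFormBilin α' (h.dualBasis hh b' a) (h.dualBasis hh b' d))
      = ∑ a, ∑ d, q (twoFormBilin α (b' a) (b d))
        (twoFormBilin α' (h.dualBasis hh b' a) (h.dualBasis hh b d)) :=
        Finset.sum_congr rfl fun a _ => sum_apply_dualBasis_basis_change hh b b'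
          (q.compl₁₂ (twoFormBilin α (b' a)) (twoFormBilin α' (h.dualBasis hh b' a)))
    _ = ∑ a, ∑ d, q (twoFormBilin α (b a) (b d))
        (twoFormBilin α' (h.dualBasis hh b a) (h.dualBasis hh b d)) := by
        rw [Finset.sum_comm, Finset.sum_comm (f := fun a d => q (twoFormBilin α (b a) (b d)) _)]
        exact Finset.sum_congr rfl fun d _ => sum_apply_dualBasis_basis_change hh b b'
          (q.compl₁₂ ((twoFormBilin α).flip (b d))
            ((twoFormBilin α').flip (h.dualBasis hh b d)))

include hh in
theorem twoFormInner_comm (hs : h.IsSymm) (hq : q.IsSymm) :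
    twoFormInner b (fun u w => h u w) q α α' = twoFormInner b (fun u w => h u w) q α' α := by
  rw [← twoFormInner_basis_change hh b (h.dualBasis hh b), twoFormInner_eq_sum_dualBasis hh,
    twoFormInner_eq_sum_dualBasis hh, LinearMap.BilinForm.dualBasis_dualBasis hh hs]
  simp only [hq.eq (twoFormBilin α _ _) (twoFormBilin α' _ _)]

end TwoFormInner

section DualTensor

variable {n : ℕ} {T V : Type*} [AddCommGroup T] [Module ℝ T] [AddCommGroup V] [Module ℝ V]
  {h : LinearMap.BilinForm ℝ T} (hh : h.Nondegenerate) (b : Module.Basis (Fin n) ℝ T)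
  (q : LinearMap.BilinForm ℝ V) (θ : T [⋀^Fin 2]→ₗ[ℝ] ExteriorAlgebra ℝ V)

/-- The tensor `K^{cd} ∈ V*` obtained from a `V`-valued two-form `θ` by raising the form indices
with `h` and lowering the internal index with `q`. -/
def dualTensor (c d : Fin n) : Module.Dual ℝ V :=
  q.flip (twoFormBilin θ (h.dualBasis hh b c) (h.dualBasis hh b d))

theorem dualTensor_apply (c d : Fin n) (v : V) : dualTensor hh b q θ c d v =
    q v (twoFormBilin θ (h.dualBasis hh b c) (h.dualBasis hh b d)) := rfl

theorem dualTensor_antisymm (c d : Fin n) :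
    dualTensor hh b q θ d c = -dualTensor hh b q θ c d := by
  rw [dualTensor, twoFormBilin_swap, map_neg, dualTensor]

theorem sum_dualTensor_apply_twoFormBilin (α : T [⋀^Fin 2]→ₗ[ℝ] ExteriorAlgebra ℝ V) :
    ∑ c, ∑ d, dualTensor hh b q θ c d (twoFormBilin α (b c) (b d)) =
      2 * twoFormInner b (fun u w => h u w) q α θ := by
  rw [twoFormInner_eq_sum_dualBasis hh]
  simp only [dualTensor_apply]
  ring

variable {e : T →ₗ[ℝ] V} {τ : T →ₗ[ℝ] T →ₗ[ℝ] T} (hτ : ∀ s t, twoFormBilin θ s t = e (τ s t))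

include hτ in
theorem dualTensor_apply_eq_zero_of_orthogonal {v : V} (hv : ∀ t, q v (e t) = 0) (c d : Fin n) :
    dualTensor hh b q θ c d v = 0 := by
  rw [dualTensor_apply, hτ, hv]

include hτ in
theorem sum_dualTensor_apply_eq_zero (hs : h.IsSymm) (hq : ∀ u w, q (e u) (e w) = h u w)
    (htrace : ∀ t, ∑ c, b.coord c (τ (b c) t) = 0) (c : Fin n) :
    ∑ d, dualTensor hh b q θ c d (e (b d)) = 0 := by
  have hdual := sum_apply_dualBasis_basis_change hh (h.dualBasis hh b) b
    (h.compl₁₂ LinearMap.id (τ.flip (h.dualBasis hh b c)))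
  simp only [LinearMap.compl₁₂_apply, LinearMap.id_apply, LinearMap.flip_apply,
    LinearMap.BilinForm.dualBasis_dualBasis hh hs, apply_dualBasis_eq_coord, htrace] at hdual
  simp only [dualTensor_antisymm hh b q θ _ c, LinearMap.neg_apply, dualTensor_apply, hτ, hq,
    Finset.sum_neg_distrib, hdual, neg_zero]

end DualTensor

section BracketTraceFree

variable {n : ℕ} {T V : Type*} [AddCommGroup T] [Module ℝ T] [AddCommGroup V] [Module ℝ V]

theorem contractRight_ι_mul_ι (u w : V) (d : Module.Dual ℝ V) :
    contractRight (ι ℝ u * ι ℝ w) d = ι ℝ (d w • u - d u • w) := by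
  have hu : contractRight (ι ℝ u) d = algebraMap ℝ (ExteriorAlgebra ℝ V) (d u) :=
    CliffordAlgebra.contractRight_ι (Q := 0) d u
  refine (CliffordAlgebra.contractRight_mul_ι d w (ι ℝ u)).trans ?_
  rw [hu, map_sub, map_smul, map_smul, Algebra.smul_def (d u)]

variable (b : Module.Basis (Fin n) ℝ T) (e : T →ₗ[ℝ] V) (η : LinearMap.BilinForm ℝ V)

theorem twoFormBilin_bracket_traceFree (φ : Module.Dual ℝ T) (s t y z : T) :
    let Φ : T → T → V := fun y z =>
      φ y • (η (e z) (e t) • e s - η (e z) (e s) • e t) - ((n : ℝ) - 1)⁻¹ •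
        (φ s • (η (e z) (e t) • e y - η (e z) (e y) • e t) -
          φ t • (η (e z) (e s) • e y - η (e z) (e y) • e s))
    twoFormBilin (altProd 1 1 contractRight (oneForm (traceFree n e φ s t)) (oneForm (η ∘ₗ e))) y z
      = Φ y z - Φ z y := by
  intro Φ
  have hΦ : ∀ y z, contractRight (traceFree n e φ s t y) ((η ∘ₗ e) z) = ι ℝ (Φ y z) := by
    intro y z
    simp only [traceFree_apply, map_sub, map_smul, LinearMap.sub_apply, LinearMap.smul_apply,
      contractRight_ι_mul_ι, LinearMap.comp_apply, Φ]
  rw [twoFormBilin_apply, altProd_one_one_apply]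
  change ExteriorAlgebra.ιInv (contractRight (traceFree n e φ s t y) ((η ∘ₗ e) z) -
    contractRight (traceFree n e φ s t z) ((η ∘ₗ e) y)) = _
  rw [hΦ, hΦ, ← map_sub, ExteriorAlgebra.ι_leftInverse]

variable {b e η} {K : Fin n → Fin n → Module.Dual ℝ V} (hK : ∀ c d, K d c = -K c d)

include hK in
theorem sum_antisymm_apply_sub_swap (Φ : Fin n → Fin n → V) :
    ∑ c, ∑ d, K c d (Φ c d - Φ d c) = 2 * ∑ c, ∑ d, K c d (Φ c d) := by
  have hswap : ∑ c, ∑ d, K c d (Φ d c) = -∑ c, ∑ d, K c d (Φ c d) := by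
    rw [Finset.sum_comm]
    simp only [← Finset.sum_neg_distrib]
    exact Finset.sum_congr rfl fun c _ => Finset.sum_congr rfl fun d _ => by
      rw [hK c d, LinearMap.neg_apply]
  simp only [map_sub, Finset.sum_sub_distrib, hswap]
  ring

include hK in
theorem sum_antisymm_mul_symm_eq_zero {g : Fin n → Fin n → ℝ} (hg : ∀ c d, g d c = g c d) (v : V) :
    ∑ c, ∑ d, g d c * K c d v = 0 := by
  have hneg : ∑ c, ∑ d, g d c * K c d v = -∑ c, ∑ d, g d c * K c d v := by
    conv_lhs => rw [Finset.sum_comm]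
    simp only [← Finset.sum_neg_distrib]
    exact Finset.sum_congr rfl fun c _ => Finset.sum_congr rfl fun d _ => by
      rw [hK c d, hg, LinearMap.neg_apply, mul_neg]
  linarith

include hK in
theorem sum_apply_bracket_traceFree (hη : η.IsSymm) (htrace : ∀ c, ∑ d, K c d (e (b d)) = 0)
    (k : Fin n) (s t : T) :
    ∑ c, ∑ d, K c d (twoFormBilin (altProd 1 1 contractRight
        (oneForm (traceFree n e (b.coord k) s t)) (oneForm (η ∘ₗ e))) (b c) (b d)) =
      2 * (∑ d, K k d (e s) * η (e (b d)) (e t) - ∑ d, K k d (e t) * η (e (b d)) (e s)) := by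
  have htrace' : ∀ w, ∑ c, ∑ d, η (e (b d)) w * K c d (e (b c)) = 0 := by
    intro w
    rw [Finset.sum_comm]
    refine Finset.sum_eq_zero fun d _ => ?_
    rw [← Finset.mul_sum]
    simp only [hK d, LinearMap.neg_apply, Finset.sum_neg_distrib, htrace, neg_zero, mul_zero]
  have hsymm := fun v => sum_antisymm_mul_symm_eq_zero hK
    (g := fun c d => η (e (b c)) (e (b d))) (fun c d => hη.eq _ _) v
  have hcoord : ∀ v w, ∑ c, ∑ d, b.coord k (b c) * (η (e (b d)) w * K c d v) =
      ∑ d, K k d v * η (e (b d)) w := by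
    intro v w
    simp only [← Finset.mul_sum]
    rw [Finset.sum_eq_single k (fun c _ hc => ?_) fun hk => absurd (Finset.mem_univ k) hk]
    · simp only [Module.Basis.coord_apply, Module.Basis.repr_self, Finsupp.single_eq_same,
        one_mul, mul_comm (η _ _)]
    · rw [Module.Basis.coord_apply, Module.Basis.repr_self, Finsupp.single_eq_of_ne hc.symm,
        zero_mul]
  simp only [twoFormBilin_bracket_traceFree]
  rw [sum_antisymm_apply_sub_swap hK fun c d => _]
  simp only [map_sub, map_smul, smul_eq_mul, mul_sub, Finset.sum_sub_distrib, hcoord]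
  simp only [← Finset.mul_sum, htrace', hsymm, mul_zero, sub_zero]

theorem sum_mul_comm_of_adapted {f : Module.Basis (Fin (n + 1)) ℝ V} {μ : T →ₗ[ℝ] Module.Dual ℝ V}
    (hf : ∀ c, f (Fin.castSucc c) = e (b c)) {k : Fin n}
    (hKlast : ∀ d, K k d (f (Fin.last n)) = 0) (hμlast : ∀ u, μ u (f (Fin.last n)) = 0)
    (hμ : ∀ u w, μ u (e w) = η (e u) (e w))
    (hsymm : ∀ s t, ∑ d, K k d (e s) * η (e (b d)) (e t) =
      ∑ d, K k d (e t) * η (e (b d)) (e s)) (v w : V) :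
    ∑ d, K k d v * μ (b d) w = ∑ d, K k d w * μ (b d) v := by
  let M : LinearMap.BilinForm ℝ V := ∑ d, (LinearMap.mul ℝ ℝ).compl₁₂ (K k d) (μ (b d))
  have hM : ∀ v w, M v w = ∑ d, K k d v * μ (b d) w := fun v w => by
    simp only [M, LinearMap.sum_apply, LinearMap.compl₁₂_apply, LinearMap.mul_apply']
  have hflip : M = M.flip := f.ext fun A => f.ext fun B => by
    rw [LinearMap.BilinForm.flip_apply, hM, hM]
    induction A using Fin.lastCases with
    | last => simp only [hKlast, hμlast, zero_mul, mul_zero, Finset.sum_const_zero]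
    | cast c =>
      induction B using Fin.lastCases with
      | last => simp only [hKlast, hμlast, zero_mul, mul_zero, Finset.sum_const_zero]
      | cast d => simp only [hf, hμ, hsymm (b c) (b d)]
  rw [← hM, hflip, LinearMap.BilinForm.flip_apply, hM]

end BracketTraceFree

section DualSmooth

variable {E₀ : Type*} [NormedAddCommGroup E₀] [NormedSpace ℝ E₀] {H₀ : Type*} [TopologicalSpace H₀]
  {I : ModelWithCorners ℝ E₀ H₀} {M : Type*} [TopologicalSpace M] [ChartedSpace H₀ M] {x : M}
variable {F : Type*} [NormedAddCommGroup F] [NormedSpace ℝ F] [FiniteDimensional ℝ F]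
variable {W W₂ : Type*} [AddCommGroup W] [Module ℝ W] [AddCommGroup W₂] [Module ℝ W₂]

/-- Smoothness at `x` of a function with values in a finite-dimensional vector space that carries
no topology, such as an exterior algebra: all components are smooth at `x`. -/
def DualSmoothAt (I : ModelWithCorners ℝ E₀ H₀) (a : M → W) (x : M) : Prop :=
  ∀ l : Module.Dual ℝ W, ContMDiffAt I 𝓘(ℝ, ℝ) ∞ (fun y => l (a y)) x

theorem dualSmoothAt_iff_contMDiffAt {a : M → F} :
    DualSmoothAt I a x ↔ ContMDiffAt I 𝓘(ℝ, F) ∞ a x := by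
  refine ⟨fun ha => ?_, fun ha l =>
    (LinearMap.toContinuousLinearMap l).contMDiff.contMDiffAt.comp x ha⟩
  have ha_eq : a = fun y =>
      ∑ k, (Module.finBasis ℝ F).coord k (a y) • Module.finBasis ℝ F k := by
    funext y
    simp only [Module.Basis.coord_apply, Module.Basis.sum_repr]
  rw [ha_eq]
  exact contMDiffAt_finsetSum fun k _ => (ha _).smul contMDiffAt_const

namespace DualSmoothAt

variable {a a' : M → W}

theorem congr_of_eventuallyEq (ha : DualSmoothAt I a x) (h : a' =ᶠ[𝓝 x] a) :
    DualSmoothAt I a' x :=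
  fun l => (ha l).congr_of_eventuallyEq (h.fun_comp l)

theorem const (w : W) : DualSmoothAt I (fun _ : M => w) x := fun _ => contMDiffAt_const

theorem add (ha : DualSmoothAt I a x) (ha' : DualSmoothAt I a' x) :
    DualSmoothAt I (fun y => a y + a' y) x := fun l => by
  simp only [map_add]
  exact (ha l).add (ha' l)

theorem sub (ha : DualSmoothAt I a x) (ha' : DualSmoothAt I a' x) :
    DualSmoothAt I (fun y => a y - a' y) x := fun l => by
  simp only [map_sub]
  exact (ha l).sub (ha' l)

theorem smul {r : M → ℝ} (hr : ContMDiffAt I 𝓘(ℝ, ℝ) ∞ r x) (ha : DualSmoothAt I a x) :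
    DualSmoothAt I (fun y => r y • a y) x := fun l => by
  simp only [map_smul, smul_eq_mul]
  exact hr.mul (ha l)

theorem sum {ι : Type*} {s : Finset ι} {g : ι → M → W} (h : ∀ k ∈ s, DualSmoothAt I (g k) x) :
    DualSmoothAt I (fun y => ∑ k ∈ s, g k y) x := fun l => by
  simp only [map_sum]
  exact contMDiffAt_finsetSum fun k hk => h k hk l

theorem linear_comp (L : W →ₗ[ℝ] W₂) (ha : DualSmoothAt I a x) :
    DualSmoothAt I (fun y => L (a y)) x :=
  fun l => ha (l ∘ₗ L)

theorem linearMap_apply [Module.Finite ℝ W] {G : M → W →ₗ[ℝ] W₂}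
    (hG : ∀ w, DualSmoothAt I (fun y => G y w) x) (ha : DualSmoothAt I a x) :
    DualSmoothAt I (fun y => G y (a y)) x := by
  have hGa : (fun y => G y (a y)) = fun y =>
      ∑ k, (Module.finBasis ℝ W).coord k (a y) • G y (Module.finBasis ℝ W k) := by
    funext y
    simp only [Module.Basis.coord_apply, ← map_smul, ← map_sum, Module.Basis.sum_repr]
  rw [hGa]
  exact sum fun k _ => smul (ha _) (hG _)

theorem alternatingMap_apply [Module.Finite ℝ W] {i : ℕ} {A : M → W [⋀^Fin i]→ₗ[ℝ] W₂}
    {u : Fin i → M → W} (hA : ∀ w, DualSmoothAt I (fun y => A y w) x)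
    (hu : ∀ k, DualSmoothAt I (u k) x) : DualSmoothAt I (fun y => A y fun k => u k y) x := by
  set B := Module.finBasis ℝ W
  have hAu : (fun y => A y fun k => u k y) = fun y => ∑ c : Fin i → Fin (Module.finrank ℝ W),
      (∏ k, B.coord (c k) (u k y)) • A y fun k => B (c k) := by
    funext y
    have hu_eq : (fun k => u k y) = fun k => ∑ j, B.coord j (u k y) • B j := by
      funext k
      simp only [Module.Basis.coord_apply, Module.Basis.sum_repr]
    conv_lhs => rw [hu_eq]
    rw [← AlternatingMap.coe_multilinearMap, MultilinearMap.map_sum]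
    simp only [MultilinearMap.map_smul_univ, AlternatingMap.coe_multilinearMap]
  rw [hAu]
  exact sum fun c _ => smul (contMDiffAt_finsetProd fun k _ => hu k _) (hA _)

end DualSmoothAt

section ExteriorAlgebra

instance finite_exteriorAlgebra [Module.Finite ℝ W] : Module.Finite ℝ (ExteriorAlgebra ℝ W) :=
  Module.Finite.of_basis (Module.finBasis ℝ W).ExteriorAlgebra

namespace DualSmoothAt

theorem mul [Module.Finite ℝ W] {a a' : M → ExteriorAlgebra ℝ W}
    (ha : DualSmoothAt I a x) (ha' : DualSmoothAt I a' x) :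
    DualSmoothAt I (fun y => a y * a' y) x :=
  linearMap_apply (G := fun y => LinearMap.mulLeft ℝ (a y))
    (fun w => ha.linear_comp (LinearMap.mulRight ℝ w)) ha'

theorem exteriorAlgebra_map [Module.Finite ℝ W] [Module.Finite ℝ W₂] {G : M → W →ₗ[ℝ] W₂}
    (hG : ∀ u, DualSmoothAt I (fun y => G y u) x)
    {a : M → ExteriorAlgebra ℝ W} (ha : DualSmoothAt I a x) :
    DualSmoothAt I (fun y => ExteriorAlgebra.map (G y) (a y)) x := by
  refine linearMap_apply (G := fun y => (ExteriorAlgebra.map (G y)).toLinearMap) (fun w => ?_) ha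
  simp only [AlgHom.toLinearMap_apply]
  induction w using ExteriorAlgebra.induction with
  | algebraMap r => simpa only [AlgHom.commutes] using const _
  | ι u => simpa only [ExteriorAlgebra.map_apply_ι] using (hG u).linear_comp (ι ℝ)
  | mul a b ha hb => simpa only [map_mul] using ha.mul hb
  | add a b ha hb =>
    simp only [map_add]
    exact ha.add hb

theorem map_contractRight_ιMulti [Module.Finite ℝ W] {V : M → Type*} [∀ y, AddCommGroup (V y)]
    [∀ y, Module ℝ (V y)] (G : ∀ y, V y →ₗ[ℝ] W) {n : ℕ} (f : ∀ y, Fin n → V y)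
    {d : ∀ y, Module.Dual ℝ (V y)} (hf : ∀ k, DualSmoothAt I (fun y => G y (f y k)) x)
    (hd : ∀ k, ContMDiffAt I 𝓘(ℝ, ℝ) ∞ (fun y => d y (f y k)) x) :
    DualSmoothAt I
      (fun y => ExteriorAlgebra.map (G y) (contractRight (ιMulti ℝ n (f y)) (d y))) x := by
  induction n with
  | zero =>
    simp only [ExteriorAlgebra.ιMulti_zero_apply, CliffordAlgebra.contractRight_one, map_zero]
    exact const 0
  | succ n ih =>
    simp only [ιMulti_succ_last, CliffordAlgebra.contractRight_mul_ι, map_sub, map_smul, map_mul]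
    refine sub (smul (hd _) ?_) (mul (ih _ (fun k => hf _) fun k => hd _) ?_)
    · simp only [ExteriorAlgebra.map_apply_ιMulti]
      exact alternatingMap_apply (fun w => const _) fun k => hf _
    · simp only [ExteriorAlgebra.map_apply_ι]
      exact (hf _).linear_comp (ι ℝ)

end DualSmoothAt

end ExteriorAlgebra

end DualSmooth

section SmoothSection

variable {E₀ : Type*} [NormedAddCommGroup E₀] [NormedSpace ℝ E₀] {H₀ : Type*} [TopologicalSpace H₀]
  {I : ModelWithCorners ℝ E₀ H₀} {M : Type*} [TopologicalSpace M] [ChartedSpace H₀ M]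
  {F : Type*} [NormedAddCommGroup F] [NormedSpace ℝ F]
  {V : M → Type*} [∀ x, AddCommGroup (V x)] [∀ x, Module ℝ (V x)] [∀ x, TopologicalSpace (V x)]
  [TopologicalSpace (TotalSpace F V)] [FiberBundle F V] [VectorBundle ℝ F V]

/-- Smoothness at `x` of a section of the bundle `V` with model fibre `F`. -/
abbrev SmoothSectionAt (I : ModelWithCorners ℝ E₀ H₀) (F : Type*) [NormedAddCommGroup F]
    [NormedSpace ℝ F] {V : M → Type*} [TopologicalSpace (TotalSpace F V)]
    [∀ x, TopologicalSpace (V x)] [FiberBundle F V] (s : ∀ x, V x) (x : M) : Prop :=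
  ContMDiffAt I (I.prod 𝓘(ℝ, F)) ∞ (fun y => TotalSpace.mk' F y (s y)) x

variable [ContMDiffVectorBundle ∞ F V I]
  (e : Trivialization F (TotalSpace.proj : TotalSpace F V → M)) [MemTrivializationAtlas e] {x : M}

theorem smoothSectionAt_iff_linearMapAt (s : ∀ x, V x) (hx : x ∈ e.baseSet) :
    SmoothSectionAt I F s x ↔ ContMDiffAt I 𝓘(ℝ, F) ∞ (fun y => e.linearMapAt ℝ y (s y)) x := by
  rw [SmoothSectionAt, e.contMDiffAt_section_iff hx]
  refine Filter.EventuallyEq.contMDiffAt_iff ?_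
  filter_upwards [e.open_baseSet.mem_nhds hx] with y hy
  rw [Trivialization.coe_linearMapAt_of_mem _ hy]

theorem smoothSectionAt_symmL (hx : x ∈ e.baseSet) (v : F) :
    SmoothSectionAt I F (fun y => e.symmL ℝ y v) x := by
  rw [smoothSectionAt_iff_linearMapAt e _ hx]
  refine (contMDiffAt_const (c := v)).congr_of_eventuallyEq ?_
  filter_upwards [e.open_baseSet.mem_nhds hx] with y hy
  exact Trivialization.linearMapAt_symmₗ _ hy v

end SmoothSection

section LocalRepresentative

variable {m : ℕ} {M : Type*} [TopologicalSpace M] [ChartedSpace (BaseModel m) M]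
  [IsManifold (𝓡 (m + 3)) ∞ M]

variable (m) in
/-- The preferred trivialization of the tangent bundle at a point. -/
abbrev tangentTriv (x₀ : M) : Trivialization (BaseModel m)
    (TotalSpace.proj : TotalSpace (BaseModel m) (TangentSpace (𝓡 (m + 3)) : M → Type _) → M) :=
  trivializationAt (BaseModel m) (TangentSpace (𝓡 (m + 3)) : M → Type _) x₀

variable {V : M → Type*} [∀ x, TopologicalSpace (V x)]
  [TopologicalSpace (TotalSpace (FibreModel m) V)] [FiberBundle (FibreModel m) V]

variable (m V) in
/-- The preferred trivialization of `V` at a point. -/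
abbrev fibreTriv (x₀ : M) : Trivialization (FibreModel m)
    (TotalSpace.proj : TotalSpace (FibreModel m) V → M) :=
  trivializationAt (FibreModel m) V x₀

variable (m V) in
/-- The common domain of the preferred trivializations of `TM` and `V` at a point. -/
def trivDomain (x₀ : M) : Set M := (tangentTriv m x₀).baseSet ∩ (fibreTriv m V x₀).baseSet

theorem isOpen_trivDomain (x₀ : M) : IsOpen (trivDomain m V x₀) :=
  (tangentTriv m x₀).open_baseSet.inter (fibreTriv m V x₀).open_baseSet

theorem mem_trivDomain (x₀ : M) : x₀ ∈ trivDomain m V x₀ :=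
  ⟨mem_baseSet_trivializationAt _ _ _, mem_baseSet_trivializationAt _ _ _⟩

variable [∀ x, AddCommGroup (V x)] [∀ x, Module ℝ (V x)] [VectorBundle ℝ (FibreModel m) V]

/-- A field of forms, read in the preferred trivializations of `TM` and `V` at `x₀`. -/
def localRep {i : ℕ} (x₀ : M) (φ : FormField m V i) (y : M) :
    BaseModel m [⋀^Fin i]→ₗ[ℝ] ExteriorAlgebra ℝ (FibreModel m) :=
  (ExteriorAlgebra.map ((fibreTriv m V x₀).linearMapAt ℝ y)).toLinearMap.compAlternatingMap
    ((φ y).compLinearMap ((tangentTriv m x₀).symmL ℝ y).toLinearMap)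

theorem localRep_apply {i : ℕ} (x₀ : M) (φ : FormField m V i) (y : M) (v : Fin i → BaseModel m) :
    localRep x₀ φ y v = ExteriorAlgebra.map ((fibreTriv m V x₀).linearMapAt ℝ y)
      (φ y fun k => (tangentTriv m x₀).symmL ℝ y (v k)) := rfl

theorem isSmoothField_iff_localRep {i : ℕ} {φ : FormField m V i} : IsSmoothField φ ↔
    ∀ (x₀ : M) (v : Fin i → BaseModel m), ∀ x ∈ trivDomain m V x₀,
      DualSmoothAt (𝓡 (m + 3)) (fun y => localRep x₀ φ y v) x := by
  refine ⟨fun h x₀ v x hx l => ?_, fun h x₀ v l x hx => (h x₀ v x hx l).contMDiffWithinAt⟩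
  exact (h x₀ v l x hx).contMDiffAt ((isOpen_trivDomain x₀).mem_nhds hx)

theorem localRep_eq_map_localRep {i : ℕ} (x₀ x₁ : M) (φ : FormField m V i) {y : M}
    (hy : y ∈ trivDomain m V x₀) (v : Fin i → BaseModel m) :
    localRep x₁ φ y v = ExteriorAlgebra.map
      ((fibreTriv m V x₁).linearMapAt ℝ y ∘ₗ ((fibreTriv m V x₀).symmL ℝ y).toLinearMap)
      (localRep x₀ φ y fun k =>
        (tangentTriv m x₀).linearMapAt ℝ y ((tangentTriv m x₁).symmL ℝ y (v k))) := by
  have hbase : ∀ u, (tangentTriv m x₀).symmL ℝ y ((tangentTriv m x₀).linearMapAt ℝ y u) = u :=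
    fun u => Trivialization.symmₗ_linearMapAt (R := ℝ) _ hy.1 u
  have hfibre : ((fibreTriv m V x₁).linearMapAt ℝ y ∘ₗ
      ((fibreTriv m V x₀).symmL ℝ y).toLinearMap) ∘ₗ (fibreTriv m V x₀).linearMapAt ℝ y =
      (fibreTriv m V x₁).linearMapAt ℝ y :=
    LinearMap.ext fun u => congrArg _ (Trivialization.symmₗ_linearMapAt (R := ℝ) _ hy.2 u)
  simp only [localRep_apply, hbase]
  rw [← AlgHom.comp_apply, ExteriorAlgebra.map_comp_map, hfibre]

variable [ContMDiffVectorBundle ∞ (FibreModel m) V (𝓡 (m + 3))]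

theorem dualSmoothAt_localRep_of_mem {i : ℕ} {φ : FormField m V i} {x₀ x₁ x : M}
    (hx₀ : x ∈ trivDomain m V x₀) (hx₁ : x ∈ trivDomain m V x₁)
    (h : ∀ v, DualSmoothAt (𝓡 (m + 3)) (fun y => localRep x₀ φ y v) x)
    (v : Fin i → BaseModel m) : DualSmoothAt (𝓡 (m + 3)) (fun y => localRep x₁ φ y v) x := by
  have hbase : ∀ k, DualSmoothAt (𝓡 (m + 3)) (fun y =>
      (tangentTriv m x₀).linearMapAt ℝ y ((tangentTriv m x₁).symmL ℝ y (v k))) x := fun k =>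
    dualSmoothAt_iff_contMDiffAt.mpr ((smoothSectionAt_iff_linearMapAt _ _ hx₀.1).mp
      (smoothSectionAt_symmL _ hx₁.1 _))
  have hfibre : ∀ u, DualSmoothAt (𝓡 (m + 3)) (fun y => ((fibreTriv m V x₁).linearMapAt ℝ y ∘ₗ
      ((fibreTriv m V x₀).symmL ℝ y).toLinearMap) u) x := fun u =>
    dualSmoothAt_iff_contMDiffAt.mpr ((smoothSectionAt_iff_linearMapAt _ _ hx₁.2).mp
      (smoothSectionAt_symmL _ hx₀.2 _))
  refine (DualSmoothAt.exteriorAlgebra_map hfibre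
    (DualSmoothAt.alternatingMap_apply h hbase)).congr_of_eventuallyEq ?_
  filter_upwards [(isOpen_trivDomain x₀).mem_nhds hx₀] with y hy
  exact localRep_eq_map_localRep x₀ x₁ φ hy v

theorem isSmoothField_of_support {i : ℕ} {φ : FormField m V i} {x₀ : M} {K : Set M}
    (hK : IsClosed K) (hKU : K ⊆ trivDomain m V x₀) (hφ : ∀ x, x ∉ K → φ x = 0)
    (h : ∀ v, ∀ x ∈ trivDomain m V x₀,
      DualSmoothAt (𝓡 (m + 3)) (fun y => localRep x₀ φ y v) x) : IsSmoothField φ := by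
  rw [isSmoothField_iff_localRep]
  intro x₁ v x hx
  by_cases hxK : x ∈ K
  · exact dualSmoothAt_localRep_of_mem (hKU hxK) hx (fun w => h w x (hKU hxK)) v
  · refine (DualSmoothAt.const 0).congr_of_eventuallyEq ?_
    filter_upwards [hK.isOpen_compl.mem_nhds hxK] with y hy
    rw [localRep_apply, hφ y hy, AlternatingMap.zero_apply, map_zero]

theorem IsSmoothField.smoothSectionAt {i : ℕ} {φ : FormField m V i} (h : IsSmoothField φ)
    {x₀ x : M} (hx : x ∈ trivDomain m V x₀) (v : Fin i → BaseModel m) :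
    SmoothSectionAt (𝓡 (m + 3)) (FibreModel m) (fun y => ExteriorAlgebra.ιInv
      (φ y fun k => (tangentTriv m x₀).symmL ℝ y (v k))) x := by
  rw [smoothSectionAt_iff_linearMapAt _ _ hx.2, ← dualSmoothAt_iff_contMDiffAt]
  refine ((isSmoothField_iff_localRep.mp h x₀ v x hx).linear_comp
    ExteriorAlgebra.ιInv).congr_of_eventuallyEq (Filter.Eventually.of_forall fun y => ?_)
  exact (LinearMap.congr_fun (ExteriorAlgebra.ιInv_comp_map _) _).symm

end LocalRepresentative

section FieldAlgebra

variable {m : ℕ} {M : Type*} [TopologicalSpace M] [ChartedSpace (BaseModel m) M]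
  {V : M → Type*} [∀ x, AddCommGroup (V x)] [∀ x, Module ℝ (V x)]

theorem wedge_apply (i j k : ℕ) (α : FormField m V i) (β : FormField m V k) (x : M) :
    wedge i j k α β x = (-1 : ℝ) ^ (j * k) •
      altProd i k (LinearMap.mul ℝ (ExteriorAlgebra ℝ (V x))) (α x) (β x) := rfl

theorem bracket_apply (η : ∀ x : M, V x →ₗ[ℝ] V x →ₗ[ℝ] ℝ)
    (φ : ∀ x : M, TangentSpace (𝓡 (m + 3)) x →ₗ[ℝ] V x) (i : ℕ) (A : FormField m V i) (x : M) :
    bracket η φ i A x = altProd i 1 (contractRight :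
        ExteriorAlgebra ℝ (V x) →ₗ[ℝ] Module.Dual ℝ (V x) →ₗ[ℝ] ExteriorAlgebra ℝ (V x))
      (A x) (oneForm (η x ∘ₗ φ x)) := rfl

theorem wedge_mem {i j k l : ℕ} {α : FormField m V i} {β : FormField m V k} {x : M}
    (hα : ∀ t, α x t ∈ ⋀[ℝ]^j (V x)) (hβ : ∀ t, β x t ∈ ⋀[ℝ]^l (V x)) (t) :
    wedge i j k α β x t ∈ ⋀[ℝ]^(j + l) (V x) := by
  rw [wedge_apply, AlternatingMap.smul_apply]
  exact Submodule.smul_mem _ _ (altProd_apply_mem _ _ _ _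
    (fun s t => SetLike.mul_mem_graded (A := fun i : ℕ => ⋀[ℝ]^i (V x)) (hα s) (hβ t)) t)

theorem symb_wedge {κ : Type*} [Fintype κ] {i j k : ℕ} {α : FormField m V i}
    (β : FormField m V k) {x : M} (b : Module.Basis κ ℝ (TangentSpace (𝓡 (m + 3)) x))
    (hα : ∀ t, α x t ∈ ⋀[ℝ]^j (V x)) :
    symb b (wedge i j k α β x) = symb b (α x) * symb b (β x) := by
  rw [wedge_apply, symb_altProd_mul b hα]

variable (e : ∀ x : M, TangentSpace (𝓡 (m + 3)) x →ₗ[ℝ] V x)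

theorem vecForm_mem (x : M) (t) : vecForm e x t ∈ ⋀[ℝ]^1 (V x) :=
  ι_mem_exteriorPower_one _

theorem wedgePow_mem {i j : ℕ} (k : ℕ) {A : FormField m V i} {x : M}
    (hA : ∀ t, A x t ∈ ⋀[ℝ]^j (V x)) (t) :
    wedgePow e i j k A x t ∈ ⋀[ℝ]^(j + k) (V x) := by
  induction k with
  | zero => exact hA t
  | succ k ih => exact wedge_mem (i := i + k) (j := j + k) (k := 1) (l := 1) ih (vecForm_mem e x) t

theorem symb_wedgePow {κ : Type*} [Fintype κ] {i j : ℕ} (k : ℕ) {A : FormField m V i} {x : M}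
    (b : Module.Basis κ ℝ (TangentSpace (𝓡 (m + 3)) x)) (hA : ∀ t, A x t ∈ ⋀[ℝ]^j (V x)) :
    symb b (wedgePow e i j k A x) = symb b (A x) * coframeSymb b (e x) ^ k := by
  induction k with
  | zero => rw [pow_zero, mul_one]; rfl
  | succ k ih =>
    rw [pow_succ, ← mul_assoc, ← ih, ← symb_oneForm_ι]
    exact symb_wedge (i := i + k) (j := j + k) (k := 1) (vecForm e) b (wedgePow_mem e k hA)

end FieldAlgebra

namespace BoundaryCoframe

variable {m : ℕ} {M : Type*} [TopologicalSpace M] [ChartedSpace (BaseModel m) M]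
  [IsManifold (𝓡 (m + 3)) ∞ M]
  {V : M → Type*} [∀ x, AddCommGroup (V x)] [∀ x, Module ℝ (V x)] [∀ x, TopologicalSpace (V x)]
  [TopologicalSpace (TotalSpace (FibreModel m) V)] [FiberBundle (FibreModel m) V]
  [VectorBundle ℝ (FibreModel m) V] {κ : Type*} [Fintype κ] (C : BoundaryCoframe m V)

theorem ηlin_apply (x : M) (u w : V x) : C.ηlin x u w = C.η x u w := rfl

theorem mem_kerW_of_symb {i j k : ℕ} {A : FormField m V i} (hA : A ∈ Omega m V i j)
    (b : ∀ x : M, Module.Basis κ ℝ (TangentSpace (𝓡 (m + 3)) x))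
    (h : ∀ x, symb (b x) (A x) * coframeSymb (b x) (C.e x) ^ k = 0) : A ∈ C.kerW i j k := by
  refine ⟨hA, LinearMap.mem_ker.mpr (funext fun x => symb_injective (b x) ?_)⟩
  rw [symb_wedgePow C.e k (b x) (hA.1 x), h, Pi.zero_apply, map_zero]

theorem symb_mul_coframeSymb_pow_of_mem_kerW {i j k : ℕ} {A : FormField m V i}
    (hA : A ∈ C.kerW i j k) {x : M} (b : Module.Basis κ ℝ (TangentSpace (𝓡 (m + 3)) x)) :
    symb b (A x) * coframeSymb b (C.e x) ^ k = 0 := by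
  rw [← symb_wedgePow C.e k b (hA.1.1 x), LinearMap.mem_ker.mp hA.2, Pi.zero_apply, map_zero]

end BoundaryCoframe

section SmoothMatrix

variable {E₀ : Type*} [NormedAddCommGroup E₀] [NormedSpace ℝ E₀] {H₀ : Type*} [TopologicalSpace H₀]
  {I : ModelWithCorners ℝ E₀ H₀} {M : Type*} [TopologicalSpace M] [ChartedSpace H₀ M]
  {κ : Type*} [Fintype κ] [DecidableEq κ] {A : M → Matrix κ κ ℝ} {x : M}

theorem contMDiffAt_det (h : ∀ i j, ContMDiffAt I 𝓘(ℝ, ℝ) ∞ (fun y => A y i j) x) :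
    ContMDiffAt I 𝓘(ℝ, ℝ) ∞ (fun y => (A y).det) x := by
  simp only [Matrix.det_apply, Units.smul_def, ← Int.cast_smul_eq_zsmul ℝ, smul_eq_mul]
  exact contMDiffAt_finsetSum fun σ _ =>
    contMDiffAt_const.mul (contMDiffAt_finsetProd fun k _ => h (σ k) k)

theorem contMDiffAt_adjugate (h : ∀ i j, ContMDiffAt I 𝓘(ℝ, ℝ) ∞ (fun y => A y i j) x) (i j : κ) :
    ContMDiffAt I 𝓘(ℝ, ℝ) ∞ (fun y => (A y).adjugate i j) x := by
  simp only [Matrix.adjugate_apply]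
  refine contMDiffAt_det fun k l => ?_
  obtain rfl | hk := eq_or_ne k j
  · simpa only [Matrix.updateRow_self] using contMDiffAt_const
  · simpa only [Matrix.updateRow_ne hk] using h k l

theorem contMDiffAt_matrix_inv (h : ∀ i j, ContMDiffAt I 𝓘(ℝ, ℝ) ∞ (fun y => A y i j) x)
    (hdet : (A x).det ≠ 0) (i j : κ) :
    ContMDiffAt I 𝓘(ℝ, ℝ) ∞ (fun y => (A y)⁻¹ i j) x := by
  simp only [Matrix.inv_def, Ring.inverse_eq_inv', Matrix.smul_apply, smul_eq_mul]
  exact ((contMDiffAt_det h).inv₀ hdet).mul (contMDiffAt_adjugate h i j)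

end SmoothMatrix

section Bilinear

variable {E₀ : Type*} [NormedAddCommGroup E₀] [NormedSpace ℝ E₀] {H₀ : Type*} [TopologicalSpace H₀]
  {I : ModelWithCorners ℝ E₀ H₀} {M : Type*} [TopologicalSpace M] [ChartedSpace H₀ M]
  {F : Type*} [NormedAddCommGroup F] [NormedSpace ℝ F]
  {V : M → Type*} [∀ x, AddCommGroup (V x)] [∀ x, Module ℝ (V x)] [∀ x, TopologicalSpace (V x)]
  [TopologicalSpace (TotalSpace F V)] [FiberBundle F V] [VectorBundle ℝ F V]

theorem contMDiffAt_bilinear {B : ∀ x : M, V x →L[ℝ] V x →L[ℝ] ℝ} {x : M}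
    (hB : ContMDiffAt I (I.prod 𝓘(ℝ, F →L[ℝ] F →L[ℝ] ℝ)) ∞
      (fun x => TotalSpace.mk' (F →L[ℝ] F →L[ℝ] ℝ) x (B x)) x) {s t : ∀ x, V x}
    (hs : SmoothSectionAt I F s x) (ht : SmoothSectionAt I F t x) :
    ContMDiffAt I 𝓘(ℝ, ℝ) ∞ (fun y => B y (s y) (t y)) x := by
  have section_smooth : ContMDiffAt I (I.prod 𝓘(ℝ)) ∞
      (fun y => TotalSpace.mk' ℝ (E := Bundle.Trivial M ℝ) y (B y (s y) (t y))) x :=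
    ContMDiffAt.clm_bundle_apply₂ (F₁ := F) (F₂ := F) hB hs ht
  exact (contMDiffAt_totalSpace.mp section_smooth).2

end Bilinear

section TangentFrame

variable {m : ℕ} {M : Type*} [TopologicalSpace M] [ChartedSpace (BaseModel m) M]
  [IsManifold (𝓡 (m + 3)) ∞ M]

/-- The local frame of the tangent bundle that corresponds to the standard basis under the preferred
trivialization at `x₀`; it is a frame over the domain of this trivialization only. -/
def tangentFrame (x₀ x : M) (c : Fin (m + 3)) : TangentSpace (𝓡 (m + 3)) x :=
  (tangentTriv m x₀).symmL ℝ x (EuclideanSpace.single c (1 : ℝ))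

open scoped Classical in
/-- The basis of `T_x M` formed by the local frame `tangentFrame x₀`, if `x` lies in the domain of
this frame; outside the domain, where no frame is distinguished, the standard basis of the model
space. -/
def tangentBasis (x₀ x : M) : Module.Basis (Fin (m + 3)) ℝ (TangentSpace (𝓡 (m + 3)) x) :=
  if hx : x ∈ (tangentTriv m x₀).baseSet then
    (EuclideanSpace.basisFun (Fin (m + 3)) ℝ).toBasis.map
      ((tangentTriv m x₀).linearEquivAt ℝ x hx).symm
  else (EuclideanSpace.basisFun (Fin (m + 3)) ℝ).toBasis

variable {x₀ x : M} (hx : x ∈ (tangentTriv m x₀).baseSet)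

include hx

theorem symmL_eq_linearEquivAt_symm (v : BaseModel m) :
    (tangentTriv m x₀).symmL ℝ x v = ((tangentTriv m x₀).linearEquivAt ℝ x hx).symm v := by
  rw [LinearEquiv.eq_symm_apply]
  have linearMapAt_symmL := Trivialization.linearMapAt_symmₗ (R := ℝ) _ hx v
  rwa [Trivialization.linearMapAt_def_of_mem _ hx] at linearMapAt_symmL

theorem tangentBasis_eq_map : tangentBasis x₀ x =
    (EuclideanSpace.basisFun (Fin (m + 3)) ℝ).toBasis.map
      ((tangentTriv m x₀).linearEquivAt ℝ x hx).symm := dif_pos hx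

theorem coe_tangentBasis : ⇑(tangentBasis (m := m) x₀ x) = tangentFrame x₀ x := by
  funext c
  rw [tangentBasis_eq_map hx, Module.Basis.map_apply, OrthonormalBasis.coe_toBasis,
    EuclideanSpace.basisFun_apply, ← symmL_eq_linearEquivAt_symm, tangentFrame]

theorem detContr_tangentBasis (c d : Fin (m + 3)) (v : Fin (m + 1) → BaseModel m) :
    detContr (p := m + 1) (tangentBasis x₀ x) c d (fun k => (tangentTriv m x₀).symmL ℝ x (v k)) =
      detContr (p := m + 1) (EuclideanSpace.basisFun (Fin (m + 3)) ℝ).toBasis c d v := by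
  simp only [symmL_eq_linearEquivAt_symm hx]
  rw [tangentBasis_eq_map hx]
  exact detContr_map (p := m + 1) _ _ c d v

theorem smoothSectionAt_tangentFrame (c : Fin (m + 3)) : SmoothSectionAt (𝓡 (m + 3)) (BaseModel m)
    (fun y => tangentFrame x₀ y c) x :=
  smoothSectionAt_symmL _ hx _

end TangentFrame

section AdaptedFrames

variable {m : ℕ} {M : Type*} [TopologicalSpace M] [ChartedSpace (BaseModel m) M]
  [IsManifold (𝓡 (m + 3)) ∞ M]
  {V : M → Type*} [∀ x, AddCommGroup (V x)] [∀ x, Module ℝ (V x)] [∀ x, TopologicalSpace (V x)]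
  [TopologicalSpace (TotalSpace (FibreModel m) V)] [FiberBundle (FibreModel m) V]
  [VectorBundle ℝ (FibreModel m) V]

theorem BoundaryCoframe.finrank_fibre (C : BoundaryCoframe m V) (x : M) :
    Module.finrank ℝ (V x) = m + 4 := by
  obtain ⟨b, -⟩ := C.η_lorentz x
  rw [Module.finrank_eq_card_basis b, Fintype.card_fin]

section

variable [ContMDiffVectorBundle ∞ (FibreModel m) V (𝓡 (m + 3))] {x₀ x : M}

theorem BoundaryCoframe.smoothSectionAt_e (C : BoundaryCoframe m V) (hx : x ∈ trivDomain m V x₀)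
    (v : BaseModel m) : SmoothSectionAt (𝓡 (m + 3)) (FibreModel m)
      (fun y => C.e y ((tangentTriv m x₀).symmL ℝ y v)) x := by
  have ιInv_vecForm : ∀ y t, ExteriorAlgebra.ιInv (vecForm C.e y t) = C.e y (t 0) := fun y t =>
    ExteriorAlgebra.ι_leftInverse _
  simpa only [ιInv_vecForm] using C.e_smooth.2.smoothSectionAt hx (fun _ => v)

theorem IsSmoothField.smoothSectionAt_twoFormBilin {α : FormField m V 2} (hα : IsSmoothField α)
    (hx : x ∈ trivDomain m V x₀) (c d : Fin (m + 3)) : SmoothSectionAt (𝓡 (m + 3)) (FibreModel m)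
      (fun y => twoFormBilin (α y) (tangentFrame x₀ y c) (tangentFrame x₀ y d)) x := by
  have h := hα.smoothSectionAt hx
    ![EuclideanSpace.single c (1 : ℝ), EuclideanSpace.single d (1 : ℝ)]
  have symmL_comp : ∀ y, (fun k => (tangentTriv m x₀).symmL ℝ y
      ((![EuclideanSpace.single c (1 : ℝ), EuclideanSpace.single d (1 : ℝ)] :
        Fin 2 → BaseModel m) k)) = ![tangentFrame x₀ y c, tangentFrame x₀ y d] := fun y => by
    funext k
    fin_cases k <;> rfl
  simp only [symmL_comp] at h
  exact h

end

namespace AdaptedMetric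

variable {C : BoundaryCoframe m V} {P : NullSplitting C} (Q : AdaptedMetric P)

/-- The image of a frame of the tangent space under the coframe, completed by the transversal
section. -/
def adaptedFrame {x : M} (b : Fin (m + 3) → TangentSpace (𝓡 (m + 3)) x) : Fin (m + 4) → V x :=
  Fin.snoc (fun k => C.e x (b k)) (Q.en x)

variable {x : M} (b : Module.Basis (Fin (m + 3)) ℝ (TangentSpace (𝓡 (m + 3)) x))

theorem linearIndependent_adaptedFrame : LinearIndependent ℝ (Q.adaptedFrame b) := by
  refine LinearIndependent.finSnoc (b.linearIndependent.map' (C.e x)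
    (LinearMap.ker_eq_bot.mpr (C.e_injective x))) fun h => Q.en_transversal x ?_
  refine Submodule.span_le.mpr ?_ h
  rintro _ ⟨k, rfl⟩
  exact ⟨b k, rfl⟩

/-- The basis of the fibre formed by the adapted frame of a basis of the tangent space. -/
def adaptedBasis : Module.Basis (Fin (m + 4)) ℝ (V x) :=
  basisOfLinearIndependentOfCardEqFinrank (Q.linearIndependent_adaptedFrame b)
    (by rw [C.finrank_fibre, Fintype.card_fin])

theorem coe_adaptedBasis : ⇑(Q.adaptedBasis b) = Q.adaptedFrame b :=
  coe_basisOfLinearIndependentOfCardEqFinrank _ _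

theorem adaptedBasis_castSucc (c : Fin (m + 3)) :
    Q.adaptedBasis b (Fin.castSucc c) = C.e x (b c) := by
  rw [coe_adaptedBasis, adaptedFrame, Fin.snoc_castSucc]

theorem adaptedBasis_last : Q.adaptedBasis b (Fin.last (m + 3)) = Q.en x := by
  rw [coe_adaptedBasis, adaptedFrame, Fin.snoc_last]

theorem smoothSectionAt_adaptedFrame [ContMDiffVectorBundle ∞ (FibreModel m) V (𝓡 (m + 3))]
    {x₀ x : M} (hx : x ∈ trivDomain m V x₀) (A : Fin (m + 4)) :
    SmoothSectionAt (𝓡 (m + 3)) (FibreModel m)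
      (fun y => Q.adaptedFrame (tangentFrame x₀ y) A) x := by
  refine Fin.lastCases ?_ (fun c => ?_) A
  · simpa only [adaptedFrame, Fin.snoc_last] using Q.en_smooth x
  · simp only [adaptedFrame, Fin.snoc_castSucc]
    exact C.smoothSectionAt_e hx _

end AdaptedMetric

end AdaptedFrames

section LocalExtension

variable {m : ℕ} {M : Type*} [TopologicalSpace M] [ChartedSpace (BaseModel m) M]
  [IsManifold (𝓡 (m + 3)) ∞ M]
  {V : M → Type*} [∀ x, TopologicalSpace (V x)]
  [TopologicalSpace (TotalSpace (FibreModel m) V)] [FiberBundle (FibreModel m) V]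

theorem exists_smooth_bump_trivDomain [T2Space M] (x₀ : M) : ∃ χ : M → ℝ,
    ContMDiff (𝓡 (m + 3)) 𝓘(ℝ, ℝ) ∞ χ ∧ HasCompactSupport χ ∧
    tsupport χ ⊆ trivDomain m V x₀ ∧ χ x₀ = 1 ∧ ∀ x, 0 ≤ χ x := by
  obtain ⟨χ, -, hχ⟩ := (SmoothBumpFunction.nhds_basis_tsupport (I := 𝓡 (m + 3)) x₀).mem_iff.mp
    ((isOpen_trivDomain (m := m) (V := V) x₀).mem_nhds (mem_trivDomain x₀))
  exact ⟨χ, χ.contMDiff, χ.hasCompactSupport, hχ, χ.eq_one, fun _ => χ.nonneg⟩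

variable [∀ x, AddCommGroup (V x)] [∀ x, Module ℝ (V x)] [VectorBundle ℝ (FibreModel m) V]
  [ContMDiffVectorBundle ∞ (FibreModel m) V (𝓡 (m + 3))]

theorem isSmoothField_smul_of_tsupport_subset {i : ℕ} {φ : FormField m V i} {x₀ : M} {χ : M → ℝ}
    (hχ : ContMDiff (𝓡 (m + 3)) 𝓘(ℝ, ℝ) ∞ χ) (hχU : tsupport χ ⊆ trivDomain m V x₀)
    (h : ∀ v, ∀ x ∈ trivDomain m V x₀,
      DualSmoothAt (𝓡 (m + 3)) (fun y => localRep x₀ φ y v) x) :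
    IsSmoothField (fun y => χ y • φ y) := by
  refine isSmoothField_of_support (isClosed_tsupport χ) hχU (fun y hy => ?_) fun v y hy => ?_
  · rw [image_eq_zero_of_notMem_tsupport hy, zero_smul]
  · refine ((h v y hy).smul (hχ y)).congr_of_eventuallyEq (Filter.Eventually.of_forall fun z => ?_)
    simp only [localRep_apply, AlternatingMap.smul_apply, map_smul]

end LocalExtension

section KernelFields

theorem DualSmoothAt.traceFree {E₀ : Type*} [NormedAddCommGroup E₀] [NormedSpace ℝ E₀]
    {H₀ : Type*} [TopologicalSpace H₀] {I : ModelWithCorners ℝ E₀ H₀} {M : Type*}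
    [TopologicalSpace M] [ChartedSpace H₀ M] {W : Type*} [AddCommGroup W] [Module ℝ W]
    [Module.Finite ℝ W]
    {T : M → Type*} [∀ y, AddCommGroup (T y)] [∀ y, Module ℝ (T y)] {x : M} (n : ℕ)
    {e : ∀ y, T y →ₗ[ℝ] W} {φ : ∀ y, Module.Dual ℝ (T y)} {s t u : ∀ y, T y}
    (hs : DualSmoothAt I (fun y => e y (s y)) x) (ht : DualSmoothAt I (fun y => e y (t y)) x)
    (hu : DualSmoothAt I (fun y => e y (u y)) x)
    (hφs : ContMDiffAt I 𝓘(ℝ, ℝ) ∞ (fun y => φ y (s y)) x)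
    (hφt : ContMDiffAt I 𝓘(ℝ, ℝ) ∞ (fun y => φ y (t y)) x)
    (hφu : ContMDiffAt I 𝓘(ℝ, ℝ) ∞ (fun y => φ y (u y)) x) :
    DualSmoothAt I (fun y => PalatiniCartan.traceFree n (e y) (φ y) (s y) (t y) (u y)) x := by
  have hs' := hs.linear_comp (ι ℝ)
  have ht' := ht.linear_comp (ι ℝ)
  have hu' := hu.linear_comp (ι ℝ)
  simp only [traceFree_apply]
  exact ((hs'.mul ht').smul hφu).sub
    ((((hu'.mul ht').smul hφs).sub ((hu'.mul hs').smul hφt)).smul contMDiffAt_const)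

variable {m : ℕ} {M : Type*} [TopologicalSpace M] [ChartedSpace (BaseModel m) M]
  [IsManifold (𝓡 (m + 3)) ∞ M]
  {V : M → Type*} [∀ x, AddCommGroup (V x)] [∀ x, Module ℝ (V x)] [∀ x, TopologicalSpace (V x)]
  [TopologicalSpace (TotalSpace (FibreModel m) V)] [FiberBundle (FibreModel m) V]
  [VectorBundle ℝ (FibreModel m) V] [ContMDiffVectorBundle ∞ (FibreModel m) V (𝓡 (m + 3))]

namespace BoundaryCoframe

variable (C : BoundaryCoframe m V)

/-- The trace-free field `traceFree (m + 3) e φ s t` whose arguments `φ`, `s`, `t` have constant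
coefficients in the preferred trivialization of the tangent bundle at `x₀`. -/
def traceFreeField (x₀ : M) (φ : Module.Dual ℝ (BaseModel m)) (s t : BaseModel m) :
    FormField m V 1 := fun y =>
  oneForm (traceFree (m + 3) (C.e y) (φ ∘ₗ (tangentTriv m x₀).linearMapAt ℝ y)
    ((tangentTriv m x₀).symmL ℝ y s) ((tangentTriv m x₀).symmL ℝ y t))

theorem dualSmoothAt_localRep_traceFreeField (x₀ : M) (φ : Module.Dual ℝ (BaseModel m))
    (s t : BaseModel m) (v : Fin 1 → BaseModel m) {x : M} (hx : x ∈ trivDomain m V x₀) :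
    DualSmoothAt (𝓡 (m + 3)) (fun y => localRep x₀ (C.traceFreeField x₀ φ s t) y v) x := by
  have coframe_smooth : ∀ u, DualSmoothAt (𝓡 (m + 3)) (fun y =>
      ((fibreTriv m V x₀).linearMapAt ℝ y ∘ₗ C.e y) ((tangentTriv m x₀).symmL ℝ y u)) x := fun u =>
    dualSmoothAt_iff_contMDiffAt.mpr
      ((smoothSectionAt_iff_linearMapAt _ _ hx.2).mp (C.smoothSectionAt_e hx u))
  have dual_smooth : ∀ u, ContMDiffAt (𝓡 (m + 3)) 𝓘(ℝ, ℝ) ∞ (fun y =>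
      (φ ∘ₗ (tangentTriv m x₀).linearMapAt ℝ y) ((tangentTriv m x₀).symmL ℝ y u)) x := fun u =>
    dualSmoothAt_iff_contMDiffAt.mpr ((smoothSectionAt_iff_linearMapAt _ _ hx.1).mp
      (smoothSectionAt_symmL _ hx.1 u)) φ
  have map_traceFree : ∀ y, localRep x₀ (C.traceFreeField x₀ φ s t) y v =
      traceFree (m + 3) ((fibreTriv m V x₀).linearMapAt ℝ y ∘ₗ C.e y)
        (φ ∘ₗ (tangentTriv m x₀).linearMapAt ℝ y) ((tangentTriv m x₀).symmL ℝ y s)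
        ((tangentTriv m x₀).symmL ℝ y t) ((tangentTriv m x₀).symmL ℝ y (v 0)) := fun y => by
    change ExteriorAlgebra.map _ (traceFree (m + 3) (C.e y) _ _ _ _) = _
    simp only [traceFree_apply, map_smul, map_sub, map_mul, ExteriorAlgebra.map_apply_ι,
      LinearMap.comp_apply]
    rfl
  simp only [map_traceFree]
  exact .traceFree _ (coframe_smooth s) (coframe_smooth t) (coframe_smooth _) (dual_smooth s)
    (dual_smooth t) (dual_smooth _)

theorem exists_mem_kerW_eq_traceFree [T2Space M] (x : M)
    (φ : Module.Dual ℝ (TangentSpace (𝓡 (m + 3)) x)) (s t : TangentSpace (𝓡 (m + 3)) x) :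
    ∃ v ∈ C.kerW 1 2 (m + 1), v x = oneForm (traceFree (m + 3) (C.e x) φ s t) := by
  obtain ⟨χ, χ_smooth, -, χ_support, χ_self, -⟩ := exists_smooth_bump_trivDomain (m := m) (V := V) x
  have symmL_linearMapAt : ∀ u,
      (tangentTriv m x).symmL ℝ x ((tangentTriv m x).linearMapAt ℝ x u) = u := fun u =>
    Trivialization.symmₗ_linearMapAt (R := ℝ) _ (mem_trivDomain (m := m) (V := V) x).1 u
  let w := C.traceFreeField x (φ ∘ₗ ((tangentTriv m x).symmL ℝ x).toLinearMap)
    ((tangentTriv m x).linearMapAt ℝ x s) ((tangentTriv m x).linearMapAt ℝ x t)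
  have w_self : w x = oneForm (traceFree (m + 3) (C.e x) φ s t) := by
    simp only [w, traceFreeField, symmL_linearMapAt]
    congr 2
    exact LinearMap.ext fun u => congrArg φ (symmL_linearMapAt u)
  refine ⟨fun y => χ y • w y, C.mem_kerW_of_symb ⟨fun y r => ?_, ?_⟩ (tangentBasis x) fun y => ?_,
    by simp only [χ_self, one_smul, w_self]⟩
  · exact Submodule.smul_mem _ _ (traceFree_mem (C.e y) (m + 3) _ _ _ (r 0))
  · exact isSmoothField_smul_of_tsupport_subset χ_smooth χ_support fun v y hy =>
      C.dualSmoothAt_localRep_traceFreeField x _ _ _ v hy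
  · rw [map_smul, smul_mul_assoc]
    exact smul_eq_zero_of_right _ (symb_traceFree_mul (p := m + 1) (tangentBasis x y) (C.e y)
      (Fintype.card_fin _).le _ _ _)

end BoundaryCoframe

end KernelFields

section LightlikeSplitting

variable {m : ℕ} {M : Type*} [TopologicalSpace M] [ChartedSpace (BaseModel m) M]
  [IsManifold (𝓡 (m + 3)) ∞ M]
  {V : M → Type*} [∀ x, AddCommGroup (V x)] [∀ x, Module ℝ (V x)] [∀ x, TopologicalSpace (V x)]
  [TopologicalSpace (TotalSpace (FibreModel m) V)] [FiberBundle (FibreModel m) V]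
  [VectorBundle ℝ (FibreModel m) V]

namespace NullSplitting

variable {C : BoundaryCoframe m V} (P : NullSplitting C) (x : M)

theorem eq_zero_of_smul_X_mem_H {c : ℝ} (h : c • P.X x ∈ P.H x) : c = 0 := by
  have smul_eq_zero_X := Submodule.disjoint_def.mp (P.H_isCompl x).disjoint _
    (Submodule.smul_mem _ c (Submodule.mem_span_singleton_self _)) h
  exact (smul_eq_zero.mp smul_eq_zero_X).resolve_right (P.X_ne_zero x)

theorem exists_eq_smul_X_add (u : TangentSpace (𝓡 (m + 3)) x) :
    ∃ c : ℝ, ∃ w ∈ P.H x, u = c • P.X x + w := by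
  obtain ⟨y, hy, w, hw, rfl⟩ := Submodule.mem_sup.mp
    ((P.H_isCompl x).sup_eq_top ▸ Submodule.mem_top : u ∈ _)
  obtain ⟨c, rfl⟩ := Submodule.mem_span_singleton.mp hy
  exact ⟨c, w, hw, rfl⟩

theorem exists_adapted_basis : ∃ b : Module.Basis (Fin (m + 3)) ℝ (TangentSpace (𝓡 (m + 3)) x),
    b 0 = P.X x ∧ ∀ k, k ≠ 0 → b k ∈ P.H x := by
  have : FiniteDimensional ℝ (TangentSpace (𝓡 (m + 3)) x) :=
    (tangentBasis x x).finiteDimensional_of_finite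
  have finrank_add := Submodule.finrank_add_eq_of_isCompl (P.H_isCompl x)
  rw [finrank_span_singleton (P.X_ne_zero x), Module.finrank_eq_card_basis (tangentBasis x x),
    Fintype.card_fin] at finrank_add
  let bH := Module.finBasisOfFinrankEq ℝ (P.H x) (n := m + 2) (by omega)
  refine ⟨Module.Basis.mkFinCons (P.X x) bH (fun c u hu h => ?_) fun z => ?_, ?_, fun k hk => ?_⟩
  · exact P.eq_zero_of_smul_X_mem_H x (eq_neg_of_add_eq_zero_left h ▸ neg_mem hu)
  · obtain ⟨c, w, hw, rfl⟩ := P.exists_eq_smul_X_add x z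
    exact ⟨-c, by rwa [show c • P.X x + w + -c • P.X x = w by module]⟩
  · rw [Module.Basis.coe_mkFinCons, Fin.cons_zero]
  · obtain ⟨j, rfl⟩ := Fin.exists_succ_eq.mpr hk
    rw [Module.Basis.coe_mkFinCons, Fin.cons_succ]
    exact (bH j).2

theorem eta_eTilde_e (u w : TangentSpace (𝓡 (m + 3)) x) :
    C.η x (P.eTilde x u) (C.e x w) = C.η x (C.e x u) (C.e x w) := by
  have null : C.η x (C.e x (P.X x)) (C.e x w) = 0 := P.X_null x w
  simp only [eTilde, LinearMap.sub_apply, LinearMap.smulRight_apply, map_sub, map_smul,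
    sub_apply, smul_apply, null, smul_zero, sub_zero]

end NullSplitting

variable [ContMDiffVectorBundle ∞ (FibreModel m) V (𝓡 (m + 3))] [T2Space M]

namespace AdaptedMetric

variable {C : BoundaryCoframe m V} {P : NullSplitting C} (Q : AdaptedMetric P) (x : M)

include Q

theorem beta_basis_eq_zero {b : Module.Basis (Fin (m + 3)) ℝ (TangentSpace (𝓡 (m + 3)) x)}
    (hb₀ : b 0 = P.X x) (hb : ∀ k, k ≠ 0 → b k ∈ P.H x) {j : Fin (m + 3)} (hj : j ≠ 0) :
    P.β x (b j) = 0 := by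
  refine eq_zero_of_normalized (b := b) (e := C.e x) (Q.adaptedBasis_castSucc b) (c₀ := 0)
    (fun φ s t => ?_) hj
  obtain ⟨v, hv, hvx⟩ := C.exists_mem_kerW_eq_traceFree x φ s t
  have normalized := covec_mul_symb_eq_zero_of_vanish b _
    fun c hc => P.β_normalized v hv x (b ∘ c) fun k => hb _ (hc k)
  rwa [symb_wedge _ b (wedgePow_mem _ m (vecForm_mem _ x)), symb_wedgePow _ m b (vecForm_mem _ x),
    hvx, vecForm, symb_oneForm_ι, ← hb₀] at normalized

theorem beta_eq_zero {u : TangentSpace (𝓡 (m + 3)) x} (hu : u ∈ P.H x) : P.β x u = 0 := by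
  obtain ⟨b, hb₀, hb⟩ := P.exists_adapted_basis x
  have sum_mem_H : ∑ k : Fin (m + 2), b.repr u k.succ • b k.succ ∈ P.H x :=
    sum_mem fun k _ => Submodule.smul_mem _ _ (hb _ (Fin.succ_ne_zero k))
  have u_eq := b.sum_repr u
  rw [Fin.sum_univ_succ, hb₀] at u_eq
  have coord_eq_zero : b.repr u 0 = 0 :=
    P.eq_zero_of_smul_X_mem_H x (by rw [eq_sub_of_add_eq u_eq]; exact sub_mem hu sum_mem_H)
  rw [coord_eq_zero, zero_smul, zero_add] at u_eq
  rw [← u_eq, map_sum]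
  exact Finset.sum_eq_zero fun k _ => by
    rw [map_smul, Q.beta_basis_eq_zero x hb₀ hb (Fin.succ_ne_zero k), smul_zero]

theorem eta_eTilde_en (u : TangentSpace (𝓡 (m + 3)) x) :
    C.η x (P.eTilde x u) (Q.en x) = 0 := by
  obtain ⟨c, w, hw, rfl⟩ := P.exists_eq_smul_X_add x u
  have eTilde_eq : P.eTilde x (c • P.X x + w) = C.e x w := by
    simp only [NullSplitting.eTilde, LinearMap.sub_apply, LinearMap.smulRight_apply, map_add,
      map_smul, P.β_X, Q.beta_eq_zero x hw, one_smul, zero_smul, sub_self, smul_zero, sub_zero,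
      zero_add]
  rw [eTilde_eq, C.η_symm, Q.en_orthogonal x w hw]

end AdaptedMetric

end LightlikeSplitting

section Metrics

variable {m : ℕ} {M : Type*} [TopologicalSpace M] [ChartedSpace (BaseModel m) M]
  [IsManifold (𝓡 (m + 3)) ∞ M]
  {V : M → Type*} [∀ x, AddCommGroup (V x)] [∀ x, Module ℝ (V x)] [∀ x, TopologicalSpace (V x)]
  [TopologicalSpace (TotalSpace (FibreModel m) V)] [FiberBundle (FibreModel m) V]
  [VectorBundle ℝ (FibreModel m) V]

namespace AdaptedMetric

variable {C : BoundaryCoframe m V} {P : NullSplitting C} (Q : AdaptedMetric P) (x : M)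

/-- The Riemannian metric of the base as a field of bilinear forms. -/
def baseLin : LinearMap.BilinForm ℝ (TangentSpace (𝓡 (m + 3)) x) :=
  ContinuousLinearMap.coeLM ℝ ∘ₗ (Q.base.inner x).toLinearMap

/-- The metric of the fibres as a field of bilinear forms. -/
def fibreLin : LinearMap.BilinForm ℝ (V x) :=
  ContinuousLinearMap.coeLM ℝ ∘ₗ (Q.fibre.inner x).toLinearMap

theorem baseLin_isSymm : (Q.baseLin x).IsSymm := ⟨Q.base.symm x⟩

theorem fibreLin_isSymm : (Q.fibreLin x).IsSymm := ⟨Q.fibre.symm x⟩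

theorem baseLin_nondegenerate : (Q.baseLin x).Nondegenerate :=
  (Q.baseLin_isSymm x).isRefl.nondegenerate_iff_separatingLeft.mpr fun u hu => by
    by_contra u_ne_zero
    exact (Q.base.pos x u u_ne_zero).ne' (hu u)

variable {x} in
theorem inner_eq (b : Module.Basis (Fin (m + 3)) ℝ (TangentSpace (𝓡 (m + 3)) x))
    (α α' : FormField m V 2) : Q.inner α α' x =
      twoFormInner b (fun u w => Q.baseLin x u w) (Q.fibreLin x) (α x) (α' x) :=
  twoFormInner_basis_change (Q.baseLin_nondegenerate x) b _ (Q.fibreLin x) (α x) (α' x)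

theorem inner_comm (α α' : FormField m V 2) : Q.inner α α' x = Q.inner α' α x := by
  rw [Q.inner_eq (tangentBasis x x), Q.inner_eq (tangentBasis x x)]
  exact twoFormInner_comm (Q.baseLin_nondegenerate x) _ _ _ _ (Q.baseLin_isSymm x)
    (Q.fibreLin_isSymm x)

end AdaptedMetric

end Metrics

section DualField

variable {m : ℕ} {M : Type*} [TopologicalSpace M] [ChartedSpace (BaseModel m) M]
  [IsManifold (𝓡 (m + 3)) ∞ M]
  {V : M → Type*} [∀ x, AddCommGroup (V x)] [∀ x, Module ℝ (V x)] [∀ x, TopologicalSpace (V x)]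
  [TopologicalSpace (TotalSpace (FibreModel m) V)] [FiberBundle (FibreModel m) V]
  [VectorBundle ℝ (FibreModel m) V]

namespace AdaptedMetric

variable {C : BoundaryCoframe m V} {P : NullSplitting C} (Q : AdaptedMetric P)

section Pointwise

variable {x : M} (b : Module.Basis (Fin (m + 3)) ℝ (TangentSpace (𝓡 (m + 3)) x))
  (θ : FormField m V 2)

/-- The tensor `dualTensor` of a two-form field at a point, formed with the metrics of the base and
of the fibres. -/
def dualCoeff : Fin (m + 3) → Fin (m + 3) → Module.Dual ℝ (V x) :=
  dualTensor (Q.baseLin_nondegenerate x) b (Q.fibreLin x) (θ x)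

theorem dualCoeff_antisymm (c d : Fin (m + 3)) : Q.dualCoeff b θ d c = -Q.dualCoeff b θ c d :=
  dualTensor_antisymm (Q.baseLin_nondegenerate x) b (Q.fibreLin x) (θ x) c d

theorem sum_dualCoeff_apply_twoFormBilin (α : FormField m V 2) :
    ∑ c, ∑ d, Q.dualCoeff b θ c d (twoFormBilin (α x) (b c) (b d)) = 2 * Q.inner α θ x := by
  rw [Q.inner_eq b]
  exact sum_dualTensor_apply_twoFormBilin (Q.baseLin_nondegenerate x) b (Q.fibreLin x) (θ x) (α x)

variable {θ} (hθ : θ ∈ Q.T)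

include hθ

theorem exists_bilin_of_mem_T :
    ∃ τ : TangentSpace (𝓡 (m + 3)) x →ₗ[ℝ] TangentSpace (𝓡 (m + 3)) x →ₗ[ℝ]
        TangentSpace (𝓡 (m + 3)) x,
      (∀ s t, twoFormBilin (θ x) s t = C.e x (τ s t)) ∧ ∀ t, ∑ c, b.coord c (τ (b c) t) = 0 :=
  exists_bilin_of_symb_mul_coframeSymb_pow_eq_zero (p := m + 1) (C.e_injective x)
    (Q.adaptedBasis_castSucc b) (hθ.1.1.1 x) (C.symb_mul_coframeSymb_pow_of_mem_kerW hθ.1 b)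

theorem dualCoeff_apply_en (c d : Fin (m + 3)) : Q.dualCoeff b θ c d (Q.en x) = 0 := by
  obtain ⟨τ, hτ, -⟩ := Q.exists_bilin_of_mem_T b hθ
  exact dualTensor_apply_eq_zero_of_orthogonal _ _ _ _ hτ
    (fun u => (Q.fibre.symm x _ _).trans (Q.fibre_en x u)) c d

theorem sum_dualCoeff_apply_e (c : Fin (m + 3)) :
    ∑ d, Q.dualCoeff b θ c d (C.e x (b d)) = 0 := by
  obtain ⟨τ, hτ, trace_eq_zero⟩ := Q.exists_bilin_of_mem_T b hθ
  exact sum_dualTensor_apply_eq_zero _ _ _ _ hτ (Q.baseLin_isSymm x) (Q.fibre_e x) trace_eq_zero c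

variable [ContMDiffVectorBundle ∞ (FibreModel m) V (𝓡 (m + 3))] [T2Space M]

theorem sum_dualCoeff_mul_eta_comm (c : Fin (m + 3)) (s t : TangentSpace (𝓡 (m + 3)) x) :
    ∑ d, Q.dualCoeff b θ c d (C.e x s) * C.ηlin x (C.e x (b d)) (C.e x t) =
      ∑ d, Q.dualCoeff b θ c d (C.e x t) * C.ηlin x (C.e x (b d)) (C.e x s) := by
  obtain ⟨v, hv, v_eq⟩ := C.exists_mem_kerW_eq_traceFree x (b.coord c) s t
  have orthogonal := hθ.2.2 _ (Submodule.mem_map_of_mem hv) x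
  have := Q.sum_dualCoeff_apply_twoFormBilin b θ (bracket C.ηlin C.e 1 v)
  rw [Q.inner_comm, orthogonal, mul_zero, bracket_apply, v_eq] at this
  have bracket_eq := sum_apply_bracket_traceFree (b := b) (e := C.e x) (η := C.ηlin x)
    (Q.dualCoeff_antisymm b θ) ⟨C.η_symm x⟩ (Q.sum_dualCoeff_apply_e b hθ) c s t
  linarith

theorem sum_dualCoeff_mul_eta_eTilde_comm (c : Fin (m + 3)) (v w : V x) :
    ∑ d, Q.dualCoeff b θ c d v * C.ηlin x (P.eTilde x (b d)) w =
      ∑ d, Q.dualCoeff b θ c d w * C.ηlin x (P.eTilde x (b d)) v :=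
  sum_mul_comm_of_adapted (η := C.ηlin x) (μ := C.ηlin x ∘ₗ P.eTilde x) (Q.adaptedBasis_castSucc b)
    (fun d => by rw [adaptedBasis_last]; exact Q.dualCoeff_apply_en b hθ c d)
    (fun u => by rw [adaptedBasis_last]; exact Q.eta_eTilde_en x u) (P.eta_eTilde_e x)
    (Q.sum_dualCoeff_mul_eta_comm b hθ c) v w

end Pointwise

/-- The form with values in `⋀^{N-1} V` that is dual to the two-form field `θ` with respect to the
volume elements of the frame `tangentBasis x₀` and of the adapted frame of the fibres. Only the
domain of the trivializations at `x₀`, where these frames are smooth, is of interest. -/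
def dualField (x₀ : M) (θ : FormField m V 2) : FormField m V (m + 1) := fun y =>
  dualForm (p := m + 1) (tangentBasis x₀ y) (Q.adaptedBasis (tangentBasis x₀ y))
    (Q.dualCoeff (tangentBasis x₀ y) θ)

theorem dualField_mem (x₀ : M) (θ : FormField m V 2) (y : M) (t) :
    Q.dualField x₀ θ y t ∈ ⋀[ℝ]^(m + 3) (V y) :=
  dualForm_mem _ _ t

theorem wedge_dualField (x₀ x : M) (θ : FormField m V 2) {α : FormField m V 2}
    (hα : ∀ t, α x t ∈ ⋀[ℝ]^1 (V x)) :
    wedge (m + 1) (m + 3) 2 (Q.dualField x₀ θ) α x = (2 * Q.inner α θ x) •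
      tensorForm (tangentBasis x₀ x).det
        (ιMulti ℝ (m + 4) (Q.adaptedBasis (tangentBasis x₀ x))) := by
  rw [wedge_apply, (Even.mul_left even_two (m + 3)).neg_one_pow, one_smul, dualField,
    dualForm_wedge_two (p := m + 1) _ _ hα, ← Q.sum_dualCoeff_apply_twoFormBilin]

section Smooth

variable {Q} {x₀ x : M} (hx : x ∈ trivDomain m V x₀)

theorem toMatrix_baseLin_det_ne_zero
    (b : Module.Basis (Fin (m + 3)) ℝ (TangentSpace (𝓡 (m + 3)) x)) :
    (LinearMap.BilinForm.toMatrix b (Q.baseLin x)).det ≠ 0 :=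
  (LinearMap.BilinForm.nondegenerate_iff_det_ne_zero b).mp (Q.baseLin_nondegenerate x)

include hx

theorem contMDiffAt_toMatrix_baseLin (c d : Fin (m + 3)) :
    ContMDiffAt (𝓡 (m + 3)) 𝓘(ℝ, ℝ) ∞
      (fun y => LinearMap.BilinForm.toMatrix (tangentBasis x₀ y) (Q.baseLin y) c d) x := by
  refine (contMDiffAt_bilinear (Q.base.contMDiff x) (smoothSectionAt_tangentFrame hx.1 c)
    (smoothSectionAt_tangentFrame hx.1 d)).congr_of_eventuallyEq ?_
  filter_upwards [(isOpen_trivDomain x₀).mem_nhds hx] with y hy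
  refine (LinearMap.BilinForm.toMatrix_apply _ _ _ _).trans ?_
  rw [coe_tangentBasis hy.1]
  rfl

variable [ContMDiffVectorBundle ∞ (FibreModel m) V (𝓡 (m + 3))]

theorem contMDiffAt_dualCoeff {θ : FormField m V 2} (hθ : IsSmoothField θ) (c d : Fin (m + 3))
    {s : ∀ y, V y} (hs : SmoothSectionAt (𝓡 (m + 3)) (FibreModel m) s x) :
    ContMDiffAt (𝓡 (m + 3)) 𝓘(ℝ, ℝ) ∞
      (fun y => Q.dualCoeff (tangentBasis x₀ y) θ c d (s y)) x := by
  let G : ∀ y, Matrix (Fin (m + 3)) (Fin (m + 3)) ℝ := fun y =>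
    LinearMap.BilinForm.toMatrix (tangentBasis x₀ y) (Q.baseLin y)
  have inverse_smooth : ∀ c k, ContMDiffAt (𝓡 (m + 3)) 𝓘(ℝ, ℝ) ∞ (fun y => (G y)⁻¹ c k) x :=
    contMDiffAt_matrix_inv (contMDiffAt_toMatrix_baseLin hx) (toMatrix_baseLin_det_ne_zero _)
  have expand : (fun y => Q.dualCoeff (tangentBasis x₀ y) θ c d (s y)) =ᶠ[𝓝 x] fun y =>
      ∑ l, (G y)⁻¹ d l * ∑ k, (G y)⁻¹ c k * Q.fibre.inner y (s y)
        (twoFormBilin (θ y) (tangentFrame x₀ y k) (tangentFrame x₀ y l)) := by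
    filter_upwards [(isOpen_trivDomain x₀).mem_nhds hx] with y hy
    simp only [dualCoeff, dualTensor_apply, dualBasis_eq_sum_inv_toMatrix, map_sum, map_smul,
      LinearMap.sum_apply, LinearMap.smul_apply, smul_eq_mul, coe_tangentBasis hy.1]
    rfl
  exact (contMDiffAt_finsetSum fun l _ => (inverse_smooth d l).mul
    (contMDiffAt_finsetSum fun k _ => (inverse_smooth c k).mul
      (contMDiffAt_bilinear (Q.fibre.contMDiff x) hs
        (hθ.smoothSectionAt_twoFormBilin hx k l)))).congr_of_eventuallyEq expand

theorem contMDiffAt_inner {α θ : FormField m V 2} (hα : IsSmoothField α) (hθ : IsSmoothField θ) :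
    ContMDiffAt (𝓡 (m + 3)) 𝓘(ℝ, ℝ) ∞ (Q.inner α θ) x := by
  have expand : Q.inner α θ =ᶠ[𝓝 x] fun y => 2⁻¹ * ∑ c, ∑ d, Q.dualCoeff (tangentBasis x₀ y) θ c d
      (twoFormBilin (α y) (tangentFrame x₀ y c) (tangentFrame x₀ y d)) := by
    filter_upwards [(isOpen_trivDomain x₀).mem_nhds hx] with y hy
    rw [← coe_tangentBasis hy.1, sum_dualCoeff_apply_twoFormBilin,
      inv_mul_cancel_left₀ two_ne_zero]
  exact (contMDiffAt_const.mul (contMDiffAt_finsetSum fun c _ => contMDiffAt_finsetSum fun d _ =>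
    contMDiffAt_dualCoeff hx hθ c d (hα.smoothSectionAt_twoFormBilin hx c d))).congr_of_eventuallyEq
    expand

theorem dualSmoothAt_localRep_dualField {θ : FormField m V 2} (hθ : IsSmoothField θ)
    (v : Fin (m + 1) → BaseModel m) :
    DualSmoothAt (𝓡 (m + 3)) (fun y => localRep x₀ (Q.dualField x₀ θ) y v) x := by
  have expand : ∀ᶠ y in 𝓝 x, localRep x₀ (Q.dualField x₀ θ) y v = ∑ c, ∑ d,
      detContr (p := m + 1) (EuclideanSpace.basisFun (Fin (m + 3)) ℝ).toBasis c d v •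
        ExteriorAlgebra.map ((fibreTriv m V x₀).linearMapAt ℝ y)
          (contractRight (ιMulti ℝ (m + 4) (Q.adaptedFrame (tangentFrame x₀ y)))
            (Q.dualCoeff (tangentBasis x₀ y) θ c d)) := by
    filter_upwards [(isOpen_trivDomain x₀).mem_nhds hx] with y hy
    rw [localRep_apply, dualField, dualForm_apply]
    simp only [detContr_tangentBasis hy.1, coe_adaptedBasis, coe_tangentBasis hy.1, map_sum,
      map_smul]
  have frame_smooth : ∀ A, DualSmoothAt (𝓡 (m + 3)) (fun y =>
      (fibreTriv m V x₀).linearMapAt ℝ y (Q.adaptedFrame (tangentFrame x₀ y) A)) x := fun A =>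
    dualSmoothAt_iff_contMDiffAt.mpr ((smoothSectionAt_iff_linearMapAt _ _ hx.2).mp
      (Q.smoothSectionAt_adaptedFrame hx A))
  exact (DualSmoothAt.sum fun c _ => .sum fun d _ => .smul contMDiffAt_const
    (.map_contractRight_ιMulti _ _ frame_smooth fun A => contMDiffAt_dualCoeff hx hθ c d
      (Q.smoothSectionAt_adaptedFrame hx A))).congr_of_eventuallyEq expand

end Smooth

theorem smul_dualField_mem_S [ContMDiffVectorBundle ∞ (FibreModel m) V (𝓡 (m + 3))] [T2Space M]
    {x₀ : M} {θ : FormField m V 2} (hθ : θ ∈ Q.T) {χ : M → ℝ}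
    (h : IsSmoothField (fun y => χ y • Q.dualField x₀ θ y)) :
    (fun y => χ y • Q.dualField x₀ θ y) ∈ P.S := by
  refine ⟨⟨⟨fun y t => Submodule.smul_mem _ _ (Q.dualField_mem x₀ θ y t), h⟩,
    LinearMap.mem_ker.mpr (funext fun y => ?_)⟩, LinearMap.mem_ker.mpr (funext fun y => ?_)⟩
  · change wedge (m + 1) (m + 3) 1 (fun y => χ y • Q.dualField x₀ θ y) (vecForm C.e) y = 0
    rw [wedge_apply, map_smul, LinearMap.smul_apply, dualField]
    exact (congrArg (_ • χ y • ·) (dualForm_wedge_eq_zero (p := m + 1) _ _ (C.e y)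
      (Q.dualCoeff_antisymm _ θ) (Q.sum_dualCoeff_apply_e _ hθ))).trans (by simp only [smul_zero])
  · rw [bracket_apply, map_smul, LinearMap.smul_apply, dualField]
    rw [dualForm_bracket_eq_zero (p := m + 1) _ _ (C.ηlin y ∘ₗ P.eTilde y)
      (Q.dualCoeff_antisymm _ θ) (Q.sum_dualCoeff_mul_eta_eTilde_comm _ hθ)]
    rw [smul_zero]
    rfl

end AdaptedMetric

end DualField

section TopForms

theorem alternatingMap_eq_det_smul {R T A κ : Type*} [CommRing R] [AddCommGroup T] [Module R T]
    [AddCommGroup A] [Module R A] [Fintype κ] [DecidableEq κ] (b : Module.Basis κ R T)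
    (f : T [⋀^κ]→ₗ[R] A) (v : κ → T) : f v = b.det v • f b := by
  suffices h : f = (LinearMap.toSpanSingleton R A (f b)).compAlternatingMap b.det from
    DFunLike.congr_fun h v
  refine b.ext_alternating fun c hc => ?_
  have map_perm := f.map_perm b (Equiv.ofBijective c (Finite.injective_iff_bijective.mp hc))
  have det_perm := b.det.map_perm b (Equiv.ofBijective c (Finite.injective_iff_bijective.mp hc))
  rw [b.det_self] at det_perm
  refine map_perm.trans ?_
  change _ = b.det (fun i => b (c i)) • f b
  rw [show b.det (fun i => b (c i)) = _ from det_perm, smul_assoc, one_smul]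

theorem topCoeff_smul {U : Type*} [AddCommGroup U] [Module ℝ U] {n : ℕ} {b : Fin n → U}
    (hb : ιMulti ℝ n b ≠ 0) (c : ℝ) : topCoeff b (c • ιMulti ℝ n b) = c := by
  have h : ∃ c' : ℝ, c • ιMulti ℝ n b = c' • ιMulti ℝ n b := ⟨c, rfl⟩
  rw [topCoeff, dif_pos h]
  exact (smul_left_injective ℝ hb h.choose_spec).symm

end TopForms

section ChartIntegrals

variable {H M : Type*} [TopologicalSpace H] [MeasurableSpace H] [OpensMeasurableSpace H]
  {μ : Measure H} [TopologicalSpace M] {φ : OpenPartialHomeomorph M H}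

theorem integrableOn_comp_symm_target [T2Space H] [IsFiniteMeasureOnCompacts μ] {f : M → ℝ}
    (hf : ContinuousOn f φ.source) {K : Set M} (hK : IsCompact K) (hKφ : K ⊆ φ.source)
    (hfK : Function.support f ⊆ K) : IntegrableOn (f ∘ φ.symm) φ.target μ := by
  have image_subset : φ '' K ⊆ φ.target := (image_mono hKφ).trans φ.image_source_eq_target.subset
  have compact_image : IsCompact (φ '' K) := hK.image_of_continuousOn (φ.continuousOn.mono hKφ)
  have continuousOn_image : ContinuousOn (f ∘ φ.symm) (φ '' K) :=
    (hf.comp φ.continuousOn_symm φ.mapsTo_symm).mono image_subset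
  refine (continuousOn_image.integrableOn_compact compact_image).of_forall_sdiff_eq_zero
    φ.open_target.measurableSet fun z hz => ?_
  by_contra hne
  exact hz.2 ⟨φ.symm z, hfK hne, φ.right_inv hz.1⟩

theorem eqOn_zero_of_setIntegral_comp_symm_eq_zero [μ.IsOpenPosMeasure] {f : M → ℝ}
    (hf : ContinuousOn f φ.source) (hf0 : ∀ x ∈ φ.source, 0 ≤ f x)
    (hint : IntegrableOn (f ∘ φ.symm) φ.target μ)
    (h : ∫ z in φ.target, f (φ.symm z) ∂μ = 0) : EqOn f 0 φ.source := by
  have ae_nonneg : 0 ≤ᵐ[μ.restrict φ.target] f ∘ φ.symm :=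
    ae_restrict_of_forall_mem φ.open_target.measurableSet fun z hz => hf0 _ (φ.map_target hz)
  have ae_zero := (setIntegral_eq_zero_iff_of_nonneg_ae ae_nonneg hint).mp h
  have eqOn_target := Measure.eqOn_open_of_ae_eq ae_zero φ.open_target
    (hf.comp φ.continuousOn_symm φ.mapsTo_symm) continuousOn_const
  intro x hx
  simpa only [Function.comp_apply, φ.left_inv hx, Pi.zero_apply] using
    eqOn_target (φ.map_source hx)

variable {I : Type*} {c : M → ℝ} {w : I → M → ℝ}

/-- Nonnegativity rules out cancellation between the charts. -/
theorem eq_zero_of_finsum_setIntegral_eq_zero [T2Space H] [IsFiniteMeasureOnCompacts μ]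
    [μ.IsOpenPosMeasure] {φ : I → OpenPartialHomeomorph M H} {ρ : PartitionOfUnity I M}
    (hρ : ρ.IsSubordinate fun i => (φ i).source) (hc : Continuous c) (hc0 : ∀ x, 0 ≤ c x)
    (hcs : HasCompactSupport c) (hw : ∀ i, ContinuousOn (w i) (φ i).source)
    (hw_pos : ∀ i, ∀ x ∈ (φ i).source, 0 < w i x)
    (h : ∑ᶠ i, ∫ z in (φ i).target, ρ i ((φ i).symm z) *
      (c ((φ i).symm z) * w i ((φ i).symm z)) ∂μ = 0) (x : M) : c x = 0 := by
  let f : I → M → ℝ := fun i y => ρ i y * (c y * w i y)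
  have f_nonneg : ∀ i, ∀ y ∈ (φ i).source, 0 ≤ f i y := fun i y hy =>
    mul_nonneg (ρ.nonneg i y) (mul_nonneg (hc0 y) (hw_pos i y hy).le)
  have integral_nonneg : ∀ i, 0 ≤ ∫ z in (φ i).target, f i ((φ i).symm z) ∂μ := fun i =>
    setIntegral_nonneg (φ i).open_target.measurableSet fun z hz =>
      f_nonneg i _ ((φ i).map_target hz)
  have f_continuous : ∀ i, ContinuousOn (f i) (φ i).source := fun i =>
    (ρ i).continuous.continuousOn.mul (hc.continuousOn.mul (hw i))
  have f_support : ∀ i, Function.support (f i) ⊆ tsupport (ρ i) ∩ tsupport c := fun i y hy =>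
    ⟨subset_tsupport _ (left_ne_zero_of_mul hy),
      subset_tsupport _ (left_ne_zero_of_mul (right_ne_zero_of_mul hy))⟩
  have f_integrable : ∀ i, IntegrableOn (f i ∘ (φ i).symm) (φ i).target μ := fun i =>
    integrableOn_comp_symm_target (f_continuous i)
      (hcs.isCompact.inter_left (isClosed_tsupport _)) (fun y hy => hρ i hy.1) (f_support i)
  have finite_support :
      (Function.support fun i => ∫ z in (φ i).target, f i ((φ i).symm z) ∂μ).Finite := by
    refine (ρ.locallyFinite.finite_nonempty_inter_compact hcs.isCompact).subset fun i hi => ?_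
    by_contra hne
    refine hi (setIntegral_eq_zero_of_forall_eq_zero fun z _ => ?_)
    by_contra hz
    exact hne ⟨_, left_ne_zero_of_mul hz, (f_support i hz).2⟩
  obtain ⟨i, hi⟩ := ρ.exists_pos (mem_univ x)
  have x_mem : x ∈ (φ i).source := hρ i (subset_tsupport _ hi.ne')
  have integral_eq_zero : ∫ z in (φ i).target, f i ((φ i).symm z) ∂μ = 0 :=
    ((single_le_finsum i finite_support integral_nonneg).trans_eq h).antisymm (integral_nonneg i)
  have f_eq_zero : f i x = 0 := eqOn_zero_of_setIntegral_comp_symm_eq_zero (f_continuous i)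
    (f_nonneg i) (f_integrable i) integral_eq_zero x_mem
  exact (mul_eq_zero.mp ((mul_eq_zero.mp f_eq_zero).resolve_left hi.ne')).resolve_right
    (hw_pos i x x_mem).ne'

end ChartIntegrals

section Densities

variable {m : ℕ} {M : Type*} [TopologicalSpace M] [ChartedSpace (BaseModel m) M]
  [IsManifold (𝓡 (m + 3)) ∞ M]
  {V : M → Type*} [∀ x, AddCommGroup (V x)] [∀ x, Module ℝ (V x)] [∀ x, TopologicalSpace (V x)]
  [TopologicalSpace (TotalSpace (FibreModel m) V)] [FiberBundle (FibreModel m) V]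
  [VectorBundle ℝ (FibreModel m) V]

theorem BoundaryCoframe.ηlin_nondegenerate (C : BoundaryCoframe m V) (x : M) :
    LinearMap.BilinForm.Nondegenerate (C.ηlin x) := by
  obtain ⟨b, hb⟩ := C.η_lorentz x
  have orthogonal : LinearMap.BilinForm.iIsOrtho (C.ηlin x) b := fun i j hij =>
    (hb i j).trans (if_neg hij)
  refine (orthogonal.nondegenerate_iff_not_isOrtho_basis_self _ b).mpr fun i => ?_
  rw [C.ηlin_apply, hb, if_pos rfl]
  split_ifs <;> norm_num

theorem BoundaryCoframe.smoothSectionAt_e_comp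
    [ContMDiffVectorBundle ∞ (FibreModel m) V (𝓡 (m + 3))] (C : BoundaryCoframe m V)
    {s : ∀ x : M, TangentSpace (𝓡 (m + 3)) x} {x : M}
    (hs : SmoothSectionAt (𝓡 (m + 3)) (BaseModel m) s x) :
    SmoothSectionAt (𝓡 (m + 3)) (FibreModel m) (fun y => C.e y (s y)) x := by
  have hx := mem_trivDomain (m := m) (V := V) x
  rw [smoothSectionAt_iff_linearMapAt _ _ hx.2]
  let B := (EuclideanSpace.basisFun (Fin (m + 3)) ℝ).toBasis
  have expansion_smooth : ContMDiffAt (𝓡 (m + 3)) 𝓘(ℝ, FibreModel m) ∞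
      (fun y => ∑ d, B.coord d ((tangentTriv m x).linearMapAt ℝ y (s y)) •
        (fibreTriv m V x).linearMapAt ℝ y (C.e y ((tangentTriv m x).symmL ℝ y (B d)))) x :=
    contMDiffAt_finsetSum fun d _ =>
      (dualSmoothAt_iff_contMDiffAt.mpr
        ((smoothSectionAt_iff_linearMapAt _ _ hx.1).mp hs) (B.coord d)).smul
        ((smoothSectionAt_iff_linearMapAt _ _ hx.2).mp (C.smoothSectionAt_e hx (B d)))
  refine expansion_smooth.congr_of_eventuallyEq ?_
  filter_upwards [(isOpen_trivDomain x).mem_nhds hx] with y hy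
  have symmL_linearMapAt : (tangentTriv m x).symmL ℝ y ((tangentTriv m x).linearMapAt ℝ y (s y)) =
      s y := Trivialization.symmₗ_linearMapAt (R := ℝ) _ hy.1 (s y)
  conv_lhs => rw [← symmL_linearMapAt, ← B.sum_repr ((tangentTriv m x).linearMapAt ℝ y (s y))]
  simp only [map_sum, map_smul]
  rfl

namespace AdaptedMetric

variable {C : BoundaryCoframe m V} {P : NullSplitting C} (Q : AdaptedMetric P)

theorem ιMulti_adaptedFrame {x : M}
    (b : Module.Basis (Fin (m + 3)) ℝ (TangentSpace (𝓡 (m + 3)) x))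
    (v : Fin (m + 3) → TangentSpace (𝓡 (m + 3)) x) :
    ιMulti ℝ (m + 4) (Q.adaptedFrame v) = b.det v • ιMulti ℝ (m + 4) (Q.adaptedFrame b) := by
  have ιMulti_mul_en : ∀ w : Fin (m + 3) → TangentSpace (𝓡 (m + 3)) x,
      ιMulti ℝ (m + 4) (Q.adaptedFrame w) = (LinearMap.mulRight ℝ (ι ℝ (Q.en x))).compAlternatingMap
        ((ιMulti ℝ (m + 3)).compLinearMap (C.e x)) w := fun w => by
    rw [ιMulti_succ_last (k := m + 3), adaptedFrame, Fin.init_snoc, Fin.snoc_last]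
    rfl
  simpa only [ιMulti_mul_en] using alternatingMap_eq_det_smul b _ v

/-- The `η`-volume of the adapted frame of the coordinate frame at `i`. The coefficient of a top
form with respect to this frame is multiplied by it to give the density of the form. -/
def volumeWeight (i x : M) : ℝ :=
  √|(Matrix.of fun a b => C.η x (Q.adaptedFrame (tangentFrame i x) a)
    (Q.adaptedFrame (tangentFrame i x) b)).det|

theorem density_eq (φ : FormField m V (m + 3)) (i x : M) : Q.density φ i x =
    topCoeff (Q.adaptedFrame (tangentFrame i x)) (φ x (tangentFrame i x)) * Q.volumeWeight i x :=
  rfl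

theorem volumeWeight_pos {i x : M} (hx : x ∈ (tangentTriv m i).baseSet) :
    0 < Q.volumeWeight i x := by
  have det_ne_zero := (LinearMap.BilinForm.nondegenerate_iff_det_ne_zero
    (Q.adaptedBasis (tangentBasis i x))).mp (C.ηlin_nondegenerate x)
  refine Real.sqrt_pos.mpr (abs_pos.mpr ?_)
  rw [← coe_tangentBasis hx, ← coe_adaptedBasis]
  convert det_ne_zero using 2
  ext a b
  exact (LinearMap.BilinForm.toMatrix_apply
    (Q.adaptedBasis (tangentBasis i x)) (C.ηlin x) a b).symm

theorem density_of_eq_smul {φ : FormField m V (m + 3)} {i x : M}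
    (hx : x ∈ (tangentTriv m i).baseSet)
    (b : Module.Basis (Fin (m + 3)) ℝ (TangentSpace (𝓡 (m + 3)) x)) {c : ℝ}
    (h : φ x = c • tensorForm b.det (ιMulti ℝ (m + 4) (Q.adaptedBasis b))) :
    Q.density φ i x = c * Q.volumeWeight i x := by
  have frame_ne_zero := ιMulti_basis_ne_zero (Q.adaptedBasis (tangentBasis i x))
  rw [coe_adaptedBasis, coe_tangentBasis hx] at frame_ne_zero
  rw [density_eq, h, AlternatingMap.smul_apply, tensorForm_apply, coe_adaptedBasis,
    ← ιMulti_adaptedFrame, topCoeff_smul frame_ne_zero]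

variable [ContMDiffVectorBundle ∞ (FibreModel m) V (𝓡 (m + 3))]

theorem continuousAt_volumeWeight {i x : M} (hx : x ∈ (tangentTriv m i).baseSet) :
    ContinuousAt (Q.volumeWeight i) x := by
  have frame_smooth : ∀ A, SmoothSectionAt (𝓡 (m + 3)) (FibreModel m)
      (fun y => Q.adaptedFrame (tangentFrame i y) A) x := by
    refine Fin.lastCases ?_ fun c => ?_
    · simpa only [adaptedFrame, Fin.snoc_last] using Q.en_smooth x
    · simpa only [adaptedFrame, Fin.snoc_castSucc] using
        C.smoothSectionAt_e_comp (smoothSectionAt_tangentFrame hx c)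
  have det_smooth := contMDiffAt_det (I := 𝓡 (m + 3)) fun a b =>
    contMDiffAt_bilinear (C.η_smooth x) (frame_smooth a) (frame_smooth b)
  exact det_smooth.continuousAt.abs.sqrt

theorem coefficient_eq_zero_of_integral_eq_zero [T2Space M] [SigmaCompactSpace M]
    {φ : FormField m V (m + 3)} {c : M → ℝ} (hc : Continuous c) (hc0 : ∀ x, 0 ≤ c x)
    (hcs : HasCompactSupport c)
    (hφ : ∀ i, ∀ x ∈ (tangentTriv m i).baseSet, Q.density φ i x = c x * Q.volumeWeight i x)
    (h : Q.integral φ = 0) (x : M) : c x = 0 := by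
  have base_eq : ∀ i : M, (tangentTriv m i).baseSet = (chartAt (BaseModel m) i).source :=
    fun i => TangentBundle.trivializationAt_baseSet i
  have subordinate :=
    (SmoothPartitionOfUnity.exists_isSubordinate_chartAt_source (𝓡 (m + 3)) M).choose_spec
  refine eq_zero_of_finsum_setIntegral_eq_zero (μ := volume) (w := Q.volumeWeight)
    subordinate.toPartitionOfUnity hc hc0 hcs
    (fun i y hy => (Q.continuousAt_volumeWeight ((base_eq i).symm ▸ hy)).continuousWithinAt)
    (fun i y hy => Q.volumeWeight_pos ((base_eq i).symm ▸ hy)) ?_ x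
  refine Eq.trans (finsum_congr fun i => ?_) h
  refine setIntegral_congr_fun (chartAt (BaseModel m) i).open_target.measurableSet fun z hz => ?_
  have density_eq := hφ i _ ((base_eq i).symm ▸ (chartAt (BaseModel m) i).map_target hz)
  simp only [density_eq]
  rfl

end AdaptedMetric

end Densities

section Positivity

theorem exists_orthogonal_basis_of_isSymm {𝕜 T : Type*} [Field 𝕜] [Invertible (2 : 𝕜)]
    [AddCommGroup T] [Module 𝕜 T] {n : ℕ} (b : Module.Basis (Fin n) 𝕜 T)
    {h : LinearMap.BilinForm 𝕜 T} (hs : h.IsSymm) :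
    ∃ b' : Module.Basis (Fin n) 𝕜 T, h.iIsOrtho b' := by
  have : FiniteDimensional 𝕜 T := b.finiteDimensional_of_finite
  obtain ⟨v, hv⟩ := LinearMap.BilinForm.exists_orthogonal_basis (B := h) ⟨hs.eq⟩
  have finrank_eq : Module.finrank 𝕜 T = n := by
    rw [Module.finrank_eq_card_basis b, Fintype.card_fin]
  refine ⟨v.reindex (finCongr finrank_eq), fun i j hij => ?_⟩
  simp only [Function.onFun, Module.Basis.reindex_apply]
  exact hv ((finCongr finrank_eq).symm.injective.ne hij)

theorem dualBasis_eq_inv_smul_of_iIsOrtho {𝕜 T κ : Type*} [Field 𝕜] [AddCommGroup T] [Module 𝕜 T]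
    [Finite κ] [DecidableEq κ] {h : LinearMap.BilinForm 𝕜 T} (hh : h.Nondegenerate)
    {b : Module.Basis κ 𝕜 T} (hb : h.iIsOrtho b) (a : κ) :
    h.dualBasis hh b a = (h (b a) (b a))⁻¹ • b a := by
  refine congrFun ((h.dualBasis_eq_iff hh b fun a => (h (b a) (b a))⁻¹ • b a).mpr
    fun a c => ?_) a
  rw [map_smul, LinearMap.smul_apply, smul_eq_mul]
  split_ifs with hac
  · rw [hac, inv_mul_cancel₀ (hb.not_isOrtho_basis_self_of_nondegenerate hh a)]
  · rw [show h (b a) (b c) = 0 from hb (Ne.symm hac), mul_zero]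

variable {T U : Type*} [AddCommGroup T] [Module ℝ T] [AddCommGroup U] [Module ℝ U] {n : ℕ}
  {h : LinearMap.BilinForm ℝ T} {q : LinearMap.BilinForm ℝ U}

theorem eq_zero_of_twoFormBilin_basis_eq_zero {α : T [⋀^Fin 2]→ₗ[ℝ] ExteriorAlgebra ℝ U}
    (hα : ∀ t, α t ∈ ⋀[ℝ]^1 U) (b : Module.Basis (Fin n) ℝ T)
    (h : ∀ a c, twoFormBilin α (b a) (b c) = 0) : α = 0 := by
  refine b.ext_alternating fun v _ => ?_
  have vec_eq : (fun i => b (v i)) = ![b (v 0), b (v 1)] := by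
    funext i
    fin_cases i <;> rfl
  rw [vec_eq, ← ι_twoFormBilin hα, h, map_zero, AlternatingMap.zero_apply]

theorem eq_zero_of_twoFormInner_self (hs : h.IsSymm) (hh : ∀ t ≠ 0, 0 < h t t)
    (hq : ∀ u ≠ 0, 0 < q u u) (b : Module.Basis (Fin n) ℝ T)
    {α : T [⋀^Fin 2]→ₗ[ℝ] ExteriorAlgebra ℝ U} (hα : ∀ t, α t ∈ ⋀[ℝ]^1 U)
    (inner_eq_zero : twoFormInner b (fun u w => h u w) q α α = 0) : α = 0 := by
  have : Invertible (2 : ℝ) := invertibleOfNonzero two_ne_zero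
  obtain ⟨b', hb'⟩ := exists_orthogonal_basis_of_isSymm b hs
  have hh' : h.Nondegenerate := (hb'.nondegenerate_iff_not_isOrtho_basis_self _ b').mpr fun a =>
    (hh _ (b'.ne_zero a)).ne'
  have q_nonneg : ∀ u, 0 ≤ q u u := fun u => by
    obtain rfl | hu := eq_or_ne u 0
    · rw [map_zero]
    · exact (hq u hu).le
  have coeff_pos : ∀ a c, 0 < (h (b' a) (b' a))⁻¹ * (h (b' c) (b' c))⁻¹ := fun a c =>
    mul_pos (inv_pos.mpr (hh _ (b'.ne_zero a))) (inv_pos.mpr (hh _ (b'.ne_zero c)))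
  have term_nonneg : ∀ a c, 0 ≤ (h (b' a) (b' a))⁻¹ * (h (b' c) (b' c))⁻¹ *
      q (twoFormBilin α (b' a) (b' c)) (twoFormBilin α (b' a) (b' c)) := fun a c =>
    mul_nonneg (coeff_pos a c).le (q_nonneg _)
  have sum_eq_zero : ∑ a, ∑ c, (h (b' a) (b' a))⁻¹ * (h (b' c) (b' c))⁻¹ *
      q (twoFormBilin α (b' a) (b' c)) (twoFormBilin α (b' a) (b' c)) = 0 := by
    rw [← twoFormInner_basis_change hh' b b',
      twoFormInner_eq_sum_dualBasis hh'] at inner_eq_zero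
    simpa [dualBasis_eq_inv_smul_of_iIsOrtho hh' hb', mul_assoc, mul_left_comm] using
      inner_eq_zero
  refine eq_zero_of_twoFormBilin_basis_eq_zero hα b' fun a c => ?_
  by_contra hne
  have term_eq_zero := (Finset.sum_eq_zero_iff_of_nonneg fun c _ => term_nonneg a c).mp
    ((Finset.sum_eq_zero_iff_of_nonneg fun a _ => Finset.sum_nonneg fun c _ => term_nonneg a c).mp
      sum_eq_zero a (Finset.mem_univ a)) c (Finset.mem_univ c)
  exact (mul_pos (coeff_pos a c) (hq _ hne)).ne' term_eq_zero

end Positivity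

section Nondegeneracy

variable {m : ℕ} {M : Type*} [TopologicalSpace M] [ChartedSpace (BaseModel m) M]
  [IsManifold (𝓡 (m + 3)) ∞ M]
  {V : M → Type*} [∀ x, AddCommGroup (V x)] [∀ x, Module ℝ (V x)] [∀ x, TopologicalSpace (V x)]
  [TopologicalSpace (TotalSpace (FibreModel m) V)] [FiberBundle (FibreModel m) V]
  [VectorBundle ℝ (FibreModel m) V]

namespace AdaptedMetric

variable {C : BoundaryCoframe m V} {P : NullSplitting C} (Q : AdaptedMetric P)

theorem inner_sub (α θ θ' : FormField m V 2) (x : M) :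
    Q.inner (α - θ) θ' x = Q.inner α θ' x - Q.inner θ θ' x := by
  have inner_add : Q.inner (α - θ + θ) θ' x = Q.inner (α - θ) θ' x + Q.inner θ θ' x :=
    twoFormInner_add _ _ _ _ _ _
  rw [sub_add_cancel] at inner_add
  exact eq_sub_of_add_eq inner_add.symm

variable {Q}

theorem eq_zero_of_inner_self {θ : FormField m V 2} (hθ : ∀ x t, θ x t ∈ ⋀[ℝ]^1 (V x))
    (h : ∀ x, Q.inner θ θ x = 0) : θ = 0 := by
  funext x
  exact eq_zero_of_twoFormInner_self (Q.baseLin_isSymm x) (Q.base.pos x) (Q.fibre.pos x) _ (hθ x)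
    (h x)

variable [ContMDiffVectorBundle ∞ (FibreModel m) V (𝓡 (m + 3))] [T2Space M]

theorem smul_inner_smul_dualField_mem_S {α θ : FormField m V 2} (hα : IsSmoothField α)
    (hθ : θ ∈ Q.T) {x₀ : M} {χ : M → ℝ} (hχ : ContMDiff (𝓡 (m + 3)) 𝓘(ℝ, ℝ) ∞ χ)
    (hχU : tsupport χ ⊆ trivDomain m V x₀) :
    (fun y => (χ y * Q.inner α θ y) • Q.dualField x₀ θ y) ∈ P.S := by
  refine Q.smul_dualField_mem_S hθ ?_
  simp only [mul_smul]
  refine isSmoothField_smul_of_tsupport_subset hχ hχU fun v x hx => ?_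
  have localRep_smul : ∀ y, localRep x₀ (fun y => Q.inner α θ y • Q.dualField x₀ θ y) y v =
      Q.inner α θ y • localRep x₀ (Q.dualField x₀ θ) y v := fun y => by
    simp only [localRep_apply, AlternatingMap.smul_apply, map_smul]
  simp only [localRep_smul]
  exact (dualSmoothAt_localRep_dualField hx hθ.1.1.2 v).smul (contMDiffAt_inner hx hα hθ.1.1.2)

theorem inner_eq_zero_of_integral [SigmaCompactSpace M] {α θ : FormField m V 2}
    (hα : α ∈ Omega m V 2 1) (hθ : θ ∈ Q.T)
    (h : ∀ τ ∈ P.S, CompactlySupported τ → Q.integral (wedge (m + 1) (m + 3) 2 τ α) = 0)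
    (x₀ : M) : Q.inner α θ x₀ = 0 := by
  obtain ⟨χ, χ_smooth, χ_compact, χ_support, χ_self, χ_nonneg⟩ :=
    exists_smooth_bump_trivDomain (m := m) (V := V) x₀
  let τ : FormField m V (m + 1) := fun y => (χ y * Q.inner α θ y) • Q.dualField x₀ θ y
  have τ_mem : τ ∈ P.S := smul_inner_smul_dualField_mem_S hα.2 hθ χ_smooth χ_support
  have τ_compact : CompactlySupported τ :=
    χ_compact.isCompact.of_isClosed_subset isClosed_closure <| closure_mono fun y hy => by
      exact fun χ_zero => hy (by simp only [τ, χ_zero, zero_mul, zero_smul])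
  have inner_continuous : Continuous (Q.inner α θ) := continuous_iff_continuousAt.mpr fun x =>
    (contMDiffAt_inner (mem_trivDomain x) hα.2 hθ.1.1.2).continuousAt
  have wedge_τ : ∀ x, wedge (m + 1) (m + 3) 2 τ α x = (χ x * (2 * Q.inner α θ x ^ 2)) •
      tensorForm (tangentBasis x₀ x).det
        (ιMulti ℝ (m + 4) (Q.adaptedBasis (tangentBasis x₀ x))) := fun x => by
    have wedge_smul : wedge (m + 1) (m + 3) 2 τ α x = (χ x * Q.inner α θ x) •
        wedge (m + 1) (m + 3) 2 (Q.dualField x₀ θ) α x := by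
      simp only [wedge_apply, τ, map_smul, LinearMap.smul_apply]
      exact smul_comm _ _ _
    rw [wedge_smul, Q.wedge_dualField x₀ x θ (hα.1 x), smul_smul]
    congr 1
    ring
  have coefficient_zero := Q.coefficient_eq_zero_of_integral_eq_zero
    (c := fun x => χ x * (2 * Q.inner α θ x ^ 2))
    (χ_smooth.continuous.mul (continuous_const.mul (inner_continuous.pow 2)))
    (fun x => mul_nonneg (χ_nonneg x) (mul_nonneg zero_le_two (sq_nonneg _)))
    χ_compact.mul_right (fun i x hx => Q.density_of_eq_smul hx _ (wedge_τ x))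
    (h τ τ_mem τ_compact) x₀
  simpa [χ_self] using coefficient_zero

end AdaptedMetric

end Nondegeneracy

end PalatiniCartan

end

open PalatiniCartan in
theorem mainTheorem6 (m : ℕ) {M : Type*} [TopologicalSpace M] [T2Space M] [SigmaCompactSpace M]
    [ChartedSpace (BaseModel m) M] [IsManifold (𝓡 (m + 3)) ∞ M]
    (V : M → Type*) [∀ x, AddCommGroup (V x)] [∀ x, Module ℝ (V x)]
    [∀ x, TopologicalSpace (V x)] [∀ x, IsTopologicalAddGroup (V x)]
    [∀ x, ContinuousSMul ℝ (V x)]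
    [TopologicalSpace (TotalSpace (FibreModel m) V)] [FiberBundle (FibreModel m) V]
    [VectorBundle ℝ (FibreModel m) V] [ContMDiffVectorBundle ∞ (FibreModel m) V (𝓡 (m + 3))]
    (C : BoundaryCoframe m V) (P : NullSplitting C) (Q : AdaptedMetric P) :
    (∀ α ∈ Omega m V 2 1,
      (∀ τ ∈ P.S, CompactlySupported τ → Q.integral (wedge (m + 1) (m + 3) 2 τ α) = 0) →
      ∀ θ, Q.IsProjT α θ ↔ θ = 0) ∧
    (∀ θ ∈ Q.T,
      (∀ τ ∈ P.S, CompactlySupported τ → Q.integral (wedge (m + 1) (m + 3) 2 τ θ) = 0) →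
      θ = 0) := by
  refine ⟨fun α hα pairing_zero θ => ⟨fun ⟨hθ, orthogonal⟩ => ?_, ?_⟩, fun θ hθ pairing_zero =>
    AdaptedMetric.eq_zero_of_inner_self hθ.1.1.1
      (AdaptedMetric.inner_eq_zero_of_integral hθ.1.1 hθ pairing_zero)⟩
  · refine AdaptedMetric.eq_zero_of_inner_self (Q := Q) hθ.1.1.1 fun x => ?_
    have inner_sub := AdaptedMetric.inner_sub Q α θ θ x
    rw [orthogonal θ hθ x, AdaptedMetric.inner_eq_zero_of_integral hα hθ pairing_zero x]
      at inner_sub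
    linarith
  · rintro rfl
    refine ⟨zero_mem _, fun θ' hθ' x => ?_⟩
    rw [sub_zero]
    exact AdaptedMetric.inner_eq_zero_of_integral hα hθ' pairing_zero x
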